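/- **Notation.** Let $d\ge 1$, let $B(x,R)$ be the open Euclidean ball in $\mathbb R^d$, and let $\mathcal S'/\mathcal P$ be the space of complex tempered distributions on $\mathbb R^d$ modulo polynomials, with the quotient topology (of the weak-$*$ topology of $\mathcal S'$). Fix a dyadic partition of unity: smooth radial functions $\psi,\phi:\mathbb R^d\to[0,1]$ with $\operatorname{supp}\psi\subset B(0,\frac43)$, $\operatorname{supp}\phi\subset\{\frac34\le|\eta|\le\frac83\}$, $\psi(\eta)+\sum_{l\ge0}\phi(2^{-l}\eta)=1$ for all $\eta$ and $\sum_{l\in\mathbb Z}\phi(2^{-l}\eta)=1$ for all $\eta\ne0$; put $\dot\Delta_l g=\mathcal F^{-1}[\phi(2^{-l}\cdot)\hat g]$ for $g\in\mathcal S'/\mathcal P$. For $\vec q\in[1,\infty)^d$ let $$\|f\|_{L^{\vec q}(\mathbb R^d)}=\Big(\int_{\mathbb R}\cdots\Big(\int_{\mathbb R}|f(x_1,\dots,x_d)|^{q_1}dx_1\Big)^{q_2/q_1}\cdots dx_d\Big)^{1/q_d},$$ and for $\vec\lambda\in[0,1)^d$ let $$\|f\|_{\mathcal M_{\vec q,\vec\lambda}(\mathbb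 R^d)}=\sup_{x\in\mathbb R^d,\,R>0}R^{-\sum_{i}\lambda_i/q_i}\|f\chi_{B(x,R)}\|_{L^{\vec q}(\mathbb R^d)}.$$ For $\sigma\in\mathbb R$ and $r\in[1,\infty]$, $\dot{\mathcal N}^{\sigma}_{\vec q,\vec\lambda,r}(\mathbb R^d)$ (respectively $\dot{\mathcal B}^{\sigma}_{\infty,r}(\mathbb R^d)$) is the set of $g\in\mathcal S'/\mathcal P$ for which the $\ell^r(\mathbb Z)$-norm of $l\mapsto 2^{l\sigma}\|\dot\Delta_l g\|_{\mathcal M_{\vec q,\vec\lambda}}$ (respectively of $l\mapsto2^{l\sigma}\|\dot\Delta_lg\|_{L^\infty}$) is finite, with this norm. Write $X\hookrightarrow Y$ for a continuous inclusion. **Theorem 1.1.** The following hold. (i) Let $\vec q\in[1,\infty)^d$ and $\vec\lambda\in[0,1)^d$. There is a constant $C$ such that, for all $l\in\mathbb Z$ and all $f\in\mathcal S'/\mathcal P$ with $\dot\Delta_l f\in\mathcal M_{\vec q,\vec\lambda}(\mathbb R^d)$, $$\|\dot\Delta_l f\|_{L^\infty(\mathbb R^d)}\le C\,2^{l\sum_{i=1}^d\frac{1-\lambda_i}{q_i}}\,\|\dot\Delta_l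 f\|_{\mathcal M_{\vec q,\vec\lambda}(\mathbb R^d)}.$$ (ii) Let $\vec q,\vec r\in[1,\infty)^d$, $\vec\lambda,\vec\mu\in[0,1)^d$, $a\in[1,\infty]$ and $\sigma\in\mathbb R$. (ii.1) If $q_i\le r_i$, $\frac{\lambda_i}{q_i}\ge\frac{\mu_i}{r_i}$ and $\frac{1-\lambda_i}{q_i}=\frac{1-\mu_i}{r_i}$ for $1\le i\le d$, then $\dot{\mathcal N}^\sigma_{\vec r,\vec\mu,a}(\mathbb R^d)\hookrightarrow\dot{\mathcal N}^\sigma_{\vec q,\vec\lambda,a}(\mathbb R^d)$. (ii.2) If $b\in[1,\infty]$ and $a\le b$, then $\dot{\mathcal N}^\sigma_{\vec q,\vec\lambda,a}(\mathbb R^d)\hookrightarrow\dot{\mathcal N}^\sigma_{\vec q,\vec\lambda,b}(\mathbb R^d)$. In (iii)–(v) let $\vec q\in[1,\infty)^d$, $\vec\lambda\in[0,1)^d$, $r\in[1,\infty]$ and $s\in\mathbb R$. (iii) $\dot{\mathcal N}^{s}_{\vec q,\vec\lambda,r}(\mathbb R^d)\hookrightarrow\dot{\mathcal B}^{\,s-\sum_{i=1}^d\frac{1-\lambda_i}{q_i}}_{\infty,r}(\mathbb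 R^d)$. (iv) For $\theta\in(0,1)$, $\dot{\mathcal N}^{s}_{\vec q,\vec\lambda,r}(\mathbb R^d)\hookrightarrow\dot{\mathcal N}^{\,s-\left(\sum_{i=1}^d\frac{1-\lambda_i}{q_i}\right)(1-\theta)}_{\vec q/\theta,\vec\lambda,r}(\mathbb R^d)$. (v) $\dot{\mathcal N}^{s}_{\vec q,\vec\lambda,r}(\mathbb R^d)$ is a Banach space, and $\dot{\mathcal N}^{s}_{\vec q,\vec\lambda,r}(\mathbb R^d)\hookrightarrow\mathcal S'/\mathcal P$. (vi) Let $1\le d_1<d_2$, $\vec q\in[1,\infty)^{d_2}$, $\vec\lambda\in[0,1)^{d_1}$, $\vec\beta\in[0,1)^{d_2}$, $r\in[1,\infty]$, $s\in\mathbb R$, and write $x=(x',x'')\in\mathbb R^{d_1}\times\mathbb R^{d_2-d_1}$. If $$\sum_{i=1}^{d_2}\frac{1-\beta_i}{q_i}=\sum_{i=1}^{d_1}\frac{1-\lambda_i}{q_i},$$ then every element $u(x')$ of $\dot{\mathcal N}^{s}_{(q_1,\dots,q_{d_1}),\vec\lambda,r}(\mathbb R^{d_1})$, regarded as a distribution in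 $x$ that does not depend on $x''$, that is, $\langle u,g\rangle=\langle u,\int g(\cdot,x'')\,dx''\rangle$ for $g\in\mathcal S(\mathbb R^{d_2})$, is an element of $\dot{\mathcal N}^{s}_{\vec q,\vec\beta,r}(\mathbb R^{d_2})$. -/

import Mathlib

open MeasureTheory
open scoped SchwartzMap ENNReal NNReal FourierTransform LineDeriv

noncomputable section

namespace BesovMixedMorrey

/-- The Euclidean space `ℝ^d`. -/
abbrev E (d : ℕ) : Type := EuclideanSpace ℝ (Fin d)

/-! ### Tempered distributions modulo polynomials -/

/-- The function on `ℝ^d` given by a complex polynomial in the coordinates. -/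
def polyFun {d : ℕ} (p : MvPolynomial (Fin d) ℂ) (x : E d) : ℂ :=
  MvPolynomial.eval (fun i => ((x i : ℝ) : ℂ)) p

theorem coord_hasTemperateGrowth {d : ℕ} (i : Fin d) :
    Function.HasTemperateGrowth (fun x : E d => ((x i : ℝ) : ℂ)) :=
  (Complex.ofRealCLM.comp (EuclideanSpace.proj (𝕜 := ℝ) i)).hasTemperateGrowth

theorem polyFun_hasTemperateGrowth {d : ℕ} (p : MvPolynomial (Fin d) ℂ) :
    Function.HasTemperateGrowth (polyFun p) := by
  induction p using MvPolynomial.induction_on with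
  | C a =>
    have : polyFun (d := d) (MvPolynomial.C a) = fun _ => a := by
      ext x; simp [polyFun]
    rw [this]; exact .const a
  | add p q hp hq =>
    have : polyFun (p + q) = polyFun p + polyFun q := by
      ext x; simp [polyFun]
    rw [this]; exact hp.add hq
  | mul_X p i hp =>
    have : polyFun (p * MvPolynomial.X i) = fun x => polyFun p x * ((x i : ℝ) : ℂ) := by
      ext x; simp [polyFun]
    rw [this]; exact hp.mul (coord_hasTemperateGrowth i)

/-- The tempered distribution `g ↦ ∫ g(x) p(x) dx` given by a polynomial `p`. -/
def polyDist {d : ℕ} (p : MvPolynomial (Fin d) ℂ) : 𝓢'(E d, ℂ) :=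
  (polyFun_hasTemperateGrowth p).toTemperedDistribution volume

theorem polyDist_apply {d : ℕ} (p : MvPolynomial (Fin d) ℂ) (g : 𝓢(E d, ℂ)) :
    polyDist p g = ∫ x, g x * polyFun p x := rfl

theorem integrable_mul_polyFun {d : ℕ} (p : MvPolynomial (Fin d) ℂ) (g : 𝓢(E d, ℂ)) :
    Integrable (fun x => g x * polyFun p x) :=
  (SchwartzMap.bilinLeftCLM (ContinuousLinearMap.lsmul ℂ ℂ)
    (polyFun_hasTemperateGrowth p) g).integrable

/-- The space `𝒫` of polynomials, inside `𝒮'(ℝ^d)`. -/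
def polynomials (d : ℕ) : Submodule ℂ 𝓢'(E d, ℂ) where
  carrier := Set.range polyDist
  zero_mem' := ⟨0, by ext g; simp [polyDist_apply, polyFun]⟩
  add_mem' := by
    rintro _ _ ⟨p, rfl⟩ ⟨q, rfl⟩
    refine ⟨p + q, ?_⟩
    ext g
    change polyDist (p + q) g = polyDist p g + polyDist q g
    simp only [polyDist_apply]
    rw [← integral_add (integrable_mul_polyFun p g) (integrable_mul_polyFun q g)]
    simp [polyFun, mul_add]
  smul_mem' := by
    rintro c _ ⟨p, rfl⟩
    refine ⟨MvPolynomial.C c * p, ?_⟩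
    ext g
    change polyDist (MvPolynomial.C c * p) g = c * polyDist p g
    simp only [polyDist_apply]
    rw [← integral_const_mul]
    simp [polyFun, mul_left_comm]

/-- The space `𝒮'/𝒫` of tempered distributions modulo polynomials, with the quotient topology. -/
abbrev SModP (d : ℕ) : Type := 𝓢'(E d, ℂ) ⧸ polynomials d

/-! ### Dyadic partition of unity and the Littlewood–Paley blocks -/

/-- A dyadic partition of unity on `ℝ^d`. (That the supports of `φ(2^{-l}·)` and `φ(2^{-l'}·)` are
disjoint for `|l - l'| ≥ 2`, and those of `ψ` and `φ(2^{-l}·)` for `l ≥ 1`, follows from the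
localization of the supports.) -/
structure DyadicPartition (d : ℕ) where
  ψ : E d → ℝ
  φ : E d → ℝ
  ψ_smooth : ContDiff ℝ (⊤ : ℕ∞) ψ
  φ_smooth : ContDiff ℝ (⊤ : ℕ∞) φ
  ψ_radial : ∀ x y, ‖x‖ = ‖y‖ → ψ x = ψ y
  φ_radial : ∀ x y, ‖x‖ = ‖y‖ → φ x = φ y
  ψ_mem : ∀ x, ψ x ∈ Set.Icc (0 : ℝ) 1
  φ_mem : ∀ x, φ x ∈ Set.Icc (0 : ℝ) 1
  ψ_supp : tsupport ψ ⊆ Metric.ball 0 (4 / 3)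
  φ_supp : tsupport φ ⊆ {η | 3 / 4 ≤ ‖η‖ ∧ ‖η‖ ≤ 8 / 3}
  sum_nat : ∀ η, HasSum (fun l : ℕ => φ ((2 : ℝ) ^ (-(l : ℤ)) • η)) (1 - ψ η)
  sum_int : ∀ η, η ≠ 0 → HasSum (fun l : ℤ => φ ((2 : ℝ) ^ (-l) • η)) 1

namespace DyadicPartition

variable {d : ℕ} (Φ : DyadicPartition d)

/-- The symbol `φ_l(η) = φ(2^{-l} η)`. -/
def symbol (l : ℤ) (η : E d) : ℂ := (Φ.φ ((2 : ℝ) ^ (-l) • η) : ℂ)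

/-- The operator `g ↦ 𝓕⁻¹[φ_l 𝓕 g]` on tempered distributions. -/
def blockDist (l : ℤ) : 𝓢'(E d, ℂ) →L[ℂ] 𝓢'(E d, ℂ) :=
  TemperedDistribution.fourierMultiplierCLM ℂ (Φ.symbol l)

theorem symbol_hasTemperateGrowth (l : ℤ) : (Φ.symbol l).HasTemperateGrowth := by
  have h2 : (2 : ℝ) ^ (-l) ≠ 0 := by positivity
  have hc : HasCompactSupport Φ.φ := by
    refine HasCompactSupport.intro (isCompact_closedBall (0 : E d) (8 / 3)) fun x hx => ?_
    by_contra h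
    exact hx (by simpa using (Φ.φ_supp (subset_tsupport _ h)).2)
  have hc' : HasCompactSupport (fun η => Φ.φ ((2 : ℝ) ^ (-l) • η)) :=
    hc.comp_homeomorph (Homeomorph.smulOfNeZero _ h2)
  refine HasCompactSupport.hasTemperateGrowth (hc'.comp_left Complex.ofReal_zero) ?_
  exact Complex.ofRealCLM.contDiff.comp (Φ.φ_smooth.comp (contDiff_const_smul _))

theorem symbol_eventually_zero (l : ℤ) : Φ.symbol l =ᶠ[nhds 0] 0 := by
  have h0 : (0 : E d) ∉ tsupport Φ.φ := fun h => by
    have := (Φ.φ_supp h).1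
    norm_num at this
  have h1 : Φ.φ =ᶠ[nhds 0] 0 := notMem_tsupport_iff_eventuallyEq.1 h0
  have h2 : Filter.Tendsto (fun η : E d => (2 : ℝ) ^ (-l) • η) (nhds 0) (nhds 0) := by
    have : Continuous (fun η : E d => (2 : ℝ) ^ (-l) • η) := continuous_const_smul _
    simpa using this.tendsto 0
  filter_upwards [h2.eventually h1] with η hη
  have hη' : Φ.φ ((2 : ℝ) ^ (-l) • η) = 0 := hη
  change ((Φ.φ ((2 : ℝ) ^ (-l) • η) : ℝ) : ℂ) = 0
  rw [hη', Complex.ofReal_zero]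

theorem integral_fourier_mul_polyFun (p : MvPolynomial (Fin d) ℂ) :
    ∀ h : 𝓢(E d, ℂ), (h : E d → ℂ) =ᶠ[nhds 0] 0 → ∫ x, 𝓕 h x * polyFun p x = 0 := by
  induction p using MvPolynomial.induction_on with
  | C a =>
    intro h hh
    have h1 : ∫ x, 𝓕 h x = 0 := by
      have h2 : 𝓕⁻ (𝓕 h) (0 : E d) = h 0 := by simp
      rw [SchwartzMap.fourierInv_coe, Real.fourierInv_eq] at h2
      simpa [hh.eq_of_nhds] using h2
    simp [polyFun, integral_mul_const, h1]
  | add p q hp hq =>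
    intro h hh
    have h1 : ∀ x, 𝓕 h x * polyFun (p + q) x = 𝓕 h x * polyFun p x + 𝓕 h x * polyFun q x := by
      intro x; simp [polyFun, mul_add]
    simp_rw [h1]
    rw [integral_add (integrable_mul_polyFun p _) (integrable_mul_polyFun q _), hp h hh, hq h hh,
      add_zero]
  | mul_X p i hp =>
    intro h hh
    have hz : ((∂_{EuclideanSpace.single i (1 : ℝ)} h : 𝓢(E d, ℂ)) : E d → ℂ) =ᶠ[nhds 0] 0 := by
      have := hh.fderiv (𝕜 := ℝ)
      filter_upwards [this] with x hx
      rw [SchwartzMap.lineDerivOp_apply_eq_fderiv, hx]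
      simp
    have h1 := hp _ hz
    rw [SchwartzMap.fourier_lineDerivOp_eq] at h1
    have hg : Function.HasTemperateGrowth
        (fun x : E d => inner ℝ x (EuclideanSpace.single i (1 : ℝ))) := by fun_prop
    have h2 : ∀ x, ((2 * Real.pi * Complex.I) • SchwartzMap.smulLeftCLM ℂ
        (fun x : E d => inner ℝ x (EuclideanSpace.single i (1 : ℝ))) (𝓕 h)) x * polyFun p x
        = (2 * Real.pi * Complex.I) * (𝓕 h x * polyFun (p * MvPolynomial.X i) x) := by
      intro x
      rw [smul_apply, SchwartzMap.smulLeftCLM_apply_apply hg]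
      simp [polyFun, EuclideanSpace.inner_single_right]
      ring
    simp_rw [h2] at h1
    rw [integral_const_mul] at h1
    exact (mul_eq_zero.1 h1).resolve_left Complex.two_pi_I_ne_zero

theorem polynomials_le_ker (l : ℤ) :
    polynomials d ≤ LinearMap.ker (Φ.blockDist l).toLinearMap := by
  rintro _ ⟨p, rfl⟩
  rw [LinearMap.mem_ker]
  ext g
  change Φ.blockDist l (polyDist p) g = 0
  rw [blockDist, TemperedDistribution.fourierMultiplierCLM_apply_apply, polyDist_apply]
  refine integral_fourier_mul_polyFun p _ ?_
  filter_upwards [Φ.symbol_eventually_zero l] with x hx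
  rw [SchwartzMap.smulLeftCLM_apply_apply (Φ.symbol_hasTemperateGrowth l), hx]
  simp

/-- The Littlewood–Paley block `Δ_l : 𝒮'/𝒫 → 𝒮'`, `Δ_l g = 𝓕⁻¹[φ_l 𝓕 g]`. -/
def block (l : ℤ) : SModP d →ₗ[ℂ] 𝓢'(E d, ℂ) :=
  (polynomials d).liftQ (Φ.blockDist l).toLinearMap (Φ.polynomials_le_ker l)

end DyadicPartition

/-! ### Mixed-Lebesgue and mixed-Morrey norms -/

/-- The mixed-Lebesgue norm of a nonnegative function of `d` variables: the innermost norm is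
taken in the first variable, the outermost one in the last variable. -/
def mixedLebesgue : (d : ℕ) → (Fin d → ℝ) → ((Fin d → ℝ) → ℝ≥0∞) → ℝ≥0∞
  | 0, _, F => F Fin.elim0
  | d + 1, q, F =>
    (∫⁻ t : ℝ, mixedLebesgue d (fun i => q i.castSucc)
      (fun x => F (Fin.snoc (α := fun _ => ℝ) x t)) ^ q (Fin.last d)) ^ (1 / q (Fin.last d))

/-- The norm of `f` in `L^{q}(ℝ^d)`, `q = (q_1, …, q_d) ∈ [1,∞)^d`. -/
def mixedLebesgueNorm {d : ℕ} (q : Fin d → ℝ) (f : E d → ℂ) : ℝ≥0∞ :=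
  mixedLebesgue d q (fun x => ‖f (WithLp.toLp 2 x)‖ₑ)

/-- The norm of `f` in the mixed-Morrey space `ℳ_{q,lam}(ℝ^d)`. -/
def morreyNorm {d : ℕ} (q lam : Fin d → ℝ) (f : E d → ℂ) : ℝ≥0∞ :=
  ⨆ (x : E d) (R : ℝ) (_ : 0 < R),
    ENNReal.ofReal (R ^ (-∑ i, lam i / q i)) *
      mixedLebesgueNorm q ((Metric.ball x R).indicator f)

/-- The norm of `f` in `L^∞(ℝ^d)`. -/
def supNorm {d : ℕ} (f : E d → ℂ) : ℝ≥0∞ := eLpNorm f ∞ volume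

/-- The tempered distribution `T` is given by the locally integrable function `f`. -/
def Represents {d : ℕ} (f : E d → ℂ) (T : 𝓢'(E d, ℂ)) : Prop :=
  LocallyIntegrable f volume ∧
    ∀ g : 𝓢(E d, ℂ), HasCompactSupport g → T g = ∫ x, f x * g x

/-- The norm `X` of functions, on tempered distributions: it is `X f` if `T` is given by a
function `f` (unique up to null sets), and `∞` if `T` is not given by a function. -/
def distNorm {d : ℕ} (X : (E d → ℂ) → ℝ≥0∞) (T : 𝓢'(E d, ℂ)) : ℝ≥0∞ :=
  ⨅ (f : E d → ℂ) (_ : Represents f T), X f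

/-! ### Besov spaces -/

/-- The `ℓ^r(ℤ)` norm, `r ∈ [1,∞]`. -/
def seqNorm (r : ℝ≥0∞) (a : ℤ → ℝ≥0∞) : ℝ≥0∞ :=
  if r = ∞ then ⨆ l, a l else (∑' l, a l ^ r.toReal) ^ (1 / r.toReal)

/-- The homogeneous Besov norm based on `X`, i.e. the `ℓ^r` norm of `l ↦ 2^{lσ} ‖Δ_l g‖_X`. -/
def besovNorm {d : ℕ} (Φ : DyadicPartition d) (X : (E d → ℂ) → ℝ≥0∞) (σ : ℝ) (r : ℝ≥0∞)
    (g : SModP d) : ℝ≥0∞ :=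
  seqNorm r fun l => ENNReal.ofReal ((2 : ℝ) ^ ((l : ℝ) * σ)) * distNorm X (Φ.block l g)

/-- The norm of the homogeneous Besov mixed-Morrey space `𝒩^σ_{q,lam,r}(ℝ^d)`; the space consists
of the `g ∈ 𝒮'/𝒫` for which it is finite. -/
def bmmNorm {d : ℕ} (Φ : DyadicPartition d) (q lam : Fin d → ℝ) (σ : ℝ) (r : ℝ≥0∞) :
    SModP d → ℝ≥0∞ :=
  besovNorm Φ (morreyNorm q lam) σ r

/-- The norm of the homogeneous Besov space `B^σ_{∞,r}(ℝ^d)`. -/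
def besovSupNorm {d : ℕ} (Φ : DyadicPartition d) (σ : ℝ) (r : ℝ≥0∞) : SModP d → ℝ≥0∞ :=
  besovNorm Φ supNorm σ r

/-- The continuous inclusion `{N₁ < ∞} ↪ {N₂ < ∞}` of two spaces of distributions modulo
polynomials, given by their norms (in particular `N₁ g < ∞` implies `N₂ g < ∞`). -/
def ContinuouslyIncluded {d : ℕ} (N₁ N₂ : SModP d → ℝ≥0∞) : Prop :=
  ∃ C : ℝ≥0, ∀ g, N₁ g < ∞ → N₂ g ≤ C * N₁ g

/-- The set `{N < ∞}` is a linear subspace of `𝒮'/𝒫` on which `N` is a norm that makes it a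
Banach space, and the inclusion of this Banach space in `𝒮'/𝒫` is continuous. -/
def IsBanachIncludedInSModP {d : ℕ} (N : SModP d → ℝ≥0∞) : Prop :=
  ∃ (B : Type) (_ : NormedAddCommGroup B) (_ : NormedSpace ℂ B) (_ : CompleteSpace B)
    (ι : B →L[ℂ] SModP d),
    Function.Injective ι ∧ Set.range ι = {g | N g < ∞} ∧ ∀ b, ‖b‖ₑ = N (ι b)

/-! ### Distributions of `x'`, as distributions of `x = (x', x'')` -/

/-- The point `(x', x'')`. -/
def glue {d m : ℕ} (x' : E d) (x'' : E m) : E (d + m) :=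
  WithLp.toLp 2 (Fin.append x' x'')

theorem glue_eq {d m : ℕ} (p : E d × E m) :
    glue p.1 p.2 = (LinearIsometryEquiv.piLpCongrLeft 2 ℝ ℝ finSumFinEquiv)
      ((PiLp.sumPiLpEquivProdLpPiLp (𝕜 := ℝ) 2 (fun _ : Fin d ⊕ Fin m => ℝ)).symm
        (WithLp.toLp 2 p)) := by
  ext i
  refine Fin.addCases (fun j => ?_) (fun j => ?_) i <;>
    simp [glue, LinearIsometryEquiv.piLpCongrLeft_apply, Equiv.piCongrLeft']

theorem glue_measurePreserving (d m : ℕ) :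
    MeasurePreserving (fun p : E d × E m => glue p.1 p.2) := by
  have h1 : MeasurePreserving (WithLp.toLp 2 : E d × E m → WithLp 2 (E d × E m)) :=
    WithLp.volume_preserving_toLp _ _
  have h2 := ((PiLp.sumPiLpEquivProdLpPiLp (𝕜 := ℝ) 2
    (fun _ : Fin d ⊕ Fin m => ℝ)).symm.trans
      (LinearIsometryEquiv.piLpCongrLeft 2 ℝ ℝ finSumFinEquiv)).measurePreserving
  have h3 := h2.comp h1
  convert h3 using 1
  funext p
  exact glue_eq p

theorem norm_glue_sq {d m : ℕ} (x' : E d) (x'' : E m) :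
    ‖glue x' x''‖ ^ 2 = ‖x'‖ ^ 2 + ‖x''‖ ^ 2 := by
  simp [EuclideanSpace.norm_sq_eq, glue, Fin.sum_univ_add]

theorem continuous_glue (d m : ℕ) : Continuous (fun p : E d × E m => glue p.1 p.2) := by
  have : (fun p : E d × E m => glue p.1 p.2) = fun p => _ := funext glue_eq
  rw [this]
  fun_prop

theorem glue_measurableEmbedding (d m : ℕ) :
    MeasurableEmbedding (fun p : E d × E m => glue p.1 p.2) := by
  refine (continuous_glue d m).measurableEmbedding fun p p' h => ?_
  simp only [glue_eq] at h
  simpa using h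

/-- The inclusion `x' ↦ (x', 0)`. -/
def incl (d m : ℕ) : E d →ₗ[ℝ] E (d + m) where
  toFun x' := glue x' 0
  map_add' x y := by
    ext i; refine Fin.addCases (fun j => ?_) (fun j => ?_) i <;> simp [glue]
  map_smul' c x := by
    ext i; refine Fin.addCases (fun j => ?_) (fun j => ?_) i <;> simp [glue]

theorem incl_hasTemperateGrowth (d m : ℕ) : Function.HasTemperateGrowth (incl d m) :=
  (LinearMap.toContinuousLinearMap (incl d m)).hasTemperateGrowth

theorem norm_incl {d m : ℕ} (x : E d) : ‖incl d m x‖ = ‖x‖ := by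
  have h := norm_glue_sq x (0 : E m)
  rw [norm_zero, zero_pow two_ne_zero, add_zero] at h
  exact (pow_left_inj₀ (norm_nonneg _) (norm_nonneg _) two_ne_zero).1 h

/-- The partial integral `x' ↦ ∫ g(x', x'') dx''` of a Schwartz function `g` on `ℝ^{d+m}`, as a
Schwartz function on `ℝ^d` (its Fourier transform is `ξ' ↦ 𝓕 g (ξ', 0)`); see
`partialIntegral_apply`. -/
def partialIntegral (d m : ℕ) : 𝓢(E (d + m), ℂ) →L[ℂ] 𝓢(E d, ℂ) :=
  FourierTransform.fourierInvCLM ℂ 𝓢(E d, ℂ) ∘L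
    SchwartzMap.compCLM ℂ (incl_hasTemperateGrowth d m)
      ⟨1, 1, fun x => by rw [norm_incl]; linarith⟩ ∘L
    FourierTransform.fourierCLM ℂ 𝓢(E (d + m), ℂ)

theorem partialIntegral_apply {d m : ℕ} (g : 𝓢(E (d + m), ℂ)) (x' : E d) :
    partialIntegral d m g x' = ∫ x'' : E m, g (glue x' x'') := by
  set G : E d → ℂ := fun x' => ∫ x'' : E m, g (glue x' x'') with hG
  have hgint : Integrable (fun p : E d × E m => g (glue p.1 p.2)) :=
    (glue_measurePreserving d m).integrable_comp_of_integrable g.integrable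
  have hGint : Integrable G := hgint.integral_prod_left
  have hcont : Continuous G := by
    let k := (volume : Measure (E m)).integrablePower
    let C := 2 ^ k * ((Finset.Iic (k, 0)).sup (fun n => SchwartzMap.seminorm ℂ n.1 n.2)) g
    have hint : Integrable (fun x'' : E m => C * (1 + ‖x''‖) ^ (-(k : ℝ))) :=
      (Measure.integrable_pow_neg_integrablePower _).const_mul C
    refine continuous_of_dominated (fun x => ?_) (fun x => ?_) hint ?_
    · have : Continuous (fun x'' : E m => g (glue x x'')) :=
        g.continuous.comp ((continuous_glue d m).comp (Continuous.prodMk_right x))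
      exact this.aestronglyMeasurable
    · refine Filter.Eventually.of_forall fun y => ?_
      have h1 := SchwartzMap.one_add_le_sup_seminorm_apply (𝕜 := ℂ) (m := (k, 0)) (k := k) (n := 0)
        le_rfl le_rfl g (glue x y)
      rw [norm_iteratedFDeriv_zero] at h1
      have h2 : ‖y‖ ≤ ‖glue x y‖ := by
        refine (sq_le_sq₀ (norm_nonneg _) (norm_nonneg _)).1 ?_
        rw [norm_glue_sq]
        linarith [sq_nonneg ‖x‖]
      have h3 : (1 + ‖y‖) ^ k * ‖g (glue x y)‖ ≤ C := by
        refine le_trans ?_ h1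
        gcongr
      rw [Real.rpow_neg (by positivity), Real.rpow_natCast, ← div_eq_mul_inv,
        le_div_iff₀ (by positivity), mul_comm]
      exact h3
    · refine Filter.Eventually.of_forall fun y => ?_
      exact g.continuous.comp ((continuous_glue d m).comp (Continuous.prodMk_left y))
  have hF : 𝓕 G = fun ξ => 𝓕 g (incl d m ξ) := by
    funext ξ
    rw [SchwartzMap.fourier_coe, Real.fourier_eq, Real.fourier_eq]
    have hmp := glue_measurePreserving d m
    have hme := glue_measurableEmbedding d m
    have hi : Integrable (fun v : E (d + m) => Real.fourierChar (-inner ℝ v (incl d m ξ)) • g v) :=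
      (Real.fourierIntegral_convergent_iff (μ := volume) (f := (g : E (d + m) → ℂ)) (incl d m ξ)).2
        g.integrable
    have hin : ∀ (x : E d) (y : E m), inner ℝ (glue x y) (incl d m ξ) = inner ℝ x ξ := by
      intro x y
      simp [PiLp.inner_apply, incl, glue, Fin.sum_univ_add]
    rw [← hmp.integral_comp hme, Measure.volume_eq_prod, integral_prod]
    · simp only [hin, hG]
      congr 1
      funext x
      simp_rw [Circle.smul_def]
      rw [integral_smul]
    · exact hmp.integrable_comp_of_integrable hi
  have hF' : 𝓕 G = ((SchwartzMap.compCLM ℂ (incl_hasTemperateGrowth d m)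
      ⟨1, 1, fun x => by rw [norm_incl]; linarith⟩ (𝓕 g) : 𝓢(E d, ℂ)) : E d → ℂ) := hF
  have hinv := hcont.fourierInv_fourier_eq hGint (by rw [hF']; exact SchwartzMap.integrable _)
  rw [hF', ← SchwartzMap.fourierInv_coe] at hinv
  exact congrFun hinv x'

/-- The tempered distribution `u(x')` on `ℝ^d`, considered as a tempered distribution of
`(x', x'')` on `ℝ^{d+m}` that does not depend on `x''`: its value at `g` is the value of `u` at
`x' ↦ ∫ g(x', x'') dx''`. -/
def cylinder (d m : ℕ) : 𝓢'(E d, ℂ) →L[ℂ] 𝓢'(E (d + m), ℂ) :=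
  PointwiseConvergenceCLM.precomp _ (partialIntegral d m)

theorem cylinder_apply {d m : ℕ} (u : 𝓢'(E d, ℂ)) (g : 𝓢(E (d + m), ℂ)) :
    cylinder d m u g = u (partialIntegral d m g) := rfl

end BesovMixedMorrey

end

/-!
The proof rests on one reproducing formula. Multiplication by `φ_{l-1} + φ_l + φ_{l+1}` does not
change the symbol `φ_l` of the block `Δ_l`, hence `Δ_l g` is the convolution of `Δ_l g` with the
kernel `K_l` of this multiplier, which is a Schwartz function concentrated on the scale `2^{-l}`
(`IsAnnular.exists_norm_fourier_dilate_le`).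

By Hölder's inequality, a function `f` in a mixed-Morrey space has integral at most
`C R^{d - S} ‖f‖` over the balls of radius `R`, where `S = ∑ (1 - λ_i) / q_i`
(`lintegral_ball_le_morreyNorm`). Summing `|f| |K_l|` over the dyadic shells around a point shows
that `|Δ_l g|` is at most `C 2^{lS}` times its mixed-Morrey norm (`DyadicPartition.exists_blockFun`).
This is Bernstein's inequality, and it gives the embedding in the Besov space over `L^∞` at once. The
embeddings between spaces with the same scaling compare the norms of the single blocks, by Hölder's
inequality on balls, and `ℓ^a` with `ℓ^b`. For the embedding in the space with the exponents `q / θ`,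
the mixed-Morrey norm with these exponents is interpolated between the norm with the exponents `q`
and the supremum norm (`morreyNorm_div_le`), which Bernstein's inequality bounds.

For the completeness and the inclusion in `𝒮'/𝒫`, note first that a distribution with vanishing
blocks is a polynomial (`DyadicPartition.mem_polynomials_of_blockDist_eq_zero`), because it vanishes on the Schwartz
functions whose moments up to some order vanish. A class `g` of finite norm has the representative
`L g = ∑_l (Δ_l g) ∘ P`, where `P` is a projection of finite corank on the Schwartz functions with
vanishing moments up to a high order: the vanishing moments make the sum over `l < 0` converge, the
smoothness of the test function the sum over `l ≥ 0`
(`DyadicPartition.exists_norm_block_projection_le`). As `P` fixes the test functions that enter in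
the blocks, `L g` has the blocks of `g`. The map `L` is linear and continuous into `𝒮'`, which gives
the continuity of the inclusion in `𝒮'/𝒫`. A Cauchy sequence `g_n` is mapped to a sequence `L g_n`
that converges in `𝒮'`, and Fatou's lemma on the blocks (`bmmNorm_le_of_tendsto`) shows that its
limit has finite norm and is the limit of the `g_n` (`IsENorm.isBanachIncludedInSModP`).

Finally, the block `Δ_l` on `ℝ^{d+m}` of a distribution `u(x')` is the Fourier multiplier on `ℝ^d`
with the restriction of the symbol to `ξ'' = 0`, applied to `u`. This restriction is again supported
in an annulus `|ξ'| ∼ 2^l`, therefore it only sees three blocks of `u`, and by Young's inequality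
(`morreyNorm_convolution_le`) it is bounded on the mixed-Morrey space. The condition on the exponents
is what bounds the mixed-Morrey norm of a function of `x'` on `ℝ^{d+m}` by its norm on `ℝ^d`
(`morreyNorm_comp_proj_le`).
-/

noncomputable section

namespace BesovMixedMorrey

open Filter Topology

/-! ### Mixed-Lebesgue norms -/

theorem mixedLebesgue_succ {d : ℕ} (q : Fin (d + 1) → ℝ) (F : (Fin (d + 1) → ℝ) → ℝ≥0∞) :
    mixedLebesgue (d + 1) q F =
      (∫⁻ t : ℝ, mixedLebesgue d (fun i => q i.castSucc)
        (fun x => F (Fin.snoc (α := fun _ => ℝ) x t)) ^ q (Fin.last d)) ^ (1 / q (Fin.last d)) :=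
  rfl

theorem measurePreserving_snoc (d : ℕ) :
    MeasurePreserving (fun p : ℝ × (Fin d → ℝ) => (Fin.snoc (α := fun _ => ℝ) p.2 p.1)) := by
  have h := (volume_preserving_piFinSuccAbove (fun _ : Fin (d + 1) => ℝ) (Fin.last d)).symm
  convert h using 1
  funext p
  exact (Fin.insertNth_last' p.1 p.2).symm

theorem ae_snoc {d : ℕ} {P : (Fin (d + 1) → ℝ) → Prop} (h : ∀ᵐ x, P x) :
    ∀ᵐ t : ℝ, ∀ᵐ x : Fin d → ℝ, P (Fin.snoc (α := fun _ => ℝ) x t) :=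
  Measure.ae_ae_of_ae_prod ((measurePreserving_snoc d).quasiMeasurePreserving.ae h)

theorem measurable_snoc (d : ℕ) :
    Measurable (fun p : ℝ × (Fin d → ℝ) => (Fin.snoc (α := fun _ => ℝ) p.2 p.1)) :=
  (measurePreserving_snoc d).measurable

theorem mixedLebesgue_mono_ae {d : ℕ} {q : Fin d → ℝ} (hq : ∀ i, 0 ≤ q i)
    {F G : (Fin d → ℝ) → ℝ≥0∞} (h : F ≤ᵐ[volume] G) :
    mixedLebesgue d q F ≤ mixedLebesgue d q G := by
  induction d with
  | zero =>
    have h' : ∀ᵐ x : Fin 0 → ℝ, F x ≤ G x := h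
    rw [volume_pi, Measure.pi_of_empty, ae_dirac_eq] at h'
    simpa [mixedLebesgue, Subsingleton.elim Fin.elim0 (isEmptyElim : Fin 0 → ℝ)] using h'
  | succ d ih =>
    rw [mixedLebesgue_succ, mixedLebesgue_succ]
    refine ENNReal.rpow_le_rpow (lintegral_mono_ae ?_) (one_div_nonneg.2 (hq _))
    filter_upwards [ae_snoc h] with t ht
    exact ENNReal.rpow_le_rpow (ih (fun i => hq _) ht) (hq _)

theorem mixedLebesgue_mono {d : ℕ} {q : Fin d → ℝ} (hq : ∀ i, 0 ≤ q i)
    {F G : (Fin d → ℝ) → ℝ≥0∞} (h : ∀ x, F x ≤ G x) :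
    mixedLebesgue d q F ≤ mixedLebesgue d q G :=
  mixedLebesgue_mono_ae hq (Eventually.of_forall h)

theorem mixedLebesgue_congr_ae {d : ℕ} {q : Fin d → ℝ} (hq : ∀ i, 0 ≤ q i)
    {F G : (Fin d → ℝ) → ℝ≥0∞} (h : F =ᵐ[volume] G) :
    mixedLebesgue d q F = mixedLebesgue d q G :=
  le_antisymm (mixedLebesgue_mono_ae hq h.le) (mixedLebesgue_mono_ae hq h.symm.le)

theorem measurable_mixedLebesgue {α : Type*} [MeasurableSpace α] {d : ℕ} (q : Fin d → ℝ)
    {F : α → (Fin d → ℝ) → ℝ≥0∞} (hF : Measurable (Function.uncurry F)) :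
    Measurable fun a => mixedLebesgue d q (F a) := by
  induction d generalizing α with
  | zero => exact hF.comp (measurable_id.prodMk measurable_const)
  | succ d ih =>
    simp only [mixedLebesgue_succ]
    refine Measurable.pow_const ?_ _
    refine Measurable.lintegral_prod_right' (f := fun p : α × ℝ =>
      mixedLebesgue d (fun i => q i.castSucc)
        (fun x => F p.1 (Fin.snoc (α := fun _ => ℝ) x p.2)) ^ q (Fin.last d)) ?_
    refine Measurable.pow_const ?_ _
    refine ih (α := α × ℝ) (fun i => q i.castSucc)
      (F := fun p x => F p.1 (Fin.snoc (α := fun _ => ℝ) x p.2)) ?_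
    have : Measurable fun p : (α × ℝ) × (Fin d → ℝ) =>
        (p.1.1, Fin.snoc (α := fun _ => ℝ) p.2 p.1.2) :=
      (measurable_fst.comp measurable_fst).prodMk
        ((measurable_snoc d).comp ((measurable_snd.comp measurable_fst).prodMk measurable_snd))
    exact hF.comp this

theorem measurable_mixedLebesgue_snoc {d : ℕ} (q : Fin d → ℝ)
    {F : (Fin (d + 1) → ℝ) → ℝ≥0∞} (hF : Measurable F) :
    Measurable fun t : ℝ => mixedLebesgue d q fun x => F (Fin.snoc (α := fun _ => ℝ) x t) :=
  measurable_mixedLebesgue q (F := fun t x => F (Fin.snoc (α := fun _ => ℝ) x t))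
    (hF.comp (measurable_snoc d))

theorem measurable_comp_snoc {d : ℕ} {F : (Fin (d + 1) → ℝ) → ℝ≥0∞} (hF : Measurable F) (t : ℝ) :
    Measurable fun x : Fin d → ℝ => F (Fin.snoc (α := fun _ => ℝ) x t) :=
  (hF.comp (measurable_snoc d)).comp measurable_prodMk_left

theorem mixedLebesgue_zero {d : ℕ} {q : Fin d → ℝ} (hq : ∀ i, 0 < q i) :
    mixedLebesgue d q (fun _ => 0) = 0 := by
  induction d with
  | zero => rfl
  | succ d ih =>
    rw [mixedLebesgue_succ, ih fun i => hq _]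
    simp [hq]

theorem mixedLebesgue_const_mul {d : ℕ} {q : Fin d → ℝ} (hq : ∀ i, 0 < q i) {c : ℝ≥0∞}
    (hc : c ≠ ∞) (F : (Fin d → ℝ) → ℝ≥0∞) :
    mixedLebesgue d q (fun x => c * F x) = c * mixedLebesgue d q F := by
  induction d with
  | zero => rfl
  | succ d ih =>
    rw [mixedLebesgue_succ, mixedLebesgue_succ]
    have h0 := hq (Fin.last d)
    simp_rw [ih (fun i => hq i.castSucc), ENNReal.mul_rpow_of_nonneg _ _ h0.le]
    rw [lintegral_const_mul' _ _ (ENNReal.rpow_ne_top_of_nonneg h0.le hc),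
      ENNReal.mul_rpow_of_nonneg _ _ (by positivity), ← ENNReal.rpow_mul,
      mul_one_div_cancel h0.ne', ENNReal.rpow_one]

theorem mixedLebesgue_comp_add {d : ℕ} (q : Fin d → ℝ) (F : (Fin d → ℝ) → ℝ≥0∞)
    (v : Fin d → ℝ) : mixedLebesgue d q (fun x => F (x + v)) = mixedLebesgue d q F := by
  induction d with
  | zero => exact congrArg F (Subsingleton.elim _ _)
  | succ d ih =>
    rw [mixedLebesgue_succ, mixedLebesgue_succ]
    congr 1
    rw [← lintegral_add_right_eq_self (fun t => mixedLebesgue d (fun i => q i.castSucc)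
      (fun x => F (Fin.snoc (α := fun _ => ℝ) x t)) ^ q (Fin.last d)) (v (Fin.last d))]
    refine lintegral_congr fun t => ?_
    congr 1
    rw [← ih _ (fun x => F (Fin.snoc (α := fun _ => ℝ) x (t + v (Fin.last d))))
      (fun i => v i.castSucc)]
    congr 1
    funext x
    congr 1
    funext i
    refine Fin.lastCases ?_ (fun j => ?_) i <;> simp

theorem mixedLebesgue_one {d : ℕ} {F : (Fin d → ℝ) → ℝ≥0∞} (hF : Measurable F) :
    mixedLebesgue d (fun _ => 1) F = ∫⁻ x, F x := by
  induction d with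
  | zero =>
    rw [volume_pi, Measure.pi_of_empty, lintegral_dirac' _ hF]
    exact congrArg F (Subsingleton.elim _ _)
  | succ d ih =>
    rw [mixedLebesgue_succ, ← (measurePreserving_snoc d).lintegral_comp hF, Measure.volume_eq_prod,
      lintegral_prod (fun p : ℝ × (Fin d → ℝ) => F (Fin.snoc (α := fun _ => ℝ) p.2 p.1))
        (hF.comp (measurable_snoc d)).aemeasurable]
    simp only [div_one, ENNReal.rpow_one]
    exact lintegral_congr fun t => ih (measurable_comp_snoc hF t)

/-- **Hölder's inequality** for mixed-Lebesgue norms, for functions supported in a cube of side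
`2R`. -/
theorem mixedLebesgue_le_of_support {d : ℕ} {q r : Fin d → ℝ} (hq : ∀ i, 0 < q i)
    (hqr : ∀ i, q i ≤ r i) {R : ℝ} (hR : 0 < R) (c : Fin d → ℝ) {F : (Fin d → ℝ) → ℝ≥0∞}
    (hF : Measurable F) (hsupp : ∀ x, F x ≠ 0 → ∀ i, x i ∈ Set.Icc (c i - R) (c i + R)) :
    mixedLebesgue d q F ≤
      ENNReal.ofReal ((2 * R) ^ ∑ i, (1 / q i - 1 / r i)) * mixedLebesgue d r F := by
  induction d with
  | zero => simp [mixedLebesgue]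
  | succ d ih =>
    rw [mixedLebesgue_succ, mixedLebesgue_succ, Fin.sum_univ_castSucc]
    have hr : ∀ i, 0 < r i := fun i => (hq i).trans_le (hqr i)
    set A : ℝ≥0∞ := ENNReal.ofReal
      ((2 * R) ^ ∑ i : Fin d, (1 / q i.castSucc - 1 / r i.castSucc)) with hA
    set a := q (Fin.last d)
    set b := r (Fin.last d)
    have ha : 0 < a := hq _
    have hb : 0 < b := hr _
    set I := Set.Icc (c (Fin.last d) - R) (c (Fin.last d) + R)
    set G : ℝ → ℝ≥0∞ := fun t => mixedLebesgue d (fun i => r i.castSucc)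
        (fun x => F (Fin.snoc (α := fun _ => ℝ) x t)) with hG
    have hGm : Measurable G := measurable_mixedLebesgue_snoc _ hF
    have hG0 : ∀ t, t ∉ I → G t = 0 := by
      intro t ht
      have : (fun x => F (Fin.snoc (α := fun _ => ℝ) x t)) = fun _ => 0 := by
        funext x
        by_contra hx
        have h := hsupp _ hx (Fin.last d)
        rw [Fin.snoc_last] at h
        exact ht h
      rw [hG]
      simp only [this]
      exact mixedLebesgue_zero fun i => hr _
    have h1 : ∀ t, mixedLebesgue d (fun i => q i.castSucc)
        (fun x => F (Fin.snoc (α := fun _ => ℝ) x t)) ≤ A * G t := by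
      intro t
      refine ih (fun i => hq _) (fun i => hqr _) (fun i => c i.castSucc)
        (measurable_comp_snoc hF t) fun x hx i => ?_
      simpa using hsupp _ hx i.castSucc
    have h2 : ∀ p : ℝ, 0 < p → ∫⁻ t, G t ^ p = ∫⁻ t in I, G t ^ p := by
      intro p hp
      rw [← lintegral_indicator measurableSet_Icc]
      refine lintegral_congr fun t => ?_
      by_cases ht : t ∈ I
      · rw [Set.indicator_of_mem ht]
      · rw [Set.indicator_of_notMem ht, hG0 t ht, ENNReal.zero_rpow_of_pos hp]
    have h3 := eLpNorm'_le_eLpNorm'_mul_rpow_measure_univ (μ := volume.restrict I) ha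
      (hqr (Fin.last d)) hGm.aestronglyMeasurable
    simp only [eLpNorm'_eq_lintegral_enorm, enorm_eq_self] at h3
    rw [← h2 _ ha, ← h2 _ hb, Measure.restrict_apply_univ, Real.volume_Icc,
      show c (Fin.last d) + R - (c (Fin.last d) - R) = 2 * R by ring,
      ENNReal.ofReal_rpow_of_pos (by positivity)] at h3
    calc (∫⁻ t : ℝ, mixedLebesgue d (fun i => q i.castSucc)
          (fun x => F (Fin.snoc (α := fun _ => ℝ) x t)) ^ a) ^ (1 / a)
        ≤ (∫⁻ t : ℝ, (A * G t) ^ a) ^ (1 / a) := by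
          gcongr with t
          exact h1 t
      _ = A * (∫⁻ t, G t ^ a) ^ (1 / a) := by
          simp_rw [ENNReal.mul_rpow_of_nonneg _ _ ha.le]
          rw [lintegral_const_mul' _ _ (ENNReal.rpow_ne_top_of_nonneg ha.le ENNReal.ofReal_ne_top),
            ENNReal.mul_rpow_of_nonneg _ _ (by positivity), ← ENNReal.rpow_mul,
            mul_one_div_cancel ha.ne', ENNReal.rpow_one]
      _ ≤ A * ((∫⁻ t, G t ^ b) ^ (1 / b) * ENNReal.ofReal ((2 * R) ^ (1 / a - 1 / b))) := by
          gcongr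
      _ = _ := by
          rw [Real.rpow_add (by positivity), ENNReal.ofReal_mul (by positivity), ← hA]
          ring

theorem mixedLebesgue_div_le {d : ℕ} {q : Fin d → ℝ} (hq : ∀ i, 0 < q i) {θ : ℝ} (h0 : 0 < θ)
    (h1 : θ < 1) {A : ℝ≥0∞} (hA : A ≠ ∞) {F : (Fin d → ℝ) → ℝ≥0∞} (hF : ∀ᵐ x, F x ≤ A) :
    mixedLebesgue d (fun i => q i / θ) F ≤ A ^ (1 - θ) * mixedLebesgue d q F ^ θ := by
  induction d with
  | zero =>
    rw [volume_pi, Measure.pi_of_empty, ae_dirac_eq] at hF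
    have hF' : F Fin.elim0 ≤ A := by
      simpa [Subsingleton.elim Fin.elim0 (isEmptyElim : Fin 0 → ℝ)] using hF
    calc F Fin.elim0 = F Fin.elim0 ^ (1 - θ) * F Fin.elim0 ^ θ := by
          rw [← ENNReal.rpow_add_of_nonneg _ _ (by linarith) h0.le, sub_add_cancel,
            ENNReal.rpow_one]
      _ ≤ A ^ (1 - θ) * F Fin.elim0 ^ θ := by gcongr
  | succ d ih =>
    rw [mixedLebesgue_succ, mixedLebesgue_succ]
    set a := q (Fin.last d)
    have ha : 0 < a := hq _
    have haθ : 0 < a / θ := by positivity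
    set G : ℝ → ℝ≥0∞ := fun t => mixedLebesgue d (fun i => q i.castSucc)
        (fun x => F (Fin.snoc (α := fun _ => ℝ) x t)) with hG
    have hAt : (A ^ (1 - θ)) ^ (a / θ) ≠ ∞ :=
      ENNReal.rpow_ne_top_of_nonneg haθ.le (ENNReal.rpow_ne_top_of_nonneg (by linarith) hA)
    calc _ ≤ (∫⁻ t, (A ^ (1 - θ) * G t ^ θ) ^ (a / θ)) ^ (1 / (a / θ)) := by
          refine ENNReal.rpow_le_rpow (lintegral_mono_ae ?_) (by positivity)
          filter_upwards [ae_snoc hF] with t ht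
          exact ENNReal.rpow_le_rpow (ih (fun i => hq _) ht) haθ.le
      _ = (∫⁻ t, (A ^ (1 - θ)) ^ (a / θ) * G t ^ a) ^ (1 / (a / θ)) := by
          congr 1
          refine lintegral_congr fun t => ?_
          rw [ENNReal.mul_rpow_of_nonneg _ _ haθ.le, ← ENNReal.rpow_mul (G t),
            mul_div_cancel₀ _ h0.ne']
      _ = _ := by
          rw [lintegral_const_mul' _ _ hAt, ENNReal.mul_rpow_of_nonneg _ _ (by positivity),
            ← ENNReal.rpow_mul, mul_one_div_cancel haθ.ne', ENNReal.rpow_one,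
            ← ENNReal.rpow_mul]
          congr 2
          field_simp

/-- **Fatou's lemma** for mixed-Lebesgue norms. -/
theorem mixedLebesgue_liminf_le {d : ℕ} {q : Fin d → ℝ} (hq : ∀ i, 0 < q i)
    {F : ℕ → (Fin d → ℝ) → ℝ≥0∞} (hF : ∀ n, Measurable (F n)) :
    mixedLebesgue d q (fun x => liminf (fun n => F n x) atTop) ≤
      liminf (fun n => mixedLebesgue d q (F n)) atTop := by
  have hpow : ∀ {p : ℝ}, 0 ≤ p → ∀ u : ℕ → ℝ≥0∞,
      (liminf u atTop) ^ p = liminf (fun n => u n ^ p) atTop := fun {p} hp u =>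
    (ENNReal.monotone_rpow_of_nonneg hp).map_liminf_of_continuousAt u
      ENNReal.continuous_rpow_const.continuousAt
  induction d with
  | zero => exact le_rfl
  | succ d ih =>
    have h0 := hq (Fin.last d)
    simp only [mixedLebesgue_succ]
    rw [← hpow (by positivity)]
    refine ENNReal.rpow_le_rpow ?_ (by positivity)
    refine le_trans (lintegral_mono fun t => ?_) (lintegral_liminf_le fun n =>
      (measurable_mixedLebesgue_snoc _ (hF n)).pow_const _)
    rw [← hpow h0.le]
    exact ENNReal.rpow_le_rpow (ih (fun i => hq _) fun n => measurable_comp_snoc (hF n) t) h0.le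

/-- **Minkowski's integral inequality**, in one variable. -/
theorem lintegral_rpow_lintegral_le {α β : Type*} [MeasurableSpace α] [MeasurableSpace β]
    (ν : Measure α) [SigmaFinite ν] (μ : Measure β) [SFinite μ] {p : ℝ} (hp : 1 ≤ p)
    {F : α → β → ℝ≥0∞} (hF : Measurable (Function.uncurry F)) :
    (∫⁻ t, (∫⁻ y, F t y ∂μ) ^ p ∂ν) ^ (1 / p) ≤ ∫⁻ y, (∫⁻ t, F t y ^ p ∂ν) ^ (1 / p) ∂μ := by
  rcases hp.eq_or_lt with rfl | hp1
  · simp only [ENNReal.rpow_one, div_one]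
    exact (lintegral_lintegral_swap hF.aemeasurable).le
  have hp0 : 0 < p := by linarith
  set G : α → ℝ≥0∞ := fun t => ∫⁻ y, F t y ∂μ with hG
  have hGm : Measurable G := hF.lintegral_prod_right
  set M := ∫⁻ y, (∫⁻ t, F t y ^ p ∂ν) ^ (1 / p) ∂μ with hM
  -- Truncations of `G` with a finite `L^p` norm, by which one can divide.
  set H : ℕ → α → ℝ≥0∞ := fun n => (spanningSets ν n).indicator fun t => min (G t) n with hH
  have hHm : ∀ n, Measurable (H n) := fun n =>
    (hGm.min measurable_const).indicator (measurableSet_spanningSets ν n)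
  have hHG : ∀ n t, H n t ≤ G t := fun n t => by
    simp only [hH]
    exact (Set.indicator_le_self _ _ _).trans (min_le_left _ _)
  have hHfin : ∀ n, ∫⁻ t, H n t ^ p ∂ν ≠ ∞ := by
    intro n
    have : ∫⁻ t, H n t ^ p ∂ν ≤ ∫⁻ _ in spanningSets ν n, (n : ℝ≥0∞) ^ p ∂ν := by
      rw [← lintegral_indicator (measurableSet_spanningSets ν n)]
      refine lintegral_mono fun t => ?_
      by_cases ht : t ∈ spanningSets ν n
      · simp only [hH, Set.indicator_of_mem ht]
        exact ENNReal.rpow_le_rpow (min_le_right _ _) hp0.le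
      · simp [hH, Set.indicator_of_notMem ht, hp0]
    refine (this.trans_lt ?_).ne
    rw [setLIntegral_const]
    exact ENNReal.mul_lt_top (ENNReal.rpow_lt_top_of_nonneg hp0.le (ENNReal.natCast_ne_top n))
      (measure_spanningSets_lt_top ν n)
  have hconj : p.HolderConjugate (p / (p - 1)) := Real.HolderConjugate.conjExponent hp1
  have key : ∀ n, (∫⁻ t, H n t ^ p ∂ν) ^ (1 / p) ≤ M := by
    intro n
    set S := ∫⁻ t, H n t ^ p ∂ν with hS
    have h1 : S ≤ S ^ (1 - 1 / p) * M := by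
      calc S ≤ ∫⁻ t, H n t ^ (p - 1) * G t ∂ν := by
            refine lintegral_mono fun t => ?_
            calc H n t ^ p = H n t ^ (p - 1) * H n t := by
                  conv_lhs => rw [← sub_add_cancel p 1,
                    ENNReal.rpow_add_of_nonneg _ _ (by linarith) zero_le_one, ENNReal.rpow_one]
              _ ≤ _ := by gcongr; exact hHG n t
        _ = ∫⁻ t, ∫⁻ y, H n t ^ (p - 1) * F t y ∂μ ∂ν := by
            refine lintegral_congr fun t => ?_
            rw [lintegral_const_mul _ hF.of_uncurry_left]
        _ = ∫⁻ y, ∫⁻ t, H n t ^ (p - 1) * F t y ∂ν ∂μ :=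
            lintegral_lintegral_swap
              ((((hHm n).pow_const _).comp measurable_fst).mul hF).aemeasurable
        _ ≤ ∫⁻ y, S ^ (1 - 1 / p) * (∫⁻ t, F t y ^ p ∂ν) ^ (1 / p) ∂μ := by
            refine lintegral_mono fun y => ?_
            have := ENNReal.lintegral_mul_le_Lp_mul_Lq ν hconj.symm
              ((hHm n).pow_const (p - 1)).aemeasurable
              (hF.of_uncurry_right (y := y)).aemeasurable
            refine this.trans (le_of_eq ?_)
            simp_rw [← ENNReal.rpow_mul]
            rw [mul_div_cancel₀ _ (by linarith : p - 1 ≠ 0)]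
            congr 2
            field_simp
        _ = _ := by
            rw [lintegral_const_mul]
            exact ((hF.pow_const p).lintegral_prod_left).pow_const _
    by_cases hS0 : S = 0
    · rw [hS0, ENNReal.zero_rpow_of_pos (by positivity)]; exact zero_le
    have h2 : S ^ (1 - 1 / p) ≠ 0 := by
      exact (ENNReal.rpow_pos (pos_iff_ne_zero.2 hS0) (hHfin n)).ne'
    have h3 : S ^ (1 - 1 / p) ≠ ∞ :=
      ENNReal.rpow_ne_top_of_nonneg (by rw [sub_nonneg, div_le_one hp0]; exact hp) (hHfin n)
    rw [← ENNReal.mul_le_mul_iff_right h2 h3, ← ENNReal.rpow_add _ _ hS0 (hHfin n)]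
    simpa using h1
  have hlim : ∀ t, ⨆ n, H n t = G t := by
    intro t
    refine le_antisymm (iSup_le fun n => hHG n t) ?_
    refine le_of_forall_lt fun c hc => ?_
    obtain ⟨k, hk⟩ := ENNReal.exists_nat_gt (ne_top_of_lt hc)
    have htm : t ∈ spanningSets ν (max k (spanningSetsIndex ν t)) :=
      monotone_spanningSets ν (le_max_right _ _) (mem_spanningSetsIndex ν t)
    refine lt_of_lt_of_le ?_ (le_iSup (fun n => H n t) (max k (spanningSetsIndex ν t)))
    simp only [hH, Set.indicator_of_mem htm]
    refine lt_min hc (hk.trans_le ?_)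
    exact_mod_cast le_max_left _ _
  have hmono : Monotone H := by
    intro m n hmn t
    simp only [hH]
    by_cases ht : t ∈ spanningSets ν m
    · rw [Set.indicator_of_mem ht, Set.indicator_of_mem (monotone_spanningSets ν hmn ht)]
      exact min_le_min le_rfl (by exact_mod_cast hmn)
    · rw [Set.indicator_of_notMem ht]; exact zero_le
  have h4 : ∫⁻ t, G t ^ p ∂ν = ⨆ n, ∫⁻ t, H n t ^ p ∂ν := by
    rw [← lintegral_iSup (fun n => (hHm n).pow_const p)
      fun m n hmn t => ENNReal.rpow_le_rpow (hmono hmn t) hp0.le]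
    refine lintegral_congr fun t => ?_
    rw [← hlim t]
    exact (ENNReal.orderIsoRpow p hp0).map_iSup _
  rw [h4, show (⨆ n, ∫⁻ t, H n t ^ p ∂ν) ^ (1 / p) = ⨆ n, (∫⁻ t, H n t ^ p ∂ν) ^ (1 / p) from
    (ENNReal.orderIsoRpow (1 / p) (by positivity)).map_iSup _]
  exact iSup_le key

/-- **Minkowski's integral inequality** for mixed-Lebesgue norms. -/
theorem mixedLebesgue_lintegral_le {β : Type*} [MeasurableSpace β] (μ : Measure β) [SFinite μ]
    {d : ℕ} {q : Fin d → ℝ} (hq : ∀ i, 1 ≤ q i) {F : β → (Fin d → ℝ) → ℝ≥0∞}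
    (hF : Measurable (Function.uncurry F)) :
    mixedLebesgue d q (fun x => ∫⁻ y, F y x ∂μ) ≤ ∫⁻ y, mixedLebesgue d q (F y) ∂μ := by
  induction d with
  | zero => exact le_rfl
  | succ d ih =>
    simp only [mixedLebesgue_succ]
    have h0 : 0 < q (Fin.last d) := by linarith [hq (Fin.last d)]
    have hm : Measurable fun p : (ℝ × β) × (Fin d → ℝ) =>
        F p.1.2 (Fin.snoc (α := fun _ => ℝ) p.2 p.1.1) :=
      hF.comp ((measurable_snd.comp measurable_fst).prodMk
        ((measurable_snoc d).comp ((measurable_fst.comp measurable_fst).prodMk measurable_snd)))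
    refine le_trans ?_ (lintegral_rpow_lintegral_le volume μ (hq (Fin.last d))
      (F := fun t y => mixedLebesgue d (fun i => q i.castSucc)
        (fun x => F y (Fin.snoc (α := fun _ => ℝ) x t)))
      (measurable_mixedLebesgue (α := ℝ × β) _
        (F := fun p x => F p.2 (Fin.snoc (α := fun _ => ℝ) x p.1)) hm))
    gcongr with t
    refine ih (fun i => hq _) (F := fun y x => F y (Fin.snoc (α := fun _ => ℝ) x t)) ?_
    exact hm.comp (((measurable_const.prodMk measurable_fst).prodMk measurable_snd))

theorem mixedLebesgue_add_le {d : ℕ} {q : Fin d → ℝ} (hq : ∀ i, 1 ≤ q i)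
    {F G : (Fin d → ℝ) → ℝ≥0∞} (hF : Measurable F) (hG : Measurable G) :
    mixedLebesgue d q (fun x => F x + G x) ≤ mixedLebesgue d q F + mixedLebesgue d q G := by
  have h := mixedLebesgue_lintegral_le (Measure.count : Measure Bool) hq
    (F := fun b => cond b F G) (measurable_from_prod_countable_right fun b => by cases b <;> simpa)
  simpa [lintegral_count, tsum_bool, add_comm] using h

/-- The mixed-Lebesgue norm of a function on `ℝ^{d+m}` that, in the last `m` variables, is bounded
by the indicator function of a cube of side `2R`. -/
theorem mixedLebesgue_append_le {d m : ℕ} {q : Fin (d + m) → ℝ} (hq : ∀ i, 0 < q i) {R : ℝ}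
    (hR : 0 < R) (c : Fin m → ℝ) {F : (Fin (d + m) → ℝ) → ℝ≥0∞} {f : (Fin d → ℝ) → ℝ≥0∞}
    (hle : ∀ x, F x ≤ f fun i => x (Fin.castAdd m i))
    (hsupp : ∀ x, F x ≠ 0 → ∀ i, x (Fin.natAdd d i) ∈ Set.Icc (c i - R) (c i + R)) :
    mixedLebesgue (d + m) q F ≤
      ENNReal.ofReal ((2 * R) ^ ∑ i, 1 / q (Fin.natAdd d i)) *
        mixedLebesgue d (fun i => q (Fin.castAdd m i)) f := by
  induction m with
  | zero =>
    simp only [Finset.univ_eq_empty, Finset.sum_empty, Real.rpow_zero, ENNReal.ofReal_one, one_mul]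
    exact mixedLebesgue_mono (fun i => (hq i).le) hle
  | succ m ih =>
    set a := q (Fin.last (d + m)) with ha'
    have ha : 0 < a := hq _
    set I := Set.Icc (c (Fin.last m) - R) (c (Fin.last m) + R)
    set K : ℝ≥0∞ := ENNReal.ofReal ((2 * R) ^ ∑ i : Fin m, 1 / q (Fin.natAdd d i.castSucc)) *
        mixedLebesgue d (fun i => q (Fin.castAdd (m + 1) i)) f with hK
    have h1 : ∀ t, mixedLebesgue (d + m) (fun i => q i.castSucc)
        (fun x => F (Fin.snoc (α := fun _ => ℝ) x t)) ^ a ≤ I.indicator (fun _ => K ^ a) t := by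
      intro t
      by_cases ht : t ∈ I
      · rw [Set.indicator_of_mem ht]
        refine ENNReal.rpow_le_rpow (ih (q := fun i => q i.castSucc) (fun i => hq _)
          (fun i => c i.castSucc) (fun x => ?_) fun x hx i => ?_) ha.le
        · refine (hle _).trans_eq (congrArg f ?_)
          funext i
          exact Fin.snoc_castSucc (α := fun _ => ℝ) t x (Fin.castAdd m i)
        · have := hsupp _ hx i.castSucc
          rwa [show Fin.natAdd d i.castSucc = (Fin.natAdd d i).castSucc from rfl,
            Fin.snoc_castSucc] at this
      · have : (fun x : Fin (d + m) → ℝ => F (Fin.snoc (α := fun _ => ℝ) x t)) =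
            fun _ => 0 := by
          funext x
          by_contra hx
          have h := hsupp _ hx (Fin.last m)
          have h2 := Fin.snoc_last (α := fun _ : Fin (d + m + 1) => ℝ) t x
          refine ht ?_
          rw [← h2]
          exact h
        rw [this, mixedLebesgue_zero fun i => hq _, ENNReal.zero_rpow_of_pos ha]
        exact zero_le
    calc mixedLebesgue (d + m + 1) q F
        ≤ (∫⁻ t, I.indicator (fun _ => K ^ a) t) ^ (1 / a) := by
          rw [mixedLebesgue_succ]
          exact ENNReal.rpow_le_rpow (lintegral_mono h1) (by positivity)
      _ = K * ENNReal.ofReal ((2 * R) ^ (1 / a)) := by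
          rw [lintegral_indicator measurableSet_Icc, setLIntegral_const, Real.volume_Icc,
            show c (Fin.last m) + R - (c (Fin.last m) - R) = 2 * R by ring,
            ENNReal.mul_rpow_of_nonneg _ _ (by positivity), ← ENNReal.rpow_mul,
            mul_one_div_cancel ha.ne', ENNReal.rpow_one,
            ENNReal.ofReal_rpow_of_pos (by positivity)]
      _ = _ := by
          rw [Fin.sum_univ_castSucc, Real.rpow_add (by positivity),
            ENNReal.ofReal_mul (by positivity), hK, ha',
            show Fin.natAdd d (Fin.last m) = Fin.last (d + m) from rfl]
          ring

/-! ### Mixed-Morrey norms -/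

theorem measurePreserving_toLp (d : ℕ) :
    MeasurePreserving (WithLp.toLp 2 : (Fin d → ℝ) → E d) :=
  PiLp.volume_preserving_toLp (Fin d)

theorem ball_subset_cube {d : ℕ} {x y : E d} {R : ℝ} (h : y ∈ Metric.ball x R) (i : Fin d) :
    y i ∈ Set.Icc (x i - R) (x i + R) := by
  have h1 : |y i - x i| < R := by
    refine lt_of_le_of_lt ?_ (mem_ball_iff_norm.1 h)
    simpa using PiLp.norm_apply_le (y - x) i
  constructor <;> linarith [(abs_lt.1 h1).1, (abs_lt.1 h1).2]

theorem mixedLebesgueNorm_congr_ae {d : ℕ} {q : Fin d → ℝ} (hq : ∀ i, 0 ≤ q i) {f g : E d → ℂ}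
    (h : f =ᵐ[volume] g) : mixedLebesgueNorm q f = mixedLebesgueNorm q g := by
  refine mixedLebesgue_congr_ae hq ?_
  filter_upwards [(measurePreserving_toLp d).quasiMeasurePreserving.ae h] with x hx
  rw [hx]

theorem morreyNorm_congr_ae {d : ℕ} {q : Fin d → ℝ} (hq : ∀ i, 0 ≤ q i) (lam : Fin d → ℝ)
    {f g : E d → ℂ} (h : f =ᵐ[volume] g) : morreyNorm q lam f = morreyNorm q lam g := by
  unfold morreyNorm
  refine iSup_congr fun x => iSup_congr fun R => iSup_congr fun _ => congrArg _ ?_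
  refine mixedLebesgueNorm_congr_ae hq ?_
  filter_upwards [h] with y hy
  simp only [Set.indicator, hy]

theorem le_morreyNorm {d : ℕ} (q lam : Fin d → ℝ) (f : E d → ℂ) (x : E d) {R : ℝ} (hR : 0 < R) :
    ENNReal.ofReal (R ^ (-∑ i, lam i / q i)) *
      mixedLebesgueNorm q ((Metric.ball x R).indicator f) ≤ morreyNorm q lam f :=
  le_iSup_of_le x (le_iSup_of_le R (le_iSup_of_le hR le_rfl))

theorem mixedLebesgueNorm_indicator_ball_le {d : ℕ} (q lam : Fin d → ℝ) (f : E d → ℂ) (x : E d)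
    {R : ℝ} (hR : 0 < R) : mixedLebesgueNorm q ((Metric.ball x R).indicator f) ≤
      ENNReal.ofReal (R ^ (∑ i, lam i / q i)) * morreyNorm q lam f := by
  calc mixedLebesgueNorm q ((Metric.ball x R).indicator f)
      = ENNReal.ofReal (R ^ (∑ i, lam i / q i)) * (ENNReal.ofReal (R ^ (-∑ i, lam i / q i)) *
          mixedLebesgueNorm q ((Metric.ball x R).indicator f)) := by
        rw [← mul_assoc, ← ENNReal.ofReal_mul (by positivity), ← Real.rpow_add hR, add_neg_cancel,
          Real.rpow_zero, ENNReal.ofReal_one, one_mul]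
    _ ≤ _ := by gcongr; exact le_morreyNorm q lam f x hR

theorem morreyNorm_le_iff {d : ℕ} {q lam : Fin d → ℝ} {f : E d → ℂ} {A : ℝ≥0∞} :
    morreyNorm q lam f ≤ A ↔ ∀ (x : E d) (R : ℝ), 0 < R →
      ENNReal.ofReal (R ^ (-∑ i, lam i / q i)) *
        mixedLebesgueNorm q ((Metric.ball x R).indicator f) ≤ A := by
  simp only [morreyNorm, iSup_le_iff]

theorem measurable_indicator_ball_toLp {d : ℕ} {f : E d → ℂ} (hf : Measurable f) (x : E d)
    (R : ℝ) :
    Measurable fun y : Fin d → ℝ => ‖(Metric.ball x R).indicator f (WithLp.toLp 2 y)‖ₑ :=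
  ((hf.indicator measurableSet_ball).comp (measurePreserving_toLp d).measurable).enorm

theorem morreyNorm_add_le {d : ℕ} {q : Fin d → ℝ} (hq : ∀ i, 1 ≤ q i) (lam : Fin d → ℝ)
    {f g : E d → ℂ} (hf : AEStronglyMeasurable f) (hg : AEStronglyMeasurable g) :
    morreyNorm q lam (f + g) ≤ morreyNorm q lam f + morreyNorm q lam g := by
  have hq0 : ∀ i, 0 ≤ q i := fun i => zero_le_one.trans (hq i)
  rw [morreyNorm_congr_ae hq0 lam (hf.ae_eq_mk.add hg.ae_eq_mk),
    morreyNorm_congr_ae hq0 lam hf.ae_eq_mk, morreyNorm_congr_ae hq0 lam hg.ae_eq_mk]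
  set F := hf.mk f
  set G := hg.mk g
  have hF : Measurable F := hf.stronglyMeasurable_mk.measurable
  have hG : Measurable G := hg.stronglyMeasurable_mk.measurable
  rw [morreyNorm_le_iff]
  intro x R hR
  refine le_trans ?_ (add_le_add (le_morreyNorm q lam F x hR) (le_morreyNorm q lam G x hR))
  rw [← mul_add]
  gcongr
  refine le_trans (mixedLebesgue_mono hq0 fun y => ?_) (mixedLebesgue_add_le hq
    (measurable_indicator_ball_toLp hF x R) (measurable_indicator_ball_toLp hG x R))
  rw [Set.indicator_add']
  exact enorm_add_le _ _

theorem morreyNorm_const_smul {d : ℕ} {q : Fin d → ℝ} (hq : ∀ i, 0 < q i) (lam : Fin d → ℝ)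
    (c : ℂ) (f : E d → ℂ) : morreyNorm q lam (c • f) = ‖c‖ₑ * morreyNorm q lam f := by
  simp only [morreyNorm, ENNReal.mul_iSup]
  refine iSup_congr fun x => iSup_congr fun R => iSup_congr fun _ => ?_
  rw [mul_left_comm]
  congr 1
  rw [mixedLebesgueNorm, mixedLebesgueNorm, ← mixedLebesgue_const_mul hq enorm_ne_top]
  congr 1
  funext y
  rw [← enorm_mul]
  by_cases hy : WithLp.toLp 2 y ∈ Metric.ball x R <;> simp [hy]

/-- The inclusion of mixed-Morrey spaces with the same scaling, by Hölder's inequality on the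
cubes that contain the balls. -/
theorem morreyNorm_le_of_le {d : ℕ} {q r lam mu : Fin d → ℝ} (hq : ∀ i, 0 < q i)
    (hqr : ∀ i, q i ≤ r i) (h : ∀ i, (1 - lam i) / q i = (1 - mu i) / r i) {f : E d → ℂ}
    (hf : AEStronglyMeasurable f) :
    morreyNorm q lam f ≤
      ENNReal.ofReal (2 ^ ∑ i, (1 / q i - 1 / r i)) * morreyNorm r mu f := by
  have hr : ∀ i, 0 < r i := fun i => (hq i).trans_le (hqr i)
  rw [morreyNorm_congr_ae (fun i => (hq i).le) lam hf.ae_eq_mk,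
    morreyNorm_congr_ae (fun i => (hr i).le) mu hf.ae_eq_mk]
  set F := hf.mk f
  have hF : Measurable F := hf.stronglyMeasurable_mk.measurable
  rw [morreyNorm_le_iff]
  intro x R hR
  have h1 := mixedLebesgue_le_of_support hq hqr hR (fun i => x i)
    (measurable_indicator_ball_toLp hF x R) fun y hy i =>
      ball_subset_cube (x := x) (R := R) (y := WithLp.toLp 2 y) (by
        by_contra hy'
        exact hy (by rw [Set.indicator_of_notMem hy']; simp)) i
  have hexp : -∑ i, lam i / q i + ∑ i, (1 / q i - 1 / r i) = -∑ i, mu i / r i := by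
    rw [← Finset.sum_neg_distrib, ← Finset.sum_add_distrib, ← Finset.sum_neg_distrib]
    refine Finset.sum_congr rfl fun i _ => ?_
    have := h i
    rw [sub_div, sub_div] at this
    linarith
  calc _ ≤ ENNReal.ofReal (R ^ (-∑ i, lam i / q i)) *
        (ENNReal.ofReal ((2 * R) ^ ∑ i, (1 / q i - 1 / r i)) *
          mixedLebesgueNorm r ((Metric.ball x R).indicator F)) := by
        gcongr
        exact h1
    _ = ENNReal.ofReal (2 ^ ∑ i, (1 / q i - 1 / r i)) *
          (ENNReal.ofReal (R ^ (-∑ i, mu i / r i)) *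
          mixedLebesgueNorm r ((Metric.ball x R).indicator F)) := by
        rw [← hexp, Real.rpow_add hR, Real.mul_rpow (by norm_num) hR.le,
          ENNReal.ofReal_mul (by positivity), ENNReal.ofReal_mul (by positivity)]
        ring
    _ ≤ _ := by
        gcongr
        exact le_morreyNorm r mu F x hR

/-- By Hölder's inequality, a function in a mixed-Morrey space has integral at most `C R^κ` over
each ball of radius `R`, with `κ = d - ∑ (1 - lam_i) / q_i`. -/
theorem lintegral_ball_le_morreyNorm {d : ℕ} {q : Fin d → ℝ} (hq : ∀ i, 1 ≤ q i)
    (lam : Fin d → ℝ) {f : E d → ℂ} (hf : AEStronglyMeasurable f) (x : E d) {R : ℝ} (hR : 0 < R) :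
    ∫⁻ y in Metric.ball x R, ‖f y‖ₑ ≤ ENNReal.ofReal (2 ^ ∑ i, (1 - 1 / q i)) *
      ENNReal.ofReal (R ^ ∑ i, (1 - (1 - lam i) / q i)) * morreyNorm q lam f := by
  have hq0 : ∀ i, 0 < q i := fun i => zero_lt_one.trans_le (hq i)
  have hfg : ∫⁻ y in Metric.ball x R, ‖f y‖ₑ = ∫⁻ y in Metric.ball x R, ‖hf.mk f y‖ₑ := by
    refine lintegral_congr_ae (ae_restrict_of_ae ?_)
    filter_upwards [hf.ae_eq_mk] with y hy
    rw [hy]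
  rw [hfg, morreyNorm_congr_ae (fun i => (hq0 i).le) lam hf.ae_eq_mk]
  set F := hf.mk f
  have hF : Measurable F := hf.stronglyMeasurable_mk.measurable
  have hm := measurable_indicator_ball_toLp hF x R
  have h0 : ∫⁻ y in Metric.ball x R, ‖F y‖ₑ =
      mixedLebesgue d (fun _ => 1) fun y => ‖(Metric.ball x R).indicator F (WithLp.toLp 2 y)‖ₑ := by
    rw [mixedLebesgue_one hm, ← lintegral_indicator measurableSet_ball,
      ← (measurePreserving_toLp d).lintegral_comp
        (hF.enorm.indicator measurableSet_ball)]
    refine lintegral_congr fun y => ?_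
    rw [enorm_indicator_eq_indicator_enorm]
  have h1 := mixedLebesgue_le_of_support (q := fun _ => 1) (r := q) (fun _ => one_pos) hq hR
    (fun i => x i) hm fun y hy i =>
      ball_subset_cube (x := x) (R := R) (y := WithLp.toLp 2 y) (by
        by_contra hy'
        exact hy (by rw [Set.indicator_of_notMem hy']; simp)) i
  rw [h0]
  calc _ ≤ ENNReal.ofReal ((2 * R) ^ ∑ i, (1 / 1 - 1 / q i)) *
        mixedLebesgueNorm q ((Metric.ball x R).indicator F) := h1
    _ ≤ ENNReal.ofReal ((2 * R) ^ ∑ i, (1 / 1 - 1 / q i)) *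
        (ENNReal.ofReal (R ^ (∑ i, lam i / q i)) * morreyNorm q lam F) := by
        gcongr
        exact mixedLebesgueNorm_indicator_ball_le q lam F x hR
    _ = _ := by
        have : ∑ i, (1 - (1 - lam i) / q i) = ∑ i, (1 - 1 / q i) + ∑ i, lam i / q i := by
          rw [← Finset.sum_add_distrib]
          refine Finset.sum_congr rfl fun i _ => ?_
          rw [sub_div]
          ring
        rw [this, Real.rpow_add hR, Real.mul_rpow (by norm_num) hR.le,
          ENNReal.ofReal_mul (by positivity), ENNReal.ofReal_mul (by positivity), div_one]
        ring

/-- Interpolation between a mixed-Morrey space and `L^∞`. -/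
theorem morreyNorm_div_le {d : ℕ} {q : Fin d → ℝ} (hq : ∀ i, 0 < q i) (lam : Fin d → ℝ) {θ : ℝ}
    (h0 : 0 < θ) (h1 : θ < 1) {f : E d → ℂ} (hf : supNorm f ≠ ∞) :
    morreyNorm (fun i => q i / θ) lam f ≤ supNorm f ^ (1 - θ) * morreyNorm q lam f ^ θ := by
  rw [morreyNorm_le_iff]
  intro x R hR
  have hb : ∀ᵐ y : Fin d → ℝ, ‖(Metric.ball x R).indicator f (WithLp.toLp 2 y)‖ₑ ≤ supNorm f := by
    refine (measurePreserving_toLp d).quasiMeasurePreserving.ae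
      (p := fun y => ‖(Metric.ball x R).indicator f y‖ₑ ≤ supNorm f) ?_
    have := ae_le_eLpNormEssSup (f := f) (μ := volume)
    filter_upwards [this] with y hy
    rw [enorm_indicator_eq_indicator_enorm]
    refine (Set.indicator_le_self _ _ _).trans ?_
    simpa [supNorm] using hy
  have h2 := mixedLebesgue_div_le hq h0 h1 hf hb
  have hR' : ENNReal.ofReal (R ^ (-∑ i, lam i / (q i / θ))) =
      ENNReal.ofReal (R ^ (-∑ i, lam i / q i)) ^ θ := by
    rw [ENNReal.ofReal_rpow_of_pos (by positivity), ← Real.rpow_mul hR.le, neg_mul, Finset.sum_mul]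
    congr 3
    refine Finset.sum_congr rfl fun i _ => ?_
    field_simp
  calc _ ≤ ENNReal.ofReal (R ^ (-∑ i, lam i / q i)) ^ θ * (supNorm f ^ (1 - θ) *
        mixedLebesgueNorm q ((Metric.ball x R).indicator f) ^ θ) := by
        rw [hR']
        gcongr
        exact h2
    _ = supNorm f ^ (1 - θ) * (ENNReal.ofReal (R ^ (-∑ i, lam i / q i)) *
        mixedLebesgueNorm q ((Metric.ball x R).indicator f)) ^ θ := by
        rw [ENNReal.mul_rpow_of_nonneg _ _ h0.le]
        ring
    _ ≤ _ := by
        gcongr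
        exact le_morreyNorm q lam f x hR

/-- **Fatou's lemma** for mixed-Morrey norms. -/
theorem morreyNorm_le_of_tendsto {d : ℕ} {q : Fin d → ℝ} (hq : ∀ i, 0 < q i) (lam : Fin d → ℝ)
    {f : ℕ → E d → ℂ} {g : E d → ℂ} (hf : ∀ n, Measurable (f n))
    (hlim : ∀ x, Tendsto (fun n => f n x) atTop (𝓝 (g x))) :
    morreyNorm q lam g ≤ liminf (fun n => morreyNorm q lam (f n)) atTop := by
  rw [morreyNorm_le_iff]
  intro x R hR
  set c := ENNReal.ofReal (R ^ (-∑ i, lam i / q i)) with hc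
  have h1 : mixedLebesgueNorm q ((Metric.ball x R).indicator g) ≤
      liminf (fun n => mixedLebesgueNorm q ((Metric.ball x R).indicator (f n))) atTop := by
    refine le_trans (mixedLebesgue_mono (fun i => (hq i).le) fun y => le_of_eq ?_)
      (mixedLebesgue_liminf_le hq fun n => measurable_indicator_ball_toLp (hf n) x R)
    refine (Tendsto.liminf_eq ?_).symm
    refine (continuous_enorm.tendsto _).comp ?_
    by_cases hy : WithLp.toLp 2 y ∈ Metric.ball x R
    · simpa only [Set.indicator_of_mem hy] using hlim _
    · simp [Set.indicator_of_notMem hy]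
  calc c * mixedLebesgueNorm q ((Metric.ball x R).indicator g)
      ≤ c * liminf (fun n => mixedLebesgueNorm q ((Metric.ball x R).indicator (f n))) atTop := by
        gcongr
    _ ≤ liminf (fun n => c * mixedLebesgueNorm q ((Metric.ball x R).indicator (f n))) atTop := by
        have hmono : Monotone fun a : ℝ≥0∞ => c * a := fun a b h => by dsimp only; gcongr
        exact (hmono.map_liminf_of_continuousAt _
          (ENNReal.continuous_const_mul ENNReal.ofReal_ne_top).continuousAt).le
    _ ≤ _ := liminf_le_liminf (Eventually.of_forall fun n => le_morreyNorm q lam (f n) x hR)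

/-- **Young's inequality** for the convolution of an integrable kernel with a function of a
mixed-Morrey space. -/
theorem morreyNorm_convolution_le {d : ℕ} {q : Fin d → ℝ} (hq : ∀ i, 1 ≤ q i) (lam : Fin d → ℝ)
    {f g K : E d → ℂ} (hf : AEStronglyMeasurable f) (hK : Measurable K)
    (hg : ∀ y, ‖g y‖ₑ ≤ ∫⁻ z, ‖K z‖ₑ * ‖f (y + z)‖ₑ) :
    morreyNorm q lam g ≤ (∫⁻ z, ‖K z‖ₑ) * morreyNorm q lam f := by
  have hq0 : ∀ i, 0 < q i := fun i => zero_lt_one.trans_le (hq i)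
  have hg' : ∀ y, ‖g y‖ₑ ≤ ∫⁻ z, ‖K z‖ₑ * ‖hf.mk f (y + z)‖ₑ := by
    intro y
    refine (hg y).trans_eq (lintegral_congr_ae ?_)
    filter_upwards [(measurePreserving_add_left volume y).quasiMeasurePreserving.ae
      hf.ae_eq_mk] with z hz
    rw [hz]
  rw [morreyNorm_congr_ae (fun i => (hq0 i).le) lam hf.ae_eq_mk]
  set F := hf.mk f
  have hF : Measurable F := hf.stronglyMeasurable_mk.measurable
  rw [morreyNorm_le_iff]
  intro x R hR
  set c := ENNReal.ofReal (R ^ (-∑ i, lam i / q i)) with hc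
  have hc' : c ≠ ∞ := ENNReal.ofReal_ne_top
  have hsh : ∀ (z : E d) (y : Fin d → ℝ),
      (Metric.ball (x + z) R).indicator F (WithLp.toLp 2 (y + z.ofLp)) =
      (Metric.ball x R).indicator (fun y => F (y + z)) (WithLp.toLp 2 y) := by
    intro z y
    have : WithLp.toLp 2 (y + z.ofLp) = WithLp.toLp 2 y + z := rfl
    rw [this]
    by_cases hy : WithLp.toLp 2 y ∈ Metric.ball x R
    · rw [Set.indicator_of_mem hy, Set.indicator_of_mem]
      simpa [mem_ball_iff_norm] using hy
    · rw [Set.indicator_of_notMem hy, Set.indicator_of_notMem]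
      simpa [mem_ball_iff_norm] using hy
  have hmeas : Measurable fun p : E d × (Fin d → ℝ) =>
      ‖K p.1‖ₑ * ‖(Metric.ball x R).indicator (fun y => F (y + p.1)) (WithLp.toLp 2 p.2)‖ₑ := by
    refine (hK.comp measurable_fst).enorm.mul (Measurable.enorm ?_)
    have : (fun p : E d × (Fin d → ℝ) =>
        (Metric.ball x R).indicator (fun y => F (y + p.1)) (WithLp.toLp 2 p.2)) =
        ((fun p : E d × (Fin d → ℝ) => (WithLp.toLp 2 p.2 : E d)) ⁻¹' Metric.ball x R).indicator
          (fun p => F (WithLp.toLp 2 p.2 + p.1)) := by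
      funext p
      rfl
    rw [this]
    have h2 : Measurable fun p : E d × (Fin d → ℝ) => (WithLp.toLp 2 p.2 : E d) :=
      (measurePreserving_toLp d).measurable.comp measurable_snd
    exact (hF.comp (h2.add measurable_fst)).indicator (h2 measurableSet_ball)
  calc c * mixedLebesgueNorm q ((Metric.ball x R).indicator g)
      ≤ c * mixedLebesgue d q (fun y => ∫⁻ z, ‖K z‖ₑ *
          ‖(Metric.ball x R).indicator (fun y => F (y + z)) (WithLp.toLp 2 y)‖ₑ) := by
        gcongr
        refine mixedLebesgue_mono (fun i => (hq0 i).le) fun y => ?_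
        by_cases hy : WithLp.toLp 2 y ∈ Metric.ball x R
        · simpa only [Set.indicator_of_mem hy] using hg' _
        · simp [Set.indicator_of_notMem hy]
    _ ≤ c * ∫⁻ z, mixedLebesgue d q (fun y => ‖K z‖ₑ *
          ‖(Metric.ball x R).indicator (fun y => F (y + z)) (WithLp.toLp 2 y)‖ₑ) := by
        gcongr
        exact mixedLebesgue_lintegral_le volume hq hmeas
    _ = ∫⁻ z, ‖K z‖ₑ * (c * mixedLebesgueNorm q ((Metric.ball (x + z) R).indicator F)) := by
        rw [← lintegral_const_mul' _ _ hc']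
        refine lintegral_congr fun z => ?_
        rw [mixedLebesgue_const_mul hq0 enorm_ne_top, mul_left_comm]
        congr 2
        rw [mixedLebesgueNorm, ← mixedLebesgue_comp_add q (fun y =>
          ‖(Metric.ball (x + z) R).indicator F (WithLp.toLp 2 y)‖ₑ) z.ofLp]
        exact congrArg _ (funext fun y => congrArg _ (hsh z y).symm)
    _ ≤ ∫⁻ z, ‖K z‖ₑ * morreyNorm q lam F := by
        gcongr with z
        exact le_morreyNorm q lam F (x + z) hR
    _ = _ := by rw [lintegral_mul_const _ hK.enorm]

/-- The projection `(x', x'') ↦ x'`. -/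
def proj (d m : ℕ) (x : E (d + m)) : E d := WithLp.toLp 2 fun i => x (Fin.castAdd m i)

theorem proj_glue {d m : ℕ} (x' : E d) (x'' : E m) : proj d m (glue x' x'') = x' := by
  ext i
  simp [proj, glue]

theorem dist_proj_le {d m : ℕ} (x y : E (d + m)) : dist (proj d m x) (proj d m y) ≤ dist x y := by
  rw [EuclideanSpace.dist_eq, EuclideanSpace.dist_eq]
  refine Real.sqrt_le_sqrt ?_
  rw [Fin.sum_univ_add]
  exact le_add_of_nonneg_right (Finset.sum_nonneg fun i _ => sq_nonneg _)

/-- The mixed-Morrey norm on `ℝ^{d+m}` of a function of the first `d` variables. A ball of radius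
`R` is contained in a cube of side `2R`, and integration over the last `m` variables gives the power
of `R` that the condition on the exponents balances. -/
theorem morreyNorm_comp_proj_le {d m : ℕ} {q β : Fin (d + m) → ℝ} (hq : ∀ i, 0 < q i)
    {lam : Fin d → ℝ}
    (h : ∑ i, (1 - β i) / q i = ∑ i, (1 - lam i) / q (Fin.castAdd m i)) (f : E d → ℂ) :
    morreyNorm q β (f ∘ proj d m) ≤ ENNReal.ofReal (2 ^ ∑ i, 1 / q (Fin.natAdd d i)) *
      morreyNorm (fun i => q (Fin.castAdd m i)) lam f := by
  rw [morreyNorm_le_iff]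
  intro x R hR
  have h1 := mixedLebesgue_append_le hq hR (fun i => x (Fin.natAdd d i))
    (F := fun y => ‖(Metric.ball x R).indicator (f ∘ proj d m) (WithLp.toLp 2 y)‖ₑ)
    (f := fun y => ‖(Metric.ball (proj d m x) R).indicator f (WithLp.toLp 2 y)‖ₑ)
    (fun y => by
      by_cases hy : WithLp.toLp 2 y ∈ Metric.ball x R
      · rw [Set.indicator_of_mem hy, Set.indicator_of_mem]
        · exact le_rfl
        · exact (dist_proj_le (WithLp.toLp 2 y) x).trans_lt hy
      · rw [Set.indicator_of_notMem hy]
        simp)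
    (fun y hy i => ball_subset_cube (x := x) (R := R) (y := WithLp.toLp 2 y) (by
        by_contra hy'
        exact hy (by rw [Set.indicator_of_notMem hy']; simp)) _)
  set q' : Fin d → ℝ := fun i => q (Fin.castAdd m i) with hq'
  have hexp : -∑ i, β i / q i + ∑ i, 1 / q (Fin.natAdd d i) = -∑ i, lam i / q' i := by
    simp only [sub_div, Finset.sum_sub_distrib] at h
    rw [Fin.sum_univ_add (fun i => 1 / q i)] at h
    simp only [hq']
    linarith
  calc _ ≤ ENNReal.ofReal (R ^ (-∑ i, β i / q i)) *
        (ENNReal.ofReal ((2 * R) ^ ∑ i, 1 / q (Fin.natAdd d i)) *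
          mixedLebesgueNorm q' ((Metric.ball (proj d m x) R).indicator f)) := by
        gcongr
        exact h1
    _ = ENNReal.ofReal (2 ^ ∑ i, 1 / q (Fin.natAdd d i)) *
          (ENNReal.ofReal (R ^ (-∑ i, lam i / q' i)) *
          mixedLebesgueNorm q' ((Metric.ball (proj d m x) R).indicator f)) := by
        rw [← hexp, Real.rpow_add hR, Real.mul_rpow (by norm_num) hR.le,
          ENNReal.ofReal_mul (by positivity), ENNReal.ofReal_mul (by positivity)]
        ring
    _ ≤ _ := by
        gcongr
        exact le_morreyNorm q' lam f _ hR

/-! ### The sequence norms -/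

theorem seqNorm_top (a : ℤ → ℝ≥0∞) : seqNorm ∞ a = ⨆ l, a l := if_pos rfl

theorem seqNorm_of_ne_top {r : ℝ≥0∞} (hr : r ≠ ∞) (a : ℤ → ℝ≥0∞) :
    seqNorm r a = (∑' l, a l ^ r.toReal) ^ (1 / r.toReal) := if_neg hr

theorem one_le_toReal {r : ℝ≥0∞} (h1 : 1 ≤ r) (hr : r ≠ ∞) : 1 ≤ r.toReal := by
  simpa using (ENNReal.toReal_le_toReal ENNReal.one_ne_top hr).2 h1

theorem seqNorm_mono (r : ℝ≥0∞) {a b : ℤ → ℝ≥0∞} (h : ∀ l, a l ≤ b l) :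
    seqNorm r a ≤ seqNorm r b := by
  by_cases hr : r = ∞
  · subst hr
    rw [seqNorm_top, seqNorm_top]
    exact iSup_mono h
  · rw [seqNorm_of_ne_top hr, seqNorm_of_ne_top hr]
    gcongr with l
    exact h l

theorem seqNorm_const_mul {r : ℝ≥0∞} (h1 : 1 ≤ r) (c : ℝ≥0∞) (a : ℤ → ℝ≥0∞) :
    seqNorm r (fun l => c * a l) = c * seqNorm r a := by
  by_cases hr : r = ∞
  · subst hr
    rw [seqNorm_top, seqNorm_top, ENNReal.mul_iSup]
  · have h2 := one_le_toReal h1 hr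
    have h0 : 0 < r.toReal := by linarith
    rw [seqNorm_of_ne_top hr, seqNorm_of_ne_top hr]
    simp_rw [ENNReal.mul_rpow_of_nonneg _ _ h0.le]
    rw [ENNReal.tsum_mul_left, ENNReal.mul_rpow_of_nonneg _ _ (by positivity), ← ENNReal.rpow_mul,
      mul_one_div_cancel h0.ne', ENNReal.rpow_one]

theorem le_seqNorm {r : ℝ≥0∞} (h1 : 1 ≤ r) (a : ℤ → ℝ≥0∞) (l : ℤ) : a l ≤ seqNorm r a := by
  by_cases hr : r = ∞
  · subst hr
    rw [seqNorm_top]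
    exact le_iSup a l
  · have h0 : 0 < r.toReal := zero_lt_one.trans_le (one_le_toReal h1 hr)
    rw [seqNorm_of_ne_top hr, one_div, ENNReal.le_rpow_inv_iff h0]
    exact ENNReal.le_tsum l

theorem seqNorm_add_le {r : ℝ≥0∞} (h1 : 1 ≤ r) (a b : ℤ → ℝ≥0∞) :
    seqNorm r (fun l => a l + b l) ≤ seqNorm r a + seqNorm r b := by
  by_cases hr : r = ∞
  · subst hr
    rw [seqNorm_top, seqNorm_top, seqNorm_top]
    exact iSup_le fun l => add_le_add (le_iSup a l) (le_iSup b l)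
  · have h := ENNReal.lintegral_Lp_add_le (μ := (Measure.count : Measure ℤ))
      (measurable_of_countable a).aemeasurable (measurable_of_countable b).aemeasurable
      (one_le_toReal h1 hr)
    simp only [lintegral_count, Pi.add_apply] at h
    rwa [seqNorm_of_ne_top hr, seqNorm_of_ne_top hr, seqNorm_of_ne_top hr]

theorem seqNorm_anti {r t : ℝ≥0∞} (h1 : 1 ≤ r) (hrt : r ≤ t) (a : ℤ → ℝ≥0∞) :
    seqNorm t a ≤ seqNorm r a := by
  by_cases ht : t = ∞
  · subst ht
    rw [seqNorm_top]
    exact iSup_le fun l => le_seqNorm h1 a l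
  have hr : r ≠ ∞ := ne_top_of_le_ne_top ht hrt
  have hr0 : 0 < r.toReal := zero_lt_one.trans_le (one_le_toReal h1 hr)
  have hrt' : r.toReal ≤ t.toReal := (ENNReal.toReal_le_toReal hr ht).2 hrt
  have ht0 : 0 < t.toReal := hr0.trans_le hrt'
  set S := seqNorm r a with hS
  have hSr : ∑' l, a l ^ r.toReal = S ^ r.toReal := by
    rw [hS, seqNorm_of_ne_top hr, ← ENNReal.rpow_mul, one_div_mul_cancel hr0.ne', ENNReal.rpow_one]
  rw [seqNorm_of_ne_top ht, one_div, ENNReal.rpow_inv_le_iff ht0]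
  calc ∑' l, a l ^ t.toReal
      = ∑' l, a l ^ (t.toReal - r.toReal) * a l ^ r.toReal := by
        refine tsum_congr fun l => ?_
        rw [← ENNReal.rpow_add_of_nonneg _ _ (by linarith) hr0.le, sub_add_cancel]
    _ ≤ ∑' l, S ^ (t.toReal - r.toReal) * a l ^ r.toReal := by
        gcongr with l
        exact le_seqNorm h1 a l
    _ = S ^ t.toReal := by
        rw [ENNReal.tsum_mul_left, hSr, ← ENNReal.rpow_add_of_nonneg _ _ (by linarith) hr0.le,
          sub_add_cancel]

theorem seqNorm_comp_add (r : ℝ≥0∞) (a : ℤ → ℝ≥0∞) (k : ℤ) :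
    seqNorm r (fun l => a (l + k)) = seqNorm r a := by
  by_cases hr : r = ∞
  · subst hr
    rw [seqNorm_top, seqNorm_top]
    exact (Equiv.addRight k).iSup_comp (g := a)
  · rw [seqNorm_of_ne_top hr, seqNorm_of_ne_top hr]
    congr 1
    exact (Equiv.addRight k).tsum_eq fun l => a l ^ r.toReal

/-- **Fatou's lemma** for the sequence norms. -/
theorem seqNorm_liminf_le {r : ℝ≥0∞} (h1 : 1 ≤ r) (a : ℕ → ℤ → ℝ≥0∞) :
    seqNorm r (fun l => liminf (fun n => a n l) atTop) ≤
      liminf (fun n => seqNorm r (a n)) atTop := by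
  by_cases hr : r = ∞
  · subst hr
    simp only [seqNorm_top]
    exact iSup_le fun l => liminf_le_liminf (Eventually.of_forall fun n => le_iSup (a n) l)
  · have h0 : 0 < r.toReal := zero_lt_one.trans_le (one_le_toReal h1 hr)
    have hpow : ∀ {p : ℝ}, 0 ≤ p → ∀ u : ℕ → ℝ≥0∞,
        (liminf u atTop) ^ p = liminf (fun n => u n ^ p) atTop := fun {p} hp u =>
      (ENNReal.monotone_rpow_of_nonneg hp).map_liminf_of_continuousAt u
        ENNReal.continuous_rpow_const.continuousAt
    simp only [seqNorm_of_ne_top hr]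
    rw [← hpow (by positivity)]
    refine ENNReal.rpow_le_rpow ?_ (by positivity)
    simp_rw [hpow h0.le]
    have h := lintegral_liminf_le (μ := (Measure.count : Measure ℤ)) (u := atTop)
      (f := fun (n : ℕ) l => a n l ^ r.toReal) fun n => measurable_of_countable _
    simpa only [lintegral_count] using h

/-! ### Derivative estimates for dilated symbols -/

theorem HasCompactSupport.exists_norm_iteratedFDeriv_le {d : ℕ} {a : E d → ℂ}
    (ha : ContDiff ℝ (⊤ : ℕ∞) a) (hc : HasCompactSupport a) (n : ℕ) :
    ∃ A : ℝ, 0 ≤ A ∧ ∀ i ≤ n, ∀ x, ‖iteratedFDeriv ℝ i a x‖ ≤ A := by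
  refine ⟨∑ i ∈ Finset.range (n + 1), SchwartzMap.seminorm ℝ 0 i (hc.toSchwartzMap ha),
    Finset.sum_nonneg fun i _ => apply_nonneg _ _, fun i hi x => ?_⟩
  refine (SchwartzMap.norm_iteratedFDeriv_le_seminorm ℝ (hc.toSchwartzMap ha) i x).trans ?_
  exact Finset.single_le_sum
    (f := fun i => SchwartzMap.seminorm ℝ 0 i (hc.toSchwartzMap ha))
    (fun i _ => apply_nonneg _ _) (Finset.mem_range_succ_iff.2 hi)

theorem norm_iteratedFDeriv_comp_smul_mul_le {d : ℕ} {a h : E d → ℂ}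
    (ha : ContDiff ℝ (⊤ : ℕ∞) a) (hh : ContDiff ℝ (⊤ : ℕ∞) h) {n : ℕ} {A : ℝ}
    (hA : ∀ i ≤ n, ∀ x, ‖iteratedFDeriv ℝ i a x‖ ≤ A) {c : ℝ} (hc : 0 ≤ c) (x : E d) :
    ‖iteratedFDeriv ℝ n (fun y => a (c • y) * h y) x‖ ≤ ∑ i ∈ Finset.range (n + 1),
      (n.choose i : ℝ) * (c ^ i * A) * ‖iteratedFDeriv ℝ (n - i) h x‖ := by
  have hac : ContDiff ℝ (⊤ : ℕ∞) fun y => a (c • y) := ha.comp (contDiff_const_smul c)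
  refine (norm_iteratedFDeriv_mul_le hac hh x (by exact_mod_cast le_top)).trans ?_
  refine Finset.sum_le_sum fun i hi => ?_
  have hi' : i ≤ n := Finset.mem_range_succ_iff.1 hi
  have : ‖iteratedFDeriv ℝ i (fun y => a (c • y)) x‖ ≤ c ^ i * A := by
    rw [iteratedFDeriv_comp_const_smul c (ha.of_le (by exact_mod_cast le_top)), norm_smul,
      Real.norm_of_nonneg (by positivity)]
    gcongr
    exact hA i hi' _
  gcongr

theorem iteratedFDeriv_comp_smul_mul_eq_zero {d : ℕ} {a h : E d → ℂ} (n : ℕ) {c : ℝ} {x : E d}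
    (hx : c • x ∉ tsupport a) : iteratedFDeriv ℝ n (fun y => a (c • y) * h y) x = 0 := by
  have h1 : a =ᶠ[𝓝 (c • x)] 0 := notMem_tsupport_iff_eventuallyEq.1 hx
  have h2 : (fun y => a (c • y) * h y) =ᶠ[𝓝 x] fun _ => 0 := by
    have : Tendsto (fun y : E d => c • y) (𝓝 x) (𝓝 (c • x)) := tendsto_const_nhds.smul tendsto_id
    filter_upwards [this.eventually h1] with y hy
    rw [hy, Pi.zero_apply, zero_mul]
  rw [(h2.iteratedFDeriv ℝ n).eq_of_nhds]
  simp

/-- Taylor's estimate: if the derivatives of `h` of order at most `N` vanish at `0`, then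
`D^j h (η) = O(|η|^{N+1-j})`. -/
theorem norm_iteratedFDeriv_le_of_vanishing {d : ℕ} (h : 𝓢(E d, ℂ)) {N : ℕ}
    (h0 : ∀ j ≤ N, iteratedFDeriv ℝ j h 0 = 0) {j k : ℕ} (hjk : j + k = N + 1) (x : E d) :
    ‖iteratedFDeriv ℝ j h x‖ ≤ SchwartzMap.seminorm ℝ 0 (N + 1) h * ‖x‖ ^ k := by
  induction k generalizing j x with
  | zero =>
    obtain rfl : j = N + 1 := by omega
    simpa using SchwartzMap.norm_iteratedFDeriv_le_seminorm ℝ h (N + 1) x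
  | succ k ih =>
    have hb : ∀ y ∈ Metric.closedBall (0 : E d) ‖x‖,
        ‖fderiv ℝ (iteratedFDeriv ℝ j h) y‖ ≤ SchwartzMap.seminorm ℝ 0 (N + 1) h * ‖x‖ ^ k := by
      intro y hy
      rw [norm_fderiv_iteratedFDeriv]
      refine (ih (j := j + 1) (by omega) y).trans ?_
      gcongr
      simpa using hy
    have hd : ∀ y ∈ Metric.closedBall (0 : E d) ‖x‖,
        DifferentiableAt ℝ (iteratedFDeriv ℝ j h) y := fun y _ =>
      ((h.smooth (j + 1)).contDiffAt.differentiableAt_iteratedFDeriv (by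
        norm_cast
        omega))
    have := (convex_closedBall (0 : E d) ‖x‖).norm_image_sub_le_of_norm_fderiv_le hd hb
      (Metric.mem_closedBall_self (norm_nonneg x)) (by simp : x ∈ Metric.closedBall 0 ‖x‖)
    rw [h0 j (by omega), sub_zero, sub_zero] at this
    rw [pow_succ, ← mul_assoc]
    exact this

theorem exists_norm_iteratedFDeriv_dilate_mul_le {d : ℕ} {a : E d → ℂ}
    (ha : ContDiff ℝ (⊤ : ℕ∞) a)
    (hA : ∀ n, ∃ A : ℝ, 0 ≤ A ∧ ∀ i ≤ n, ∀ x, ‖iteratedFDeriv ℝ i a x‖ ≤ A) {δ : ℝ} (hδ : 0 < δ)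
    (hsupp : ∀ x ∈ tsupport a, δ ≤ ‖x‖) (h : 𝓢(E d, ℂ)) (k n : ℕ) :
    ∃ C : ℝ, 0 ≤ C ∧ ∀ (K : ℕ) (x : E d),
      ‖x‖ ^ k * ‖iteratedFDeriv ℝ n (fun y => a ((1 / 2 : ℝ) ^ K • y) * h y) x‖ ≤
        C * (1 / 2) ^ K := by
  obtain ⟨A, hA0, hA⟩ := hA n
  refine ⟨(∑ i ∈ Finset.range (n + 1), (n.choose i : ℝ) * A *
    SchwartzMap.seminorm ℝ (k + 1) (n - i) h) / δ, ?_, fun K x => ?_⟩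
  · have : ∀ i ∈ Finset.range (n + 1), 0 ≤ (n.choose i : ℝ) * A *
      SchwartzMap.seminorm ℝ (k + 1) (n - i) h := fun i _ => by positivity
    exact div_nonneg (Finset.sum_nonneg this) hδ.le
  by_cases hx : (1 / 2 : ℝ) ^ K • x ∈ tsupport a
  · have h1 := hsupp _ hx
    rw [norm_smul, Real.norm_of_nonneg (by positivity)] at h1
    set c : ℝ := (1 / 2) ^ K with hc
    have hc0 : 0 < c := by positivity
    have hc1 : c ≤ 1 := pow_le_one₀ (by norm_num) (by norm_num)
    calc ‖x‖ ^ k * ‖iteratedFDeriv ℝ n (fun y => a (c • y) * h y) x‖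
        ≤ ‖x‖ ^ k * ∑ i ∈ Finset.range (n + 1),
            (n.choose i : ℝ) * (c ^ i * A) * ‖iteratedFDeriv ℝ (n - i) h x‖ := by
          gcongr
          exact norm_iteratedFDeriv_comp_smul_mul_le ha (h.smooth _) hA hc0.le x
      _ ≤ ∑ i ∈ Finset.range (n + 1),
            (n.choose i : ℝ) * A * SchwartzMap.seminorm ℝ (k + 1) (n - i) h / δ * c := by
          rw [Finset.mul_sum]
          refine Finset.sum_le_sum fun i _ => ?_
          have h2 := SchwartzMap.le_seminorm ℝ (k + 1) (n - i) h x
          have h3 : ‖x‖ ^ k * ‖iteratedFDeriv ℝ (n - i) h x‖ ≤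
              SchwartzMap.seminorm ℝ (k + 1) (n - i) h / δ * c := by
            rw [div_mul_eq_mul_div, le_div_iff₀ hδ]
            calc ‖x‖ ^ k * ‖iteratedFDeriv ℝ (n - i) h x‖ * δ
                ≤ ‖x‖ ^ k * ‖iteratedFDeriv ℝ (n - i) h x‖ * (c * ‖x‖) := by gcongr
              _ = (‖x‖ ^ (k + 1) * ‖iteratedFDeriv ℝ (n - i) h x‖) * c := by ring
              _ ≤ _ := by gcongr
          have h4 : c ^ i ≤ 1 := pow_le_one₀ hc0.le hc1
          calc ‖x‖ ^ k * ((n.choose i : ℝ) * (c ^ i * A) * ‖iteratedFDeriv ℝ (n - i) h x‖)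
              = (n.choose i : ℝ) * (c ^ i * A) *
                (‖x‖ ^ k * ‖iteratedFDeriv ℝ (n - i) h x‖) := by ring
            _ ≤ (n.choose i : ℝ) * (1 * A) *
                (SchwartzMap.seminorm ℝ (k + 1) (n - i) h / δ * c) := by gcongr
            _ = _ := by ring
      _ = _ := by rw [← Finset.sum_mul, Finset.sum_div]
  · rw [iteratedFDeriv_comp_smul_mul_eq_zero n hx, norm_zero, mul_zero]
    have : ∀ i ∈ Finset.range (n + 1), 0 ≤ (n.choose i : ℝ) * A *
      SchwartzMap.seminorm ℝ (k + 1) (n - i) h := fun i _ => by positivity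
    exact mul_nonneg (div_nonneg (Finset.sum_nonneg this) hδ.le) (by positivity)

theorem exists_norm_iteratedFDeriv_contract_mul_le {d : ℕ} {a : E d → ℂ}
    (ha : ContDiff ℝ (⊤ : ℕ∞) a)
    (hA : ∀ n, ∃ A : ℝ, 0 ≤ A ∧ ∀ i ≤ n, ∀ x, ‖iteratedFDeriv ℝ i a x‖ ≤ A) {ρ : ℝ} (hρ : 1 ≤ ρ)
    (hsupp : ∀ x ∈ tsupport a, ‖x‖ ≤ ρ) (h : 𝓢(E d, ℂ)) {N : ℕ}
    (h0 : ∀ j ≤ N, iteratedFDeriv ℝ j h 0 = 0) (k : ℕ) {n : ℕ} (hn : n ≤ N) :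
    ∃ C : ℝ, 0 ≤ C ∧ ∀ (K : ℕ) (x : E d),
      ‖x‖ ^ k * ‖iteratedFDeriv ℝ n (fun y => a ((2 : ℝ) ^ K • y) * h y) x‖ ≤
        C * (1 / 2) ^ K := by
  obtain ⟨A, hA0, hA⟩ := hA n
  set H := SchwartzMap.seminorm ℝ 0 (N + 1) h with hH
  have hH0 : 0 ≤ H := apply_nonneg _ _
  refine ⟨∑ i ∈ Finset.range (n + 1), (n.choose i : ℝ) * A * H * ρ ^ (k + (N + 1)), by positivity,
    fun K x => ?_⟩
  by_cases hx : (2 : ℝ) ^ K • x ∈ tsupport a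
  · have h1 := hsupp _ hx
    rw [norm_smul, Real.norm_of_nonneg (by positivity)] at h1
    set c : ℝ := 2 ^ K with hc
    have hc1 : 1 ≤ c := one_le_pow₀ (by norm_num)
    have hc0 : 0 < c := by positivity
    have hxρ : ‖x‖ ≤ ρ := le_trans (le_mul_of_one_le_left (norm_nonneg x) hc1) h1
    calc ‖x‖ ^ k * ‖iteratedFDeriv ℝ n (fun y => a (c • y) * h y) x‖
        ≤ ‖x‖ ^ k * ∑ i ∈ Finset.range (n + 1),
            (n.choose i : ℝ) * (c ^ i * A) * ‖iteratedFDeriv ℝ (n - i) h x‖ := by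
          gcongr
          exact norm_iteratedFDeriv_comp_smul_mul_le ha (h.smooth _) hA hc0.le x
      _ ≤ ∑ i ∈ Finset.range (n + 1),
            (n.choose i : ℝ) * A * H * ρ ^ (k + (N + 1)) * (1 / 2) ^ K := by
          rw [Finset.mul_sum]
          refine Finset.sum_le_sum fun i hi => ?_
          have hi' : i ≤ n := Finset.mem_range_succ_iff.1 hi
          have h2 := norm_iteratedFDeriv_le_of_vanishing h h0
            (show (n - i) + (N + 1 - (n - i)) = N + 1 by omega) x
          set p := N + 1 - (n - i) with hp
          have hip : i + 1 ≤ p := by omega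
          -- `c ^ (i + 1) * ‖x‖ ^ p ≤ (c * ‖x‖) ^ p`, as `p ≥ i + 1` and `c ≥ 1`
          have h3 : c ^ i * ‖x‖ ^ p ≤ ρ ^ (N + 1) * c⁻¹ := by
            rw [← div_eq_mul_inv, le_div_iff₀ hc0]
            calc c ^ i * ‖x‖ ^ p * c = c ^ (i + 1) * ‖x‖ ^ p := by ring
              _ ≤ c ^ p * ‖x‖ ^ p := by gcongr
              _ = (c * ‖x‖) ^ p := by rw [mul_pow]
              _ ≤ ρ ^ p := by gcongr
              _ ≤ ρ ^ (N + 1) := pow_le_pow_right₀ hρ (by omega)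
          calc ‖x‖ ^ k * ((n.choose i : ℝ) * (c ^ i * A) * ‖iteratedFDeriv ℝ (n - i) h x‖)
              ≤ ρ ^ k * ((n.choose i : ℝ) * (c ^ i * A) * (H * ‖x‖ ^ p)) := by gcongr
            _ = (n.choose i : ℝ) * A * H * ρ ^ k * (c ^ i * ‖x‖ ^ p) := by ring
            _ ≤ (n.choose i : ℝ) * A * H * ρ ^ k * (ρ ^ (N + 1) * c⁻¹) := by gcongr
            _ = _ := by
              rw [hc, one_div, inv_pow, pow_add]
              ring
      _ = _ := by rw [← Finset.sum_mul]
  · rw [iteratedFDeriv_comp_smul_mul_eq_zero n hx, norm_zero, mul_zero]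
    positivity

/-- Smooth cutoff: if `χ = 1` near `0`, then `χ(2^{-K} ·) h → h` in `𝒮`. -/
theorem tendsto_cutoff {d : ℕ} {χ : E d → ℂ} (hχ : ContDiff ℝ (⊤ : ℕ∞) χ)
    (hc : HasCompactSupport χ) {δ : ℝ} (hδ : 0 < δ) (h1 : ∀ x, ‖x‖ < δ → χ x = 1)
    (h : 𝓢(E d, ℂ)) :
    Tendsto (fun K : ℕ => SchwartzMap.smulLeftCLM ℂ (fun x => χ ((1 / 2 : ℝ) ^ K • x)) h) atTop
      (𝓝 h) := by
  have hχK : ∀ K : ℕ, (fun x => χ ((1 / 2 : ℝ) ^ K • x)).HasTemperateGrowth := fun K =>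
    HasCompactSupport.hasTemperateGrowth
      (hc.comp_homeomorph (Homeomorph.smulOfNeZero ((1 / 2 : ℝ) ^ K) (by positivity)))
      (hχ.comp (contDiff_const_smul _) : ContDiff ℝ _ fun x => χ ((1 / 2 : ℝ) ^ K • x))
  set a : E d → ℂ := fun x => χ x - 1 with ha
  have had : ContDiff ℝ (⊤ : ℕ∞) a := hχ.sub contDiff_const
  have hA : ∀ n, ∃ A : ℝ, 0 ≤ A ∧ ∀ i ≤ n, ∀ x, ‖iteratedFDeriv ℝ i a x‖ ≤ A := by
    intro n
    obtain ⟨A, hA0, hA⟩ := HasCompactSupport.exists_norm_iteratedFDeriv_le hχ hc n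
    refine ⟨A + 1, by linarith, fun i hi x => ?_⟩
    rcases Nat.eq_zero_or_pos i with rfl | hi0
    · rw [norm_iteratedFDeriv_zero]
      refine (norm_sub_le _ _).trans ?_
      have := hA 0 hi x
      rw [norm_iteratedFDeriv_zero] at this
      rw [norm_one]
      linarith
    · have h2 : iteratedFDeriv ℝ i a x = iteratedFDeriv ℝ i χ x := by
        rw [show a = χ - fun _ => 1 from rfl, iteratedFDeriv_sub_apply
          ((hχ.of_le (by exact_mod_cast le_top)).contDiffAt) contDiff_const.contDiffAt,
          iteratedFDeriv_const_of_ne (by omega)]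
        simp
      rw [h2]
      linarith [hA i hi x]
  have hsupp : ∀ x ∈ tsupport a, δ ≤ ‖x‖ := by
    intro x hx
    have hcl : IsClosed {x : E d | δ ≤ ‖x‖} := isClosed_le continuous_const continuous_norm
    refine closure_minimal (fun y hy => ?_) hcl hx
    by_contra hy'
    exact hy (by simp [ha, h1 y (not_le.1 hy')])
  rw [(schwartz_withSeminorms ℝ (E d) ℂ).tendsto_nhds]
  rintro ⟨k, n⟩ ε hε
  obtain ⟨C, hC0, hC⟩ := exists_norm_iteratedFDeriv_dilate_mul_le had hA hδ hsupp h k n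
  have hlim : Tendsto (fun K : ℕ => C * (1 / 2 : ℝ) ^ K) atTop (𝓝 0) := by
    simpa using (tendsto_pow_atTop_nhds_zero_of_lt_one (by norm_num : (0 : ℝ) ≤ 1 / 2)
      (by norm_num)).const_mul C
  filter_upwards [hlim.eventually (gt_mem_nhds hε)] with K hK
  refine lt_of_le_of_lt (SchwartzMap.seminorm_le_bound ℝ k n _ (by positivity) fun x => ?_) hK
  have : ((SchwartzMap.smulLeftCLM ℂ (fun x => χ ((1 / 2 : ℝ) ^ K • x)) h - h : 𝓢(E d, ℂ)) :
      E d → ℂ) = fun y => a ((1 / 2 : ℝ) ^ K • y) * h y := by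
    funext y
    rw [sub_apply, SchwartzMap.smulLeftCLM_apply_apply (hχK K), smul_eq_mul, ha]
    ring
  rw [this]
  exact hC K x

/-- The Fourier transform of a function supported in a ball, with bounded derivatives. -/
theorem norm_fourier_le_of_support {d : ℕ} (ρ : ℝ) (k : ℕ) :
    ∃ C : ℝ, 0 < C ∧ ∀ (G : E d → ℂ) (A : ℝ), ContDiff ℝ (⊤ : ℕ∞) G →
      tsupport G ⊆ Metric.closedBall 0 ρ → (∀ n ≤ k, ∀ x, ‖iteratedFDeriv ℝ n G x‖ ≤ A) →
      ∀ x, ‖𝓕 G x‖ ≤ C * A * ((1 + ‖x‖) ^ k)⁻¹ := by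
  set V : ℝ := (volume : Measure (E d)).real (Metric.closedBall 0 ρ) with hV
  have hV0 : 0 ≤ V := measureReal_nonneg
  refine ⟨2 ^ k * (2 * 2 ^ k) * (k + 1) * (V + 1), by positivity, ?_⟩
  intro G A hG hsupp hA x
  have hA0 : 0 ≤ A := (norm_nonneg _).trans (hA 0 (Nat.zero_le k) 0)
  have hcs : HasCompactSupport G :=
    HasCompactSupport.of_support_subset_isCompact (isCompact_closedBall 0 ρ)
      ((subset_tsupport G).trans hsupp)
  have hint : ∀ n ≤ k, ∫ v, ‖v‖ ^ 0 * ‖iteratedFDeriv ℝ n G v‖ ≤ A * V := by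
    intro n hn
    simp only [pow_zero, one_mul]
    have hz : ∀ v, v ∉ Metric.closedBall (0 : E d) ρ → ‖iteratedFDeriv ℝ n G v‖ = 0 := by
      intro v hv
      rw [norm_eq_zero]
      by_contra h
      exact hv (hsupp (support_iteratedFDeriv_subset n h))
    rw [← setIntegral_eq_integral_of_forall_compl_eq_zero hz]
    have := norm_setIntegral_le_of_norm_le_const (μ := volume)
      (isCompact_closedBall (0 : E d) ρ).measure_lt_top
      (f := fun v => ‖iteratedFDeriv ℝ n G v‖) (C := A) (fun v _ => by
        rw [norm_norm]; exact hA n hn v)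
    exact (Real.le_norm_self _).trans this
  have hb : ∀ n ≤ k, ‖x‖ ^ n * ‖𝓕 G x‖ ≤ 2 ^ k * ((k + 1) * (A * V)) := by
    intro n hn
    have h := Real.pow_mul_norm_iteratedFDeriv_fourier_le (K := 0) (N := ⊤) (f := G) hG
      (fun p q _ _ => ((hcs.toSchwartzMap hG).integrable_pow_mul_iteratedFDeriv volume p q))
      (k := 0) (n := n) le_rfl (by exact_mod_cast le_top) x
    rw [norm_iteratedFDeriv_zero] at h
    refine h.trans ?_
    have h2 : ∑ p ∈ Finset.range (0 + 1) ×ˢ Finset.range (n + 1),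
        ∫ v, ‖v‖ ^ p.1 * ‖iteratedFDeriv ℝ p.2 G v‖ ≤ (k + 1) * (A * V) := by
      rw [Finset.sum_product]
      simp only [zero_add, Finset.range_one, Finset.sum_singleton]
      calc _ ≤ ∑ _q ∈ Finset.range (n + 1), A * V :=
            Finset.sum_le_sum fun q hq => hint q (by
              have := Finset.mem_range_succ_iff.1 hq
              omega)
        _ = (n + 1) * (A * V) := by simp
        _ ≤ _ := by gcongr
    have h3 : (2 * ((0 : ℕ) : ℝ) + 2) ^ n ≤ 2 ^ k := by
      rw [Nat.cast_zero, mul_zero, zero_add]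
      exact pow_le_pow_right₀ (by norm_num) hn
    rw [pow_zero, one_mul]
    have h4 : 0 ≤ ∑ p ∈ Finset.range (0 + 1) ×ˢ Finset.range (n + 1),
        ∫ v, ‖v‖ ^ p.1 * ‖iteratedFDeriv ℝ p.2 G v‖ :=
      Finset.sum_nonneg fun p _ => integral_nonneg fun v => by positivity
    gcongr
  rw [← div_eq_mul_inv, le_div_iff₀ (by positivity)]
  have h5 : (1 + ‖x‖) ^ k ≤ 2 ^ k * (1 + ‖x‖ ^ k) := by
    have := add_pow_le (zero_le_one) (norm_nonneg x) k
    rw [one_pow] at this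
    refine this.trans ?_
    gcongr
    · norm_num
    · omega
  calc ‖𝓕 G x‖ * (1 + ‖x‖) ^ k ≤ ‖𝓕 G x‖ * (2 ^ k * (1 + ‖x‖ ^ k)) := by gcongr
    _ = 2 ^ k * (‖x‖ ^ 0 * ‖𝓕 G x‖ + ‖x‖ ^ k * ‖𝓕 G x‖) := by ring
    _ ≤ 2 ^ k * (2 ^ k * ((k + 1) * (A * V)) + 2 ^ k * ((k + 1) * (A * V))) :=
        mul_le_mul_of_nonneg_left (add_le_add (hb 0 (Nat.zero_le k)) (hb k le_rfl))
          (by positivity)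
    _ = 2 ^ k * (2 * 2 ^ k) * (k + 1) * V * A := by ring
    _ ≤ 2 ^ k * (2 * 2 ^ k) * (k + 1) * (V + 1) * A := by
        gcongr
        linarith

/-! ### Kernels of dilated symbols -/

theorem fourier_comp_smul {d : ℕ} (G : E d → ℂ) {c : ℝ} (hc : 0 < c) (x : E d) :
    𝓕 (fun y => G (c⁻¹ • y)) x = (c : ℂ) ^ d * 𝓕 G (c • x) := by
  rw [Real.fourier_eq, Real.fourier_eq]
  have h := Measure.integral_comp_smul (volume : Measure (E d))
    (fun v => Real.fourierChar (-inner ℝ v (c • x)) • G v) c⁻¹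
  have h1 : ∀ v : E d, inner ℝ (c⁻¹ • v) (c • x) = inner ℝ v x := by
    intro v
    rw [real_inner_smul_left, real_inner_smul_right, ← mul_assoc, inv_mul_cancel₀ hc.ne', one_mul]
  simp_rw [h1] at h
  rw [h, finrank_euclideanSpace_fin, inv_pow, inv_inv, abs_of_pos (by positivity)]
  rw [Complex.real_smul, Complex.ofReal_pow]

/-- A smooth function supported in an annulus. -/
structure IsAnnular {d : ℕ} (a : E d → ℂ) : Prop where
  contDiff : ContDiff ℝ (⊤ : ℕ∞) a
  exists_radii : ∃ r₁ r₂ : ℝ, 0 < r₁ ∧ tsupport a ⊆ {η | r₁ ≤ ‖η‖ ∧ ‖η‖ ≤ r₂}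

namespace IsAnnular

variable {d : ℕ} {a : E d → ℂ}

theorem hasCompactSupport (ha : IsAnnular a) : HasCompactSupport a := by
  obtain ⟨r₁, r₂, -, h⟩ := ha.exists_radii
  refine HasCompactSupport.of_support_subset_isCompact (isCompact_closedBall 0 r₂)
    fun x hx => ?_
  simpa using (h (subset_tsupport a hx)).2

end IsAnnular

/-- The dilate `η ↦ a(2^{-l} η)` of a symbol. -/
def dilate {d : ℕ} (a : E d → ℂ) (l : ℤ) (η : E d) : ℂ := a ((2 : ℝ) ^ (-l) • η)

theorem IsAnnular.dilate {d : ℕ} {a : E d → ℂ} (ha : IsAnnular a) (l : ℤ) :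
    IsAnnular (dilate a l) := by
  refine ⟨ha.contDiff.comp (contDiff_const_smul _), ?_⟩
  obtain ⟨r₁, r₂, h1, h⟩ := ha.exists_radii
  refine ⟨2 ^ l * r₁, 2 ^ l * r₂, by positivity, fun x hx => ?_⟩
  have h2 : (2 : ℝ) ^ (-l) • x ∈ tsupport a := by
    by_contra hx'
    have h3 : a =ᶠ[𝓝 ((2 : ℝ) ^ (-l) • x)] 0 := notMem_tsupport_iff_eventuallyEq.1 hx'
    refine (notMem_tsupport_iff_eventuallyEq.2 ?_) hx
    have : Tendsto (fun y : E d => (2 : ℝ) ^ (-l) • y) (𝓝 x) (𝓝 ((2 : ℝ) ^ (-l) • x)) :=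
      tendsto_const_nhds.smul tendsto_id
    exact this.eventually h3
  have h3 := h h2
  have h4 : (0 : ℝ) < 2 ^ l := by positivity
  simp only [Set.mem_ofPred_eq, norm_smul, zpow_neg, norm_inv, norm_zpow, Real.norm_ofNat] at h3 ⊢
  rw [inv_mul_eq_div, le_div_iff₀ h4, div_le_iff₀ h4] at h3
  constructor <;> linarith

theorem zpow_le_add_of_mem_Icc {r₁ r₂ t : ℝ} (h0 : 0 < r₁) (h1 : r₁ ≤ t) (h2 : t ≤ r₂) (e : ℤ) :
    t ^ e ≤ r₁ ^ e + r₂ ^ e := by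
  have ht : 0 < t := h0.trans_le h1
  have hr : 0 < r₂ := ht.trans_le h2
  rcases le_total 0 e with he | he
  · have := zpow_le_zpow_left₀ he ht.le h2
    have := zpow_pos h0 e
    linarith
  · have h3 : t ^ e ≤ r₁ ^ e := by
      have h4 := zpow_le_zpow_left₀ (neg_nonneg.2 he) h0.le h1
      rw [zpow_neg, zpow_neg] at h4
      exact (inv_le_inv₀ (zpow_pos h0 e) (zpow_pos ht e)).1 h4
    have := zpow_pos hr e
    linarith

/-- The kernel of the symbol `a(2^{-l} ·) h`, if `h` is of the order of `|η|^M` together with its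
derivatives. -/
theorem IsAnnular.exists_norm_fourier_le {d : ℕ} {a : E d → ℂ} (ha : IsAnnular a) (k : ℕ)
    (M : ℤ) : ∃ C : ℝ, 0 < C ∧ ∀ (h : E d → ℂ) (A : ℝ), ContDiff ℝ (⊤ : ℕ∞) h → 0 ≤ A →
      (∀ j ≤ k, ∀ η, η ≠ 0 → ‖iteratedFDeriv ℝ j h η‖ ≤ A * ‖η‖ ^ (M - j)) →
      ∀ (l : ℤ) (x : E d), ‖𝓕 (fun η => BesovMixedMorrey.dilate a l η * h η) x‖ ≤
        C * (A * 2 ^ (l * M)) * ((2 ^ l) ^ d * ((1 + 2 ^ l * ‖x‖) ^ k)⁻¹) := by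
  obtain ⟨r₁, r₂, hr1, hr⟩ := ha.exists_radii
  obtain ⟨A₀, hA₀, hA₀'⟩ :=
    HasCompactSupport.exists_norm_iteratedFDeriv_le ha.contDiff ha.hasCompactSupport k
  obtain ⟨C, hC, hC'⟩ := norm_fourier_le_of_support (d := d) r₂ k
  set B : ℝ := ∑ j ∈ Finset.range (k + 1), (r₁ ^ (M - j) + |r₂ ^ (M - j)|) with hB
  have hB0 : 0 ≤ B := Finset.sum_nonneg fun j _ => by positivity
  refine ⟨C * (2 ^ k * A₀ * B + 1), by positivity, fun h A hh hA hbound l x => ?_⟩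
  set c : ℝ := 2 ^ l with hc
  have hc0 : 0 < c := by positivity
  set G : E d → ℂ := fun η => a η * h (c • η) with hG
  have hhc : ContDiff ℝ (⊤ : ℕ∞) fun η => h (c • η) := hh.comp (contDiff_const_smul c)
  have hGd : ContDiff ℝ (⊤ : ℕ∞) G := ha.contDiff.mul hhc
  have hGs : tsupport G ⊆ tsupport a := tsupport_mul_subset_left
  have hder : ∀ n ≤ k, ∀ η, ‖iteratedFDeriv ℝ n G η‖ ≤ 2 ^ k * A₀ * B * (A * 2 ^ (l * M)) := by
    intro n hn η
    by_cases hη : η ∈ tsupport a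
    · have hη' := hr hη
      have hη0 : η ≠ 0 := by
        rintro rfl
        have := hη'.1
        rw [norm_zero] at this
        linarith
      have hd : ∀ j ≤ k, ‖iteratedFDeriv ℝ j (fun η => h (c • η)) η‖ ≤ B * (A * 2 ^ (l * M)) := by
        intro j hj
        rw [iteratedFDeriv_comp_const_smul c (hh.of_le (by exact_mod_cast le_top)), norm_smul,
          Real.norm_of_nonneg (by positivity)]
        have h1 := hbound j hj (c • η) (smul_ne_zero hc0.ne' hη0)
        rw [norm_smul, Real.norm_of_nonneg hc0.le, mul_zpow] at h1
        have h2 : ‖η‖ ^ (M - j) ≤ B := by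
          refine (zpow_le_add_of_mem_Icc hr1 hη'.1 hη'.2 _).trans ?_
          refine (add_le_add le_rfl (le_abs_self _)).trans ?_
          exact Finset.single_le_sum
            (f := fun j : ℕ => r₁ ^ (M - j) + |r₂ ^ (M - j)|)
            (fun j _ => by positivity) (Finset.mem_range_succ_iff.2 hj)
        calc c ^ j * ‖iteratedFDeriv ℝ j h (c • η)‖
            ≤ c ^ j * (A * (c ^ (M - j) * ‖η‖ ^ (M - j))) := by gcongr
          _ = (c ^ j * c ^ (M - j)) * A * ‖η‖ ^ (M - j) := by ring
          _ = c ^ M * A * ‖η‖ ^ (M - j) := by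
              rw [← zpow_natCast, ← zpow_add₀ hc0.ne', add_sub_cancel]
          _ ≤ c ^ M * A * B := by gcongr
          _ = _ := by
              rw [hc, ← zpow_mul]
              ring
      calc ‖iteratedFDeriv ℝ n G η‖
          ≤ ∑ i ∈ Finset.range (n + 1), (n.choose i : ℝ) * ‖iteratedFDeriv ℝ i a η‖ *
              ‖iteratedFDeriv ℝ (n - i) (fun η => h (c • η)) η‖ :=
            norm_iteratedFDeriv_mul_le ha.contDiff hhc η (by exact_mod_cast le_top)
        _ ≤ ∑ i ∈ Finset.range (n + 1), (n.choose i : ℝ) * A₀ * (B * (A * 2 ^ (l * M))) := by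
            refine Finset.sum_le_sum fun i hi => ?_
            have hi' : i ≤ n := Finset.mem_range_succ_iff.1 hi
            have := hA₀' i (by omega) η
            have := hd (n - i) (by omega)
            gcongr
        _ = 2 ^ n * A₀ * B * (A * 2 ^ (l * M)) := by
            rw [← Finset.sum_mul, ← Finset.sum_mul, ← Nat.cast_sum, Nat.sum_range_choose]
            push_cast
            ring
        _ ≤ _ := by
            gcongr
            norm_num
    · have h1 : iteratedFDeriv ℝ n G η = 0 := by
        by_contra h2
        exact hη (hGs (support_iteratedFDeriv_subset n h2))
      rw [h1, norm_zero]
      positivity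
  have hGsupp : tsupport G ⊆ Metric.closedBall 0 r₂ := fun η hη => by
    simpa using (hr (hGs hη)).2
  have key := hC' G _ hGd hGsupp hder (c • x)
  have hsc : (fun η => BesovMixedMorrey.dilate a l η * h η) = fun η => G (c⁻¹ • η) := by
    funext η
    simp only [BesovMixedMorrey.dilate, hG, smul_smul, mul_inv_cancel₀ hc0.ne', one_smul, zpow_neg,
      ← hc]
  rw [hsc, fourier_comp_smul G hc0, norm_mul, norm_pow, Complex.norm_real,
    Real.norm_of_nonneg hc0.le]
  rw [norm_smul, Real.norm_of_nonneg hc0.le] at key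
  calc c ^ d * ‖𝓕 G (c • x)‖
      ≤ c ^ d * (C * (2 ^ k * A₀ * B * (A * 2 ^ (l * M))) * ((1 + c * ‖x‖) ^ k)⁻¹) := by gcongr
    _ = C * (2 ^ k * A₀ * B) * (A * 2 ^ (l * M)) * (c ^ d * ((1 + c * ‖x‖) ^ k)⁻¹) := by ring
    _ ≤ _ := by
        gcongr
        linarith

/-- A function with integral `O(R^κ)` over the balls of radius `R` around a point, integrated
against a kernel of scale `1/ρ` around this point that decays fast. -/
theorem exists_lintegral_mul_decay_le {d : ℕ} {κ : ℝ} {k : ℕ} (hk : κ < k) :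
    ∃ C : ℝ≥0, ∀ (F : E d → ℝ≥0∞) (A : ℝ≥0∞) (x : E d), AEMeasurable F →
      (∀ R > 0, ∫⁻ y in Metric.ball x R, F y ≤ A * ENNReal.ofReal (R ^ κ)) → ∀ ρ : ℝ, 0 < ρ →
      ∫⁻ y, F y * ENNReal.ofReal ((1 + ρ * ‖y - x‖) ^ k)⁻¹ ≤
        C * A * ENNReal.ofReal (ρ ^ (-κ)) := by
  set θ : ℝ := 2 ^ (κ - k) with hθ
  have hθ0 : 0 < θ := by positivity
  have hθ1 : θ < 1 := Real.rpow_lt_one_of_one_lt_of_neg (by norm_num) (by linarith)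
  have hsum : Summable fun j : ℕ => (2 : ℝ) ^ k * θ ^ j :=
    (summable_geometric_of_lt_one hθ0.le hθ1).mul_left _
  refine ⟨(∑' j : ℕ, (2 : ℝ) ^ k * θ ^ j).toNNReal, fun F A x hF hA ρ hρ => ?_⟩
  set w : ℕ → ℝ := fun j => 2 ^ k * ((2 : ℝ) ^ j)⁻¹ ^ k with hw
  have hpt : ∀ y, F y * ENNReal.ofReal ((1 + ρ * ‖y - x‖) ^ k)⁻¹ ≤
      ∑' j : ℕ, ENNReal.ofReal (w j) * (Metric.ball x (2 ^ j / ρ)).indicator F y := by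
    intro y
    set z := ρ * ‖y - x‖ with hz
    have hz0 : 0 ≤ z := by positivity
    obtain ⟨j, hj1, hj2⟩ : ∃ j : ℕ, z < 2 ^ j ∧ (1 + z)⁻¹ ≤ 2 * ((2 : ℝ) ^ j)⁻¹ := by
      rcases lt_or_ge z 1 with h | h
      · refine ⟨0, by simpa using h, ?_⟩
        rw [pow_zero, inv_one, mul_one]
        exact (inv_le_one_of_one_le₀ (by linarith)).trans (by norm_num)
      · obtain ⟨n, hn1, hn2⟩ := exists_nat_pow_near h (by norm_num : (1 : ℝ) < 2)
        refine ⟨n + 1, hn2, ?_⟩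
        rw [pow_succ, mul_inv, mul_comm _ (2 : ℝ)⁻¹, ← mul_assoc, mul_inv_cancel₀ two_ne_zero,
          one_mul]
        exact inv_anti₀ (by positivity) (by linarith)
    have hy : y ∈ Metric.ball x (2 ^ j / ρ) := by
      rw [mem_ball_iff_norm, lt_div_iff₀ hρ]
      linarith
    refine le_trans ?_ (ENNReal.le_tsum j)
    rw [Set.indicator_of_mem hy, mul_comm]
    gcongr
    rw [hw, ← inv_pow]
    dsimp only
    rw [← mul_pow]
    exact pow_le_pow_left₀ (by positivity) hj2 k
  calc ∫⁻ y, F y * ENNReal.ofReal ((1 + ρ * ‖y - x‖) ^ k)⁻¹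
      ≤ ∫⁻ y, ∑' j : ℕ, ENNReal.ofReal (w j) * (Metric.ball x (2 ^ j / ρ)).indicator F y :=
        lintegral_mono hpt
    _ = ∑' j : ℕ, ENNReal.ofReal (w j) * ∫⁻ y in Metric.ball x (2 ^ j / ρ), F y := by
        rw [lintegral_tsum fun j => (hF.indicator measurableSet_ball).const_mul _]
        refine tsum_congr fun j => ?_
        rw [lintegral_const_mul' _ _ ENNReal.ofReal_ne_top,
          lintegral_indicator measurableSet_ball]
    _ ≤ ∑' j : ℕ, ENNReal.ofReal (w j) * (A * ENNReal.ofReal ((2 ^ j / ρ) ^ κ)) := by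
        gcongr with j
        exact hA _ (by positivity)
    _ = ∑' j : ℕ, A * ENNReal.ofReal (ρ ^ (-κ)) * ENNReal.ofReal (2 ^ k * θ ^ j) := by
        refine tsum_congr fun j => ?_
        rw [mul_left_comm, mul_assoc, ← ENNReal.ofReal_mul (by positivity),
          ← ENNReal.ofReal_mul (by positivity)]
        congr 2
        have h2 : (0 : ℝ) < 2 ^ j := by positivity
        rw [hw, hθ, Real.div_rpow h2.le hρ.le, Real.rpow_neg hρ.le,
          Real.rpow_pow_comm zero_le_two (κ - k) j, Real.rpow_sub_natCast h2.ne']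
        dsimp only
        rw [inv_pow]
        field_simp
    _ = _ := by
        rw [ENNReal.tsum_mul_left, ← ENNReal.ofReal_tsum_of_nonneg (fun j => by positivity) hsum]
        change _ * ((Real.toNNReal _ : ℝ≥0) : ℝ≥0∞) = _
        ring

theorem exists_lintegral_decay_le (d : ℕ) :
    ∃ C : ℝ≥0, ∀ ρ : ℝ, 0 < ρ →
      ∫⁻ y : E d, ENNReal.ofReal (ρ ^ d * ((1 + ρ * ‖y‖) ^ (d + 1))⁻¹) ≤ C := by
  obtain ⟨C, hC⟩ := exists_lintegral_mul_decay_le (d := d) (κ := d) (k := d + 1) (by simp)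
  have hV : (volume : Measure (E d)) (Metric.ball 0 1) ≠ ∞ := measure_ball_lt_top.ne
  refine ⟨C * ((volume : Measure (E d)) (Metric.ball 0 1)).toNNReal, fun ρ hρ => ?_⟩
  have h := hC (fun _ => 1) (volume (Metric.ball (0 : E d) 1)) 0 aemeasurable_const
    (fun R hR => by
      rw [lintegral_one, Measure.restrict_apply_univ, Measure.addHaar_ball_of_pos _ _ hR,
        finrank_euclideanSpace_fin, mul_comm, Real.rpow_natCast]) ρ hρ
  simp only [one_mul, sub_zero] at h
  calc ∫⁻ y : E d, ENNReal.ofReal (ρ ^ d * ((1 + ρ * ‖y‖) ^ (d + 1))⁻¹)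
      = ENNReal.ofReal (ρ ^ d) * ∫⁻ y : E d, ENNReal.ofReal ((1 + ρ * ‖y‖) ^ (d + 1))⁻¹ := by
        rw [← lintegral_const_mul' _ _ ENNReal.ofReal_ne_top]
        refine lintegral_congr fun y => ?_
        rw [ENNReal.ofReal_mul (by positivity)]
    _ ≤ ENNReal.ofReal (ρ ^ d) * (C * volume (Metric.ball (0 : E d) 1) *
          ENNReal.ofReal (ρ ^ (-(d : ℝ)))) := by gcongr
    _ = C * volume (Metric.ball (0 : E d) 1) *
          ENNReal.ofReal (ρ ^ d * ρ ^ (-(d : ℝ))) := by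
        rw [ENNReal.ofReal_mul (by positivity)]
        ring
    _ = _ := by
        rw [Real.rpow_neg hρ.le, Real.rpow_natCast, mul_inv_cancel₀ (by positivity),
          ENNReal.ofReal_one, mul_one, ENNReal.coe_mul, ENNReal.coe_toNNReal hV]

theorem IsAnnular.exists_lintegral_fourier_le {d : ℕ} {a : E d → ℂ} (ha : IsAnnular a)
    (M : ℤ) : ∃ C : ℝ≥0, ∀ (h : E d → ℂ) (A : ℝ), ContDiff ℝ (⊤ : ℕ∞) h → 0 ≤ A →
      (∀ j ≤ d + 1, ∀ η, η ≠ 0 → ‖iteratedFDeriv ℝ j h η‖ ≤ A * ‖η‖ ^ (M - j)) →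
      ∀ l : ℤ, ∫⁻ x, ‖𝓕 (fun η => BesovMixedMorrey.dilate a l η * h η) x‖ₑ ≤
        C * ENNReal.ofReal (A * 2 ^ (l * M)) := by
  obtain ⟨C, hC, hC'⟩ := ha.exists_norm_fourier_le (d + 1) M
  obtain ⟨C₂, hC₂⟩ := exists_lintegral_decay_le d
  refine ⟨C.toNNReal * C₂, fun h A hh hA hb l => ?_⟩
  calc ∫⁻ x, ‖𝓕 (fun η => BesovMixedMorrey.dilate a l η * h η) x‖ₑ
      ≤ ∫⁻ x : E d, ENNReal.ofReal (C * (A * 2 ^ (l * M))) *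
          ENNReal.ofReal ((2 ^ l) ^ d * ((1 + 2 ^ l * ‖x‖) ^ (d + 1))⁻¹) := by
        refine lintegral_mono fun x => ?_
        rw [← ENNReal.ofReal_mul (by positivity), ← ofReal_norm]
        exact ENNReal.ofReal_le_ofReal (hC' h A hh hA hb l x)
    _ ≤ ENNReal.ofReal (C * (A * 2 ^ (l * M))) * C₂ := by
        rw [lintegral_const_mul' _ _ ENNReal.ofReal_ne_top]
        gcongr
        exact hC₂ _ (by positivity)
    _ = _ := by
        rw [ENNReal.ofReal_mul hC.le, ENNReal.coe_mul, ENNReal.ofReal]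
        ring

theorem norm_iteratedFDeriv_one_le {d : ℕ} (j : ℕ) {η : E d} (hη : η ≠ 0) :
    ‖iteratedFDeriv ℝ j (fun _ : E d => (1 : ℂ)) η‖ ≤ 1 * ‖η‖ ^ ((0 : ℤ) - j) := by
  rcases Nat.eq_zero_or_pos j with rfl | hj
  · simp
  · rw [iteratedFDeriv_const_of_ne (by omega)]
    simp only [Pi.zero_apply, norm_zero, one_mul]
    positivity

theorem IsAnnular.exists_norm_fourier_dilate_le {d : ℕ} {a : E d → ℂ} (ha : IsAnnular a)
    (k : ℕ) : ∃ C : ℝ, 0 < C ∧ ∀ (l : ℤ) (x : E d),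
      ‖𝓕 (BesovMixedMorrey.dilate a l) x‖ ≤ C * ((2 ^ l) ^ d * ((1 + 2 ^ l * ‖x‖) ^ k)⁻¹) := by
  obtain ⟨C, hC, hC'⟩ := ha.exists_norm_fourier_le k 0
  refine ⟨C, hC, fun l x => ?_⟩
  simpa using hC' (fun _ => 1) 1 contDiff_const zero_le_one
    (fun j _ η hη => norm_iteratedFDeriv_one_le j hη) l x

theorem IsAnnular.exists_lintegral_fourier_dilate_le {d : ℕ} {a : E d → ℂ} (ha : IsAnnular a) :
    ∃ C : ℝ≥0, ∀ l : ℤ, ∫⁻ x, ‖𝓕 (BesovMixedMorrey.dilate a l) x‖ₑ ≤ C := by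
  obtain ⟨C, hC⟩ := ha.exists_lintegral_fourier_le 0
  refine ⟨C, fun l => ?_⟩
  simpa using hC (fun _ => 1) 1 contDiff_const zero_le_one
    (fun j _ η hη => norm_iteratedFDeriv_one_le j hη) l

/-! ### Fourier multipliers and representation by functions -/

/-- The operator `φ ↦ 𝓕 (m · 𝓕⁻¹ φ)` on `𝒮`, the transpose of the Fourier multiplier `m` on
`𝒮'`. -/
def transposeMul {d : ℕ} (m : E d → ℂ) : 𝓢(E d, ℂ) →L[ℂ] 𝓢(E d, ℂ) :=
  FourierTransform.fourierCLM ℂ 𝓢(E d, ℂ) ∘L SchwartzMap.smulLeftCLM ℂ m ∘L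
    FourierTransform.fourierInvCLM ℂ 𝓢(E d, ℂ)

theorem fourierMultiplierCLM_apply_eq {d : ℕ} (m : E d → ℂ) (T : 𝓢'(E d, ℂ)) (φ : 𝓢(E d, ℂ)) :
    TemperedDistribution.fourierMultiplierCLM ℂ m T φ = T (transposeMul m φ) := rfl

theorem transposeMul_def {d : ℕ} (m : E d → ℂ) (φ : 𝓢(E d, ℂ)) :
    transposeMul m φ = 𝓕 (SchwartzMap.smulLeftCLM ℂ m (𝓕⁻ φ)) := rfl

theorem transposeMul_coe {d : ℕ} {m : E d → ℂ} (hm : m.HasTemperateGrowth) (φ : 𝓢(E d, ℂ)) :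
    (transposeMul m φ : E d → ℂ) = 𝓕 (fun η => m η * 𝓕⁻ φ η) := by
  rw [transposeMul_def, SchwartzMap.fourier_coe]
  congr 1
  funext η
  rw [SchwartzMap.smulLeftCLM_apply_apply hm, smul_eq_mul]

theorem transposeMul_transposeMul {d : ℕ} {m₁ m₂ : E d → ℂ} (h₁ : m₁.HasTemperateGrowth)
    (h₂ : m₂.HasTemperateGrowth) (φ : 𝓢(E d, ℂ)) :
    transposeMul m₁ (transposeMul m₂ φ) = transposeMul (m₁ * m₂) φ := by
  rw [transposeMul_def, transposeMul_def, transposeMul_def, FourierTransform.fourierInv_fourier_eq,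
    SchwartzMap.smulLeftCLM_smulLeftCLM_apply h₁ h₂]

theorem transposeMul_add {d : ℕ} {m₁ m₂ : E d → ℂ} (h₁ : m₁.HasTemperateGrowth)
    (h₂ : m₂.HasTemperateGrowth) (φ : 𝓢(E d, ℂ)) :
    transposeMul (m₁ + m₂) φ = transposeMul m₁ φ + transposeMul m₂ φ := by
  rw [transposeMul_def, transposeMul_def, transposeMul_def, SchwartzMap.smulLeftCLM_add h₁ h₂,
    add_apply, FourierTransform.fourier_add]

theorem transposeMul_zero {d : ℕ} (φ : 𝓢(E d, ℂ)) : transposeMul (0 : E d → ℂ) φ = 0 := by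
  have h := transposeMul_add (Function.HasTemperateGrowth.const (0 : ℂ))
    (Function.HasTemperateGrowth.const (0 : ℂ)) φ
  have h0 : ((fun _ : E d => (0 : ℂ)) + fun _ => 0) = 0 := by
    funext x
    simp
  rw [h0] at h
  exact left_eq_add.1 h

/-- The Schwartz function given by the Fourier transform of a smooth function with compact
support. -/
def kernel {d : ℕ} {m : E d → ℂ} (hm : ContDiff ℝ (⊤ : ℕ∞) m) (hc : HasCompactSupport m) :
    𝓢(E d, ℂ) := 𝓕 (hc.toSchwartzMap hm)

theorem kernel_coe {d : ℕ} {m : E d → ℂ} (hm : ContDiff ℝ (⊤ : ℕ∞) m)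
    (hc : HasCompactSupport m) : (kernel hm hc : E d → ℂ) = 𝓕 m :=
  SchwartzMap.fourier_coe _

theorem transposeMul_apply {d : ℕ} {m : E d → ℂ} (hm : ContDiff ℝ (⊤ : ℕ∞) m)
    (hc : HasCompactSupport m) (φ : 𝓢(E d, ℂ)) (x : E d) :
    transposeMul m φ x = ∫ y, kernel hm hc (x - y) * φ y := by
  have hmt : m.HasTemperateGrowth := hc.hasTemperateGrowth hm
  set K := kernel hm hc with hK
  set B : ℂ →L[ℂ] ℂ →L[ℂ] ℂ := ContinuousLinearMap.mul ℂ ℂ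
  have h1 : 𝓕⁻ (SchwartzMap.convolution B φ K) = SchwartzMap.smulLeftCLM ℂ m (𝓕⁻ φ) := by
    ext η
    rw [SchwartzMap.fourierInv_apply_eq, SchwartzMap.fourier_convolution,
      SchwartzMap.smulLeftCLM_apply_apply hmt]
    have hinv : ∀ ψ : 𝓢(E d, ℂ), 𝓕 ψ (-η) = 𝓕⁻ ψ η := by
      intro ψ
      rw [SchwartzMap.fourierInv_apply_eq]
      rfl
    change B (𝓕 φ (-η)) (𝓕 K (-η)) = _
    rw [hinv, hinv, hK, kernel, FourierTransform.fourierInv_fourier_eq]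
    change 𝓕⁻ φ η * m η = m η • 𝓕⁻ φ η
    rw [mul_comm, smul_eq_mul]
  rw [transposeMul_def, ← h1, FourierTransform.fourier_fourierInv_eq, SchwartzMap.convolution_apply]
  refine integral_congr_ae (Eventually.of_forall fun y => ?_)
  change φ y * K (x - y) = _
  rw [mul_comm]

/-- The function `f` has integral at most `A R^κ` over each ball of radius `R`. -/
def HasGrowth {d : ℕ} (κ : ℝ) (A : ℝ≥0∞) (f : E d → ℂ) : Prop :=
  AEStronglyMeasurable f ∧
    ∀ (x : E d) (R : ℝ), 0 < R → ∫⁻ y in Metric.ball x R, ‖f y‖ₑ ≤ A * ENNReal.ofReal (R ^ κ)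

theorem SchwartzMap.exists_norm_le_decay {d : ℕ} (g : 𝓢(E d, ℂ)) (k : ℕ) :
    ∃ C : ℝ, 0 ≤ C ∧ ∀ x, ‖g x‖ ≤ C * ((1 + ‖x‖) ^ k)⁻¹ := by
  refine ⟨2 ^ k * ((Finset.Iic (k, 0)).sup fun n => SchwartzMap.seminorm ℝ n.1 n.2) g,
    by positivity, fun x => ?_⟩
  have h := SchwartzMap.one_add_le_sup_seminorm_apply (𝕜 := ℝ) (m := (k, 0)) (k := k) (n := 0)
    le_rfl le_rfl g x
  rw [norm_iteratedFDeriv_zero] at h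
  rw [← div_eq_mul_inv, le_div_iff₀ (by positivity), mul_comm]
  exact h

/-- The integral of a function of growth against translates of a Schwartz function is bounded. -/
theorem HasGrowth.exists_lintegral_mul_le {d : ℕ} {κ : ℝ} {A : ℝ≥0∞} {f : E d → ℂ}
    (h : HasGrowth κ A f) (hA : A ≠ ∞) (g : 𝓢(E d, ℂ)) :
    ∃ C : ℝ≥0, ∀ y, ∫⁻ x, ‖f x * g (x - y)‖ₑ ≤ C := by
  obtain ⟨k, hk⟩ := exists_nat_gt κ
  obtain ⟨C, hC⟩ := exists_lintegral_mul_decay_le (d := d) hk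
  obtain ⟨D, hD0, hD⟩ := SchwartzMap.exists_norm_le_decay g k
  refine ⟨D.toNNReal * (C * A.toNNReal), fun y => ?_⟩
  have h1 := hC (fun x => ‖f x‖ₑ) A y h.1.enorm (h.2 y) 1 one_pos
  simp only [one_mul, Real.one_rpow, ENNReal.ofReal_one, mul_one] at h1
  calc ∫⁻ x, ‖f x * g (x - y)‖ₑ
      ≤ ∫⁻ x, ENNReal.ofReal D * (‖f x‖ₑ * ENNReal.ofReal ((1 + ‖x - y‖) ^ k)⁻¹) := by
        refine lintegral_mono fun x => ?_
        dsimp only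
        rw [enorm_mul, mul_left_comm, ← ENNReal.ofReal_mul hD0, ← ofReal_norm (g (x - y))]
        gcongr
        exact hD _
    _ ≤ ENNReal.ofReal D * (C * A) := by
        rw [lintegral_const_mul' _ _ ENNReal.ofReal_ne_top]
        gcongr
    _ = _ := by
        rw [ENNReal.coe_mul, ENNReal.coe_mul, ENNReal.coe_toNNReal hA]
        rfl

theorem HasGrowth.integrable_mul {d : ℕ} {κ : ℝ} {A : ℝ≥0∞} {f : E d → ℂ}
    (h : HasGrowth κ A f) (hA : A ≠ ∞) (g : 𝓢(E d, ℂ)) : Integrable fun x => f x * g x := by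
  obtain ⟨C, hC⟩ := h.exists_lintegral_mul_le hA g
  refine ⟨h.1.mul g.continuous.aestronglyMeasurable, ?_⟩
  have := hC 0
  simp only [sub_zero] at this
  exact this.trans_lt ENNReal.coe_lt_top

/-- A tempered distribution that is given by a function of growth on the test functions with
compact support is given by this function on all Schwartz functions. -/
theorem Represents.apply_eq {d : ℕ} {κ : ℝ} {A : ℝ≥0∞} {f : E d → ℂ} {T : 𝓢'(E d, ℂ)}
    (hT : Represents f T) (h : HasGrowth κ A f) (hA : A ≠ ∞) (g : 𝓢(E d, ℂ)) :
    T g = ∫ x, f x * g x := by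
  let b : ContDiffBump (0 : E d) := ⟨1, 2, one_pos, one_lt_two⟩
  set χ : E d → ℂ := fun x => (b x : ℂ) with hχ
  have hχd : ContDiff ℝ (⊤ : ℕ∞) χ := Complex.ofRealCLM.contDiff.comp b.contDiff
  have hχc : HasCompactSupport χ := b.hasCompactSupport.comp_left Complex.ofReal_zero
  have hχ1 : ∀ x : E d, ‖x‖ < 1 → χ x = 1 := fun x hx => by
    simp [hχ, b.one_of_mem_closedBall (by simpa using hx.le : x ∈ Metric.closedBall (0 : E d) 1)]
  have hχb : ∀ x, ‖χ x‖ ≤ 1 := fun x => by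
    simp only [hχ, Complex.norm_real, Real.norm_of_nonneg b.nonneg]
    exact b.le_one
  have hcK : ∀ K : ℕ, HasCompactSupport fun x => χ ((1 / 2 : ℝ) ^ K • x) := fun K =>
    hχc.comp_homeomorph (Homeomorph.smulOfNeZero ((1 / 2 : ℝ) ^ K) (by positivity))
  have hχK : ∀ K : ℕ, (fun x => χ ((1 / 2 : ℝ) ^ K • x)).HasTemperateGrowth := fun K =>
    HasCompactSupport.hasTemperateGrowth (hcK K)
      (hχd.comp (contDiff_const_smul _) : ContDiff ℝ _ fun x => χ ((1 / 2 : ℝ) ^ K • x))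
  have h1 := (T.continuous.tendsto g).comp (tendsto_cutoff hχd hχc one_pos hχ1 g)
  have h2 : ∀ K : ℕ, T (SchwartzMap.smulLeftCLM ℂ (fun x => χ ((1 / 2 : ℝ) ^ K • x)) g) =
      ∫ x, f x * (χ ((1 / 2 : ℝ) ^ K • x) * g x) := by
    intro K
    rw [hT.2]
    · refine integral_congr_ae (Eventually.of_forall fun x => ?_)
      dsimp only
      rw [SchwartzMap.smulLeftCLM_apply_apply (hχK K), smul_eq_mul]
    · rw [SchwartzMap.smulLeftCLM_apply (hχK K)]
      exact (hcK K).smul_right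
  have h3 : Tendsto (fun K : ℕ => ∫ x, f x * (χ ((1 / 2 : ℝ) ^ K • x) * g x)) atTop
      (𝓝 (∫ x, f x * g x)) := by
    refine tendsto_integral_of_dominated_convergence (fun x => ‖f x * g x‖) (fun K => ?_)
      (h.integrable_mul hA g).norm (fun K => ?_) ?_
    · exact h.1.mul ((hχd.continuous.comp (continuous_const_smul _)).mul
        g.continuous).aestronglyMeasurable
    · refine Eventually.of_forall fun x => ?_
      rw [norm_mul, norm_mul, norm_mul]
      gcongr
      exact mul_le_of_le_one_left (norm_nonneg _) (hχb _)
    · refine Eventually.of_forall fun x => ?_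
      have h4 : Tendsto (fun K : ℕ => (1 / 2 : ℝ) ^ K • x) atTop (𝓝 0) := by
        have := (tendsto_pow_atTop_nhds_zero_of_lt_one (by norm_num : (0 : ℝ) ≤ 1 / 2)
          (by norm_num)).smul_const x
        rwa [zero_smul] at this
      have h5 := (hχd.continuous.tendsto 0).comp h4
      rw [hχ1 0 (by simp)] at h5
      simpa using (h5.mul_const (g x)).const_mul (f x)
  have h6 : (fun K : ℕ => ∫ x, f x * (χ ((1 / 2 : ℝ) ^ K • x) * g x)) =
      T ∘ fun K : ℕ => SchwartzMap.smulLeftCLM ℂ (fun x => χ ((1 / 2 : ℝ) ^ K • x)) g :=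
    funext fun K => (h2 K).symm
  rw [h6] at h3
  exact tendsto_nhds_unique h1 h3

theorem Represents.ae_eq {d : ℕ} {f g : E d → ℂ} {T : 𝓢'(E d, ℂ)} (hf : Represents f T)
    (hg : Represents g T) : f =ᵐ[volume] g := by
  refine ae_eq_of_integral_contDiff_smul_eq hf.1 hg.1 fun u hu hc => ?_
  have hc' : HasCompactSupport fun x => (u x : ℂ) := hc.comp_left Complex.ofReal_zero
  have hu' : ContDiff ℝ (⊤ : ℕ∞) fun x => (u x : ℂ) := Complex.ofRealCLM.contDiff.comp hu
  have h1 := hf.2 (hc'.toSchwartzMap hu') hc'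
  rw [hg.2 (hc'.toSchwartzMap hu') hc'] at h1
  have h2 : ∀ w : E d → ℂ, ∫ x, u x • w x = ∫ x, w x * (hc'.toSchwartzMap hu') x := by
    intro w
    refine integral_congr_ae (Eventually.of_forall fun x => ?_)
    change u x • w x = w x * (u x : ℂ)
    rw [Complex.real_smul, mul_comm]
  rw [h2, h2, h1]

theorem distNorm_eq {d : ℕ} {X : (E d → ℂ) → ℝ≥0∞} (hX : ∀ f g, f =ᵐ[volume] g → X f = X g)
    {f : E d → ℂ} {T : 𝓢'(E d, ℂ)} (hf : Represents f T) : distNorm X T = X f :=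
  le_antisymm (iInf₂_le f hf) (le_iInf₂ fun _ hg => (hX _ _ (hf.ae_eq hg)).le)

theorem exists_represents_of_distNorm_lt_top {d : ℕ} {X : (E d → ℂ) → ℝ≥0∞} {T : 𝓢'(E d, ℂ)}
    (h : distNorm X T < ∞) : ∃ f, Represents f T ∧ X f < ∞ := by
  simpa only [distNorm, iInf_lt_iff, exists_prop] using h

/-- The function `y ↦ T(K(· - y))`. -/
def mollify {d : ℕ} (K : 𝓢(E d, ℂ)) (T : 𝓢'(E d, ℂ)) (y : E d) : ℂ :=
  T (SchwartzMap.compSubConstCLM ℂ y K)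

theorem Represents.mollify_eq {d : ℕ} {κ : ℝ} {A : ℝ≥0∞} {f : E d → ℂ} {T : 𝓢'(E d, ℂ)}
    (hT : Represents f T) (h : HasGrowth κ A f) (hA : A ≠ ∞) (K : 𝓢(E d, ℂ)) (y : E d) :
    mollify K T y = ∫ x, f x * K (x - y) := hT.apply_eq h hA _

theorem Represents.enorm_mollify_le {d : ℕ} {κ : ℝ} {A : ℝ≥0∞} {f : E d → ℂ} {T : 𝓢'(E d, ℂ)}
    (hT : Represents f T) (h : HasGrowth κ A f) (hA : A ≠ ∞) (K : 𝓢(E d, ℂ)) (y : E d) :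
    ‖mollify K T y‖ₑ ≤ ∫⁻ x, ‖f x‖ₑ * ‖K (x - y)‖ₑ := by
  rw [hT.mollify_eq h hA]
  refine (enorm_integral_le_lintegral_enorm _).trans_eq ?_
  simp_rw [enorm_mul]

theorem Represents.measurable_mollify {d : ℕ} {κ : ℝ} {A : ℝ≥0∞} {f : E d → ℂ} {T : 𝓢'(E d, ℂ)}
    (hT : Represents f T) (h : HasGrowth κ A f) (hA : A ≠ ∞) (K : 𝓢(E d, ℂ)) :
    Measurable (mollify K T) := by
  have h1 : mollify K T = fun y => ∫ x, h.1.mk f x * K (x - y) := by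
    funext y
    rw [hT.mollify_eq h hA]
    refine integral_congr_ae ?_
    filter_upwards [h.1.ae_eq_mk] with x hx
    rw [hx]
  rw [h1]
  have h2 : StronglyMeasurable fun p : E d × E d => h.1.mk f p.2 * K (p.2 - p.1) :=
    (h.1.stronglyMeasurable_mk.comp_measurable measurable_snd).mul
      (K.continuous.comp (continuous_snd.sub continuous_fst)).stronglyMeasurable
  exact h2.integral_prod_right'.measurable

/-- The Fourier multiplier `m` applied to a distribution that is given by a function of growth. -/
theorem Represents.apply_transposeMul {d : ℕ} {κ : ℝ} {A : ℝ≥0∞} {f : E d → ℂ} {T : 𝓢'(E d, ℂ)}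
    (hT : Represents f T) (h : HasGrowth κ A f) (hA : A ≠ ∞) {m : E d → ℂ}
    (hm : ContDiff ℝ (⊤ : ℕ∞) m) (hc : HasCompactSupport m) (φ : 𝓢(E d, ℂ)) :
    T (transposeMul m φ) = ∫ y, mollify (kernel hm hc) T y * φ y := by
  set K := kernel hm hc with hK
  obtain ⟨C, hC⟩ := h.exists_lintegral_mul_le hA K
  have hmeas : AEStronglyMeasurable (fun p : E d × E d => f p.1 * (K (p.1 - p.2) * φ p.2))
      (volume.prod volume) :=
    h.1.comp_fst.mul ((K.continuous.comp (continuous_fst.sub continuous_snd)).mul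
      (φ.continuous.comp continuous_snd)).aestronglyMeasurable
  have hint : Integrable (Function.uncurry fun x y => f x * (K (x - y) * φ y))
      (volume.prod volume) := by
    refine ⟨hmeas, ?_⟩
    rw [hasFiniteIntegral_iff_enorm]
    calc ∫⁻ p : E d × E d, ‖f p.1 * (K (p.1 - p.2) * φ p.2)‖ₑ ∂(volume.prod volume)
        = ∫⁻ y, ∫⁻ x, ‖f x * (K (x - y) * φ y)‖ₑ := lintegral_prod_symm _ hmeas.enorm
      _ = ∫⁻ y, (∫⁻ x, ‖f x * K (x - y)‖ₑ) * ‖φ y‖ₑ := by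
          refine lintegral_congr fun y => ?_
          rw [← lintegral_mul_const' _ _ enorm_ne_top]
          simp_rw [enorm_mul, mul_assoc]
      _ ≤ ∫⁻ y, C * ‖φ y‖ₑ := by
          gcongr with y
          exact hC y
      _ = C * ∫⁻ y, ‖φ y‖ₑ := lintegral_const_mul' _ _ ENNReal.coe_ne_top
      _ < ∞ := ENNReal.mul_lt_top ENNReal.coe_lt_top φ.integrable.2
  calc T (transposeMul m φ) = ∫ x, f x * ∫ y, K (x - y) * φ y := by
        rw [hT.apply_eq h hA]
        simp_rw [transposeMul_apply hm hc]
        rfl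
    _ = ∫ x, ∫ y, f x * (K (x - y) * φ y) := by simp_rw [integral_const_mul]
    _ = ∫ y, ∫ x, f x * (K (x - y) * φ y) := integral_integral_swap hint
    _ = ∫ y, mollify K T y * φ y := by
        refine integral_congr_ae (Eventually.of_forall fun y => ?_)
        dsimp only
        rw [hT.mollify_eq h hA, ← integral_mul_const]
        simp_rw [mul_assoc]

theorem locallyIntegrable_of_bounded {d : ℕ} {f : E d → ℂ} (hf : Measurable f) {A : ℝ≥0∞}
    (hA : A ≠ ∞) (hb : ∀ y, ‖f y‖ₑ ≤ A) : LocallyIntegrable f := by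
  have : MemLp f ∞ volume := ⟨hf.aestronglyMeasurable, by
    refine lt_of_le_of_lt ?_ hA.lt_top
    rw [eLpNorm_exponent_top]
    exact eLpNormEssSup_le_of_ae_enorm_bound (Eventually.of_forall hb)⟩
  exact this.locallyIntegrable le_top

theorem supNorm_le_of_bound {d : ℕ} {f : E d → ℂ} {A : ℝ≥0∞} (hb : ∀ y, ‖f y‖ₑ ≤ A) :
    supNorm f ≤ A := by
  rw [supNorm, eLpNorm_exponent_top]
  exact eLpNormEssSup_le_of_ae_enorm_bound (Eventually.of_forall hb)

/-- The Fourier multiplier `a(2^{-l} ·)` maps a distribution that is given by a function with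
integral at most `A R^κ` over the balls of radius `R` to a function that is bounded by a constant
times `2^{l(d - κ)} A`. -/
theorem IsAnnular.exists_bound_mollify {d : ℕ} {a : E d → ℂ} (ha : IsAnnular a) (κ : ℝ) :
    ∃ C : ℝ≥0, ∀ (l : ℤ) (T : 𝓢'(E d, ℂ)) (f : E d → ℂ) (A : ℝ≥0∞), Represents f T →
      HasGrowth κ A f → A ≠ ∞ → ∀ y,
      ‖mollify (kernel (ha.dilate l).contDiff (ha.dilate l).hasCompactSupport) T y‖ₑ ≤
        C * ENNReal.ofReal ((2 : ℝ) ^ ((l : ℝ) * (d - κ))) * A := by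
  obtain ⟨k, hk⟩ := exists_nat_gt κ
  obtain ⟨C, hC⟩ := exists_lintegral_mul_decay_le (d := d) hk
  obtain ⟨D, hD0, hD⟩ := ha.exists_norm_fourier_dilate_le k
  refine ⟨D.toNNReal * C, fun l T f A hT h hA y => ?_⟩
  have h1 := hC (fun x => ‖f x‖ₑ) A y h.1.enorm (h.2 y) (2 ^ l) (by positivity)
  calc _ ≤ ∫⁻ x, ‖f x‖ₑ * ‖kernel (ha.dilate l).contDiff (ha.dilate l).hasCompactSupport
          (x - y)‖ₑ := hT.enorm_mollify_le h hA _ y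
    _ ≤ ∫⁻ x, ENNReal.ofReal (D * (2 ^ l) ^ d) *
          (‖f x‖ₑ * ENNReal.ofReal ((1 + 2 ^ l * ‖x - y‖) ^ k)⁻¹) := by
        refine lintegral_mono fun x => ?_
        dsimp only
        rw [mul_left_comm, ← ENNReal.ofReal_mul (by positivity), kernel_coe,
          ← ofReal_norm (𝓕 (BesovMixedMorrey.dilate a l) (x - y))]
        gcongr
        rw [mul_assoc]
        exact hD l _
    _ ≤ ENNReal.ofReal (D * (2 ^ l) ^ d) *
          (C * A * ENNReal.ofReal (((2 : ℝ) ^ l) ^ (-κ))) := by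
        rw [lintegral_const_mul' _ _ ENNReal.ofReal_ne_top]
        gcongr
    _ = ENNReal.ofReal D * C * ENNReal.ofReal (((2 : ℝ) ^ l) ^ d * ((2 : ℝ) ^ l) ^ (-κ)) * A := by
        rw [ENNReal.ofReal_mul hD0.le, ENNReal.ofReal_mul (by positivity)]
        ring
    _ = _ := by
        rw [ENNReal.coe_mul, ← Real.rpow_natCast, ← Real.rpow_add (by positivity),
          ← Real.rpow_intCast, ← Real.rpow_mul (by norm_num), sub_eq_add_neg]
        rfl

/-! ### Littlewood–Paley blocks and the Bernstein inequality -/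

theorem IsAnnular.add {d : ℕ} {a b : E d → ℂ} (ha : IsAnnular a) (hb : IsAnnular b) :
    IsAnnular fun η => a η + b η := by
  obtain ⟨r₁, r₂, h0, h⟩ := ha.exists_radii
  obtain ⟨s₁, s₂, k0, k⟩ := hb.exists_radii
  refine ⟨ha.contDiff.add hb.contDiff, min r₁ s₁, max r₂ s₂, lt_min h0 k0, ?_⟩
  have h1 : tsupport (fun η => a η + b η) ⊆ tsupport a ∪ tsupport b := by
    rw [tsupport, tsupport, tsupport, ← closure_union]
    exact closure_mono (Function.support_add a b)
  intro η hη
  rcases h1 hη with h2 | h2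
  · exact ⟨(min_le_left _ _).trans (h h2).1, (h h2).2.trans (le_max_left _ _)⟩
  · exact ⟨(min_le_right _ _).trans (k h2).1, (k h2).2.trans (le_max_right _ _)⟩

theorem IsAnnular.hasTemperateGrowth {d : ℕ} {a : E d → ℂ} (ha : IsAnnular a) :
    a.HasTemperateGrowth := ha.hasCompactSupport.hasTemperateGrowth ha.contDiff

/-- The kernel of the Fourier multiplier `a(2^{-l} ·)`. -/
def IsAnnular.kernel {d : ℕ} {a : E d → ℂ} (ha : IsAnnular a) (l : ℤ) : 𝓢(E d, ℂ) :=
  BesovMixedMorrey.kernel (ha.dilate l).contDiff (ha.dilate l).hasCompactSupport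

theorem distNorm_le {d : ℕ} (X : (E d → ℂ) → ℝ≥0∞) {f : E d → ℂ} {T : 𝓢'(E d, ℂ)}
    (hf : Represents f T) : distNorm X T ≤ X f := iInf₂_le f hf

theorem morreyNorm_hasGrowth {d : ℕ} {q : Fin d → ℝ} (hq : ∀ i, 1 ≤ q i) (lam : Fin d → ℝ)
    {f : E d → ℂ} (hf : AEStronglyMeasurable f) :
    HasGrowth (d - ∑ i, (1 - lam i) / q i)
      (ENNReal.ofReal (2 ^ ∑ i, (1 - 1 / q i)) * morreyNorm q lam f) f := by
  refine ⟨hf, fun x R hR => (lintegral_ball_le_morreyNorm hq lam hf x hR).trans_eq ?_⟩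
  rw [Finset.sum_sub_distrib (f := fun _ => (1 : ℝ)) (g := fun i => (1 - lam i) / q i)]
  simp only [Finset.sum_const, Finset.card_univ, Fintype.card_fin, nsmul_eq_mul, mul_one]
  ring

namespace DyadicPartition

variable {d : ℕ} (Φ : DyadicPartition d)

theorem isAnnular_φ : IsAnnular fun η => (Φ.φ η : ℂ) := by
  refine ⟨Complex.ofRealCLM.contDiff.comp Φ.φ_smooth, 3 / 4, 8 / 3, by norm_num, ?_⟩
  exact (tsupport_comp_subset Complex.ofReal_zero Φ.φ).trans Φ.φ_supp

theorem isAnnular_symbol (l : ℤ) : IsAnnular (Φ.symbol l) := Φ.isAnnular_φ.dilate l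

/-- The sum of the three symbols `φ_{-1} + φ_0 + φ_1`, which is `1` on the support of `φ`. -/
def wide (η : E d) : ℂ := Φ.symbol (-1) η + Φ.symbol 0 η + Φ.symbol 1 η

theorem isAnnular_wide : IsAnnular Φ.wide :=
  ((Φ.isAnnular_symbol (-1)).add (Φ.isAnnular_symbol 0)).add (Φ.isAnnular_symbol 1)

theorem dilate_wide (l : ℤ) (η : E d) :
    dilate Φ.wide l η = Φ.symbol (l - 1) η + Φ.symbol l η + Φ.symbol (l + 1) η := by
  have h : ∀ k : ℤ, Φ.symbol k ((2 : ℝ) ^ (-l) • η) = Φ.symbol (l + k) η := by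
    intro k
    rw [symbol, symbol, smul_smul, ← zpow_add₀ two_ne_zero, neg_add, add_comm]
  rw [dilate, wide, h, h, h, add_zero, sub_eq_add_neg]

theorem φ_smul_eq_zero {l k : ℤ} {η : E d}
    (h : 3 / 4 ≤ ‖(2 : ℝ) ^ (-l) • η‖ ∧ ‖(2 : ℝ) ^ (-l) • η‖ ≤ 8 / 3)
    (hk : k ∉ ({l - 1, l, l + 1} : Finset ℤ)) : Φ.φ ((2 : ℝ) ^ (-k) • η) = 0 := by
  by_contra hne
  have h3 := Φ.φ_supp (subset_tsupport _ hne)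
  rw [Set.mem_ofPred_eq] at h3
  rw [norm_smul, Real.norm_of_nonneg (by positivity)] at h h3
  -- As `8 / 3 < 2 ^ 2 * (3 / 4)`, the annuli with indices that differ by `2` are disjoint.
  have key : ∀ i j : ℤ, 3 / 4 ≤ (2 : ℝ) ^ (-i) * ‖η‖ → (2 : ℝ) ^ (-j) * ‖η‖ ≤ 8 / 3 →
      i - j < 2 := by
    intro i j hi hj
    by_contra hij
    have h4 : (2 : ℝ) ^ (2 : ℤ) ≤ 2 ^ (i - j) := zpow_le_zpow_right₀ one_le_two (not_lt.1 hij)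
    have h5 : (2 : ℝ) ^ (-j) = 2 ^ (i - j) * 2 ^ (-i) := by
      rw [← zpow_add₀ two_ne_zero]
      congr 1
      ring
    rw [h5, mul_assoc] at hj
    have h6 : (2 : ℝ) ^ (2 : ℤ) * (3 / 4) ≤ 2 ^ (i - j) * ((2 : ℝ) ^ (-i) * ‖η‖) := by gcongr
    norm_num at h6 hj
    linarith
  have h4 := key l k h.1 h3.2
  have h5 := key k l h3.1 h.2
  refine hk ?_
  simp only [Finset.mem_insert, Finset.mem_singleton]
  omega

theorem dilate_wide_eq_one {l : ℤ} {η : E d}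
    (h : 3 / 4 ≤ ‖(2 : ℝ) ^ (-l) • η‖ ∧ ‖(2 : ℝ) ^ (-l) • η‖ ≤ 8 / 3) :
    dilate Φ.wide l η = 1 := by
  have hη : η ≠ 0 := by
    rintro rfl
    have := h.1
    norm_num at this
  have h3 := (Φ.sum_int η hη).unique
    (hasSum_sum_of_ne_finset_zero fun k hk => Φ.φ_smul_eq_zero h hk)
  rw [dilate_wide]
  rw [Finset.sum_insert (by simp; omega), Finset.sum_insert (by simp), Finset.sum_singleton] at h3
  simp only [symbol]
  rw [← Complex.ofReal_add, ← Complex.ofReal_add, add_assoc, ← h3, Complex.ofReal_one]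

theorem mem_annulus_of_symbol_ne_zero {l : ℤ} {η : E d} (h : Φ.symbol l η ≠ 0) :
    3 / 4 ≤ ‖(2 : ℝ) ^ (-l) • η‖ ∧ ‖(2 : ℝ) ^ (-l) • η‖ ≤ 8 / 3 := by
  refine Φ.φ_supp (subset_tsupport _ fun h0 => h ?_)
  rw [symbol, h0, Complex.ofReal_zero]

theorem symbol_mul_symbol_eq_zero {l k : ℤ} (hk : k ∉ ({l - 1, l, l + 1} : Finset ℤ)) :
    Φ.symbol k * Φ.symbol l = 0 := by
  funext η
  rw [Pi.mul_apply, Pi.zero_apply]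
  by_cases h : Φ.symbol l η = 0
  · rw [h, mul_zero]
  · rw [symbol, Φ.φ_smul_eq_zero (Φ.mem_annulus_of_symbol_ne_zero h) hk, Complex.ofReal_zero,
      zero_mul]

theorem symbol_mul_dilate_wide (l : ℤ) : Φ.symbol l * dilate Φ.wide l = Φ.symbol l := by
  funext η
  rw [Pi.mul_apply]
  by_cases h : Φ.symbol l η = 0
  · rw [h, zero_mul]
  · rw [Φ.dilate_wide_eq_one (Φ.mem_annulus_of_symbol_ne_zero h), mul_one]

theorem block_mk (l : ℤ) (T : 𝓢'(E d, ℂ)) :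
    Φ.block l (Submodule.Quotient.mk T) = Φ.blockDist l T := rfl

theorem blockDist_apply (l : ℤ) (T : 𝓢'(E d, ℂ)) (φ : 𝓢(E d, ℂ)) :
    Φ.blockDist l T φ = T (transposeMul (Φ.symbol l) φ) := rfl

theorem dilate_wide_eq_sum (l : ℤ) :
    dilate Φ.wide l = Φ.symbol (l - 1) + (Φ.symbol l + Φ.symbol (l + 1)) := by
  funext η
  rw [Φ.dilate_wide, Pi.add_apply, Pi.add_apply, add_assoc]

/-- The Fourier multiplier `φ_{l-1} + φ_l + φ_{l+1}` as a sum of three blocks. -/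
theorem apply_transposeMul_wide (l : ℤ) (T : 𝓢'(E d, ℂ)) (φ : 𝓢(E d, ℂ)) :
    T (transposeMul (dilate Φ.wide l) φ) =
      ∑ k ∈ ({l - 1, l, l + 1} : Finset ℤ), T (transposeMul (Φ.symbol k) φ) := by
  rw [Finset.sum_insert (by simp; omega), Finset.sum_insert (by simp), Finset.sum_singleton,
    dilate_wide_eq_sum, transposeMul_add (Φ.symbol_hasTemperateGrowth _)
      ((Φ.symbol_hasTemperateGrowth _).add (Φ.symbol_hasTemperateGrowth _)),
    transposeMul_add (Φ.symbol_hasTemperateGrowth _) (Φ.symbol_hasTemperateGrowth _), map_add,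
    map_add]

theorem block_transposeMul_wide (l : ℤ) (g : SModP d) (φ : 𝓢(E d, ℂ)) :
    Φ.block l g (transposeMul (dilate Φ.wide l) φ) = Φ.block l g φ := by
  obtain ⟨T, rfl⟩ := Submodule.Quotient.mk_surjective _ g
  rw [block_mk, blockDist_apply, blockDist_apply,
    transposeMul_transposeMul (Φ.symbol_hasTemperateGrowth l)
      (Φ.isAnnular_wide.dilate l).hasTemperateGrowth, symbol_mul_dilate_wide]

/-- The block `Δ_l g` as a function. It is the convolution of `Δ_l g` with the kernel of the
multiplier `φ_{l-1} + φ_l + φ_{l+1}`, which reproduces `Δ_l g`. -/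
def blockFun (l : ℤ) (g : SModP d) : E d → ℂ :=
  mollify (Φ.isAnnular_wide.kernel l) (Φ.block l g)

/-- If `Δ_l g` is in a mixed-Morrey space, then it is given by the bounded function `blockFun`. -/
theorem exists_blockFun {q : Fin d → ℝ} (hq : ∀ i, 1 ≤ q i) (lam : Fin d → ℝ) :
    ∃ C : ℝ≥0, ∀ (l : ℤ) (g : SModP d), distNorm (morreyNorm q lam) (Φ.block l g) < ∞ →
      Measurable (Φ.blockFun l g) ∧
      (∀ y, ‖Φ.blockFun l g y‖ₑ ≤
        C * ENNReal.ofReal ((2 : ℝ) ^ ((l : ℝ) * ∑ i, (1 - lam i) / q i)) *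
          distNorm (morreyNorm q lam) (Φ.block l g)) ∧
      Represents (Φ.blockFun l g) (Φ.block l g) ∧
      ∀ φ : 𝓢(E d, ℂ), Φ.block l g φ = ∫ y, Φ.blockFun l g y * φ y := by
  obtain ⟨C, hC⟩ := Φ.isAnnular_wide.exists_bound_mollify (d - ∑ i, (1 - lam i) / q i)
  refine ⟨C * (2 ^ ∑ i, (1 - 1 / q i) : ℝ).toNNReal, fun l g hg => ?_⟩
  obtain ⟨f, hf, hfin⟩ := exists_represents_of_distNorm_lt_top hg
  have hd : distNorm (morreyNorm q lam) (Φ.block l g) = morreyNorm q lam f :=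
    distNorm_eq (fun _ _ h => morreyNorm_congr_ae (fun i => zero_le_one.trans (hq i)) lam h) hf
  have hgr := morreyNorm_hasGrowth hq lam hf.1.aestronglyMeasurable
  have hA := ENNReal.mul_ne_top
    (ENNReal.ofReal_ne_top (r := (2 ^ ∑ i, (1 - 1 / q i) : ℝ))) hfin.ne
  have hb : ∀ y, ‖Φ.blockFun l g y‖ₑ ≤
      (C * (2 ^ ∑ i, (1 - 1 / q i) : ℝ).toNNReal : ℝ≥0) *
        ENNReal.ofReal ((2 : ℝ) ^ ((l : ℝ) * ∑ i, (1 - lam i) / q i)) *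
          distNorm (morreyNorm q lam) (Φ.block l g) := by
    intro y
    refine (hC l _ f _ hf hgr hA y).trans_eq ?_
    rw [hd, sub_sub_cancel, ENNReal.coe_mul]
    change _ * _ * (ENNReal.ofReal _ * _) = _ * ENNReal.ofReal _ * _ * _
    ring
  have hm : Measurable (Φ.blockFun l g) := hf.measurable_mollify hgr hA _
  have happ : ∀ φ : 𝓢(E d, ℂ), Φ.block l g φ = ∫ y, Φ.blockFun l g y * φ y := by
    intro φ
    rw [← block_transposeMul_wide]
    exact hf.apply_transposeMul hgr hA (Φ.isAnnular_wide.dilate l).contDiff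
      (Φ.isAnnular_wide.dilate l).hasCompactSupport φ
  refine ⟨hm, hb, ⟨locallyIntegrable_of_bounded hm ?_ hb, fun φ _ => happ φ⟩, happ⟩
  exact ENNReal.mul_ne_top (ENNReal.mul_ne_top ENNReal.coe_ne_top ENNReal.ofReal_ne_top) hg.ne

theorem distNorm_block_eq {q : Fin d → ℝ} (hq : ∀ i, 1 ≤ q i) (lam : Fin d → ℝ) {l : ℤ}
    {g : SModP d} (h : distNorm (morreyNorm q lam) (Φ.block l g) < ∞) :
    distNorm (morreyNorm q lam) (Φ.block l g) = morreyNorm q lam (Φ.blockFun l g) := by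
  obtain ⟨C, hC⟩ := Φ.exists_blockFun hq lam
  exact distNorm_eq (fun _ _ h => morreyNorm_congr_ae (fun i => zero_le_one.trans (hq i)) lam h)
    (hC l g h).2.2.1

/-- Bernstein's inequality. -/
theorem exists_distNorm_supNorm_le {q : Fin d → ℝ} (hq : ∀ i, 1 ≤ q i) (lam : Fin d → ℝ) :
    ∃ C : ℝ≥0, ∀ (l : ℤ) (g : SModP d), distNorm (morreyNorm q lam) (Φ.block l g) < ∞ →
      distNorm supNorm (Φ.block l g) ≤
        C * ENNReal.ofReal ((2 : ℝ) ^ ((l : ℝ) * ∑ i, (1 - lam i) / q i)) *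
          distNorm (morreyNorm q lam) (Φ.block l g) := by
  obtain ⟨C, hC⟩ := Φ.exists_blockFun hq lam
  refine ⟨C, fun l g h => (distNorm_le _ (hC l g h).2.2.1).trans ?_⟩
  exact supNorm_le_of_bound (hC l g h).2.1

end DyadicPartition

/-! ### The embeddings -/

section Embeddings

variable {d : ℕ} (Φ : DyadicPartition d)

theorem distNorm_lt_top_of_bmmNorm_lt_top {q lam : Fin d → ℝ} {r : ℝ≥0∞} (hr : 1 ≤ r) {s : ℝ}
    {g : SModP d} (h : bmmNorm Φ q lam s r g < ∞) (l : ℤ) :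
    distNorm (morreyNorm q lam) (Φ.block l g) < ∞ := by
  have h1 := (le_seqNorm hr (fun l : ℤ => ENNReal.ofReal ((2 : ℝ) ^ ((l : ℝ) * s)) *
    distNorm (morreyNorm q lam) (Φ.block l g)) l).trans_lt h
  by_contra h2
  rw [not_lt_top_iff.1 h2, ENNReal.mul_top] at h1
  · exact lt_irrefl _ h1
  · exact (ENNReal.ofReal_pos.2 (by positivity)).ne'

/-- An inequality between the norms of the blocks gives an embedding. -/
theorem continuouslyIncluded_of_block_le {q lam : Fin d → ℝ} {X : (E d → ℂ) → ℝ≥0∞} {r : ℝ≥0∞}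
    (hr : 1 ≤ r) {s t : ℝ} (C : ℝ≥0)
    (h : ∀ (l : ℤ) (g : SModP d), distNorm (morreyNorm q lam) (Φ.block l g) < ∞ →
      distNorm X (Φ.block l g) ≤ C * ENNReal.ofReal ((2 : ℝ) ^ ((l : ℝ) * t)) *
        distNorm (morreyNorm q lam) (Φ.block l g)) :
    ContinuouslyIncluded (bmmNorm Φ q lam s r) (besovNorm Φ X (s - t) r) := by
  refine ⟨C, fun g hg => ?_⟩
  rw [bmmNorm, besovNorm, besovNorm, ← seqNorm_const_mul hr]
  refine seqNorm_mono r fun l => ?_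
  calc _ ≤ ENNReal.ofReal ((2 : ℝ) ^ ((l : ℝ) * (s - t))) *
        (C * ENNReal.ofReal ((2 : ℝ) ^ ((l : ℝ) * t)) *
          distNorm (morreyNorm q lam) (Φ.block l g)) := by
        gcongr
        exact h l g (distNorm_lt_top_of_bmmNorm_lt_top Φ hr hg l)
    _ = C * (ENNReal.ofReal ((2 : ℝ) ^ ((l : ℝ) * (s - t)) * (2 : ℝ) ^ ((l : ℝ) * t)) *
          distNorm (morreyNorm q lam) (Φ.block l g)) := by
        rw [ENNReal.ofReal_mul (by positivity)]
        ring
    _ = _ := by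
        rw [← Real.rpow_add two_pos, mul_sub, sub_add_cancel]

theorem bmmNorm_continuouslyIncluded_of_le {q r lam mu : Fin d → ℝ} {a : ℝ≥0∞} (ha : 1 ≤ a)
    (σ : ℝ) (hq : ∀ i, 1 ≤ q i) (hqr : ∀ i, q i ≤ r i)
    (h : ∀ i, (1 - lam i) / q i = (1 - mu i) / r i) :
    ContinuouslyIncluded (bmmNorm Φ r mu σ a) (bmmNorm Φ q lam σ a) := by
  have h1 := continuouslyIncluded_of_block_le Φ (q := r) (lam := mu) (X := morreyNorm q lam) ha
    (s := σ) (t := 0) (2 ^ ∑ i, (1 / q i - 1 / r i) : ℝ).toNNReal fun l g hg => ?_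
  · rwa [sub_zero] at h1
  obtain ⟨f, hf, hfin⟩ := exists_represents_of_distNorm_lt_top hg
  have hq0 : ∀ i, 0 < q i := fun i => one_pos.trans_le (hq i)
  rw [distNorm_eq (fun _ _ h => morreyNorm_congr_ae (fun i => (hq0 i).le) lam h) hf,
    distNorm_eq (fun _ _ h => morreyNorm_congr_ae
      (fun i => ((hq0 i).trans_le (hqr i)).le) mu h) hf, mul_zero, Real.rpow_zero,
      ENNReal.ofReal_one, mul_one]
  exact morreyNorm_le_of_le hq0 hqr h hf.1.aestronglyMeasurable

theorem bmmNorm_continuouslyIncluded_seq {q lam : Fin d → ℝ} {a b : ℝ≥0∞} (ha : 1 ≤ a)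
    (hab : a ≤ b) (σ : ℝ) :
    ContinuouslyIncluded (bmmNorm Φ q lam σ a) (bmmNorm Φ q lam σ b) :=
  ⟨1, fun g _ => by
    rw [ENNReal.coe_one, one_mul]
    exact seqNorm_anti ha hab _⟩

theorem bmmNorm_continuouslyIncluded_besovSupNorm {q : Fin d → ℝ} (lam : Fin d → ℝ) {r : ℝ≥0∞}
    (hr : 1 ≤ r) (s : ℝ) (hq : ∀ i, 1 ≤ q i) :
    ContinuouslyIncluded (bmmNorm Φ q lam s r)
      (besovSupNorm Φ (s - ∑ i, (1 - lam i) / q i) r) := by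
  obtain ⟨C, hC⟩ := Φ.exists_distNorm_supNorm_le hq lam
  exact continuouslyIncluded_of_block_le Φ hr C hC

theorem bmmNorm_continuouslyIncluded_div {q : Fin d → ℝ} (lam : Fin d → ℝ) {r : ℝ≥0∞}
    (hr : 1 ≤ r) (s : ℝ) {θ : ℝ} (h0 : 0 < θ) (h1 : θ < 1) (hq : ∀ i, 1 ≤ q i) :
    ContinuouslyIncluded (bmmNorm Φ q lam s r)
      (bmmNorm Φ (fun i => q i / θ) lam (s - (∑ i, (1 - lam i) / q i) * (1 - θ)) r) := by
  obtain ⟨C, hC⟩ := Φ.exists_blockFun hq lam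
  refine continuouslyIncluded_of_block_le Φ hr (C ^ (1 - θ)) fun l g hg => ?_
  obtain ⟨-, hb, hrep, -⟩ := hC l g hg
  have hs := supNorm_le_of_bound hb
  have hs' := hs.trans_lt (ENNReal.mul_lt_top
    (ENNReal.mul_lt_top ENNReal.coe_lt_top ENNReal.ofReal_lt_top) hg)
  have hθ : 0 < 1 - θ := by linarith
  set M := distNorm (morreyNorm q lam) (Φ.block l g) with hM
  calc _ ≤ morreyNorm (fun i => q i / θ) lam (Φ.blockFun l g) := distNorm_le _ hrep
    _ ≤ supNorm (Φ.blockFun l g) ^ (1 - θ) * morreyNorm q lam (Φ.blockFun l g) ^ θ :=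
        morreyNorm_div_le (fun i => one_pos.trans_le (hq i)) lam h0 h1 hs'.ne
    _ ≤ (C * ENNReal.ofReal ((2 : ℝ) ^ ((l : ℝ) * ∑ i, (1 - lam i) / q i)) * M) ^ (1 - θ) *
          M ^ θ := by
        rw [← Φ.distNorm_block_eq hq lam hg]
        gcongr
    _ = (C : ℝ≥0∞) ^ (1 - θ) *
          ENNReal.ofReal ((2 : ℝ) ^ ((l : ℝ) * ∑ i, (1 - lam i) / q i)) ^ (1 - θ) *
          (M ^ (1 - θ) * M ^ θ) := by
        rw [ENNReal.mul_rpow_of_nonneg _ _ hθ.le, ENNReal.mul_rpow_of_nonneg _ _ hθ.le]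
        ring
    _ = _ := by
        rw [← ENNReal.rpow_add_of_nonneg _ _ hθ.le h0.le, sub_add_cancel, ENNReal.rpow_one,
          ENNReal.ofReal_rpow_of_nonneg (by positivity) hθ.le, ← Real.rpow_mul two_pos.le,
          ENNReal.coe_rpow_of_nonneg _ hθ.le, mul_assoc (l : ℝ)]

end Embeddings

/-! ### Distributions with vanishing blocks are polynomials -/

/-- The derivatives of order `j` of `𝓕⁻ φ` at the origin are the moments of order `j` of `φ`, up
to constants. -/
theorem iteratedFDeriv_fourierInv_zero {d : ℕ} {φ : 𝓢(E d, ℂ)} {j : ℕ}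
    (h : ∀ I : Fin j → Fin d, polyDist (∏ k, MvPolynomial.X (I k)) φ = 0) :
    iteratedFDeriv ℝ j (𝓕⁻ φ : 𝓢(E d, ℂ)) 0 = 0 := by
  set f : E d → ℂ := fun x => φ (-x) with hf
  have h1 : ((𝓕⁻ φ : 𝓢(E d, ℂ)) : E d → ℂ) = 𝓕 f := by
    rw [SchwartzMap.fourierInv_coe, Real.fourierInv_eq_fourier_comp_neg]
  have hfc : Continuous f := φ.continuous.comp continuous_neg
  have hint : ∀ n : ℕ, Integrable fun v : E d => ‖v‖ ^ n * ‖f v‖ := fun n => by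
    simpa [hf] using (SchwartzMap.integrable_pow_mul volume φ n).comp_neg
  rw [h1, Real.iteratedFDeriv_fourier (N := ⊤) (fun n _ => hint n) hfc.aestronglyMeasurable le_top]
  refine ContinuousMultilinearMap.toMultilinearMap_injective (Module.Basis.ext_multilinear
    (fun _ => (EuclideanSpace.basisFun (Fin d) ℝ).toBasis) fun I => ?_)
  have hi : Integrable fun v => VectorFourier.fourierPowSMulRight (innerSL ℝ) f v j :=
    VectorFourier.integrable_fourierPowSMulRight _ (hint j) hfc.aestronglyMeasurable
  have h2 : 𝓕 (fun v => VectorFourier.fourierPowSMulRight (innerSL ℝ) f v j) 0 =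
      ∫ v, VectorFourier.fourierPowSMulRight (innerSL ℝ) f v j := by
    rw [Real.fourier_eq]
    simp
  rw [h2]
  set e : Fin j → E d := fun i => (EuclideanSpace.basisFun (Fin d) ℝ).toBasis (I i) with he
  change (ContinuousMultilinearMap.apply ℝ (fun _ : Fin j => E d) ℂ e)
    (∫ v, VectorFourier.fourierPowSMulRight (innerSL ℝ) f v j) = 0
  rw [← ContinuousLinearMap.integral_comp_comm _ hi]
  have h3 : ∀ v, (ContinuousMultilinearMap.apply ℝ (fun _ : Fin j => E d) ℂ e)
      (VectorFourier.fourierPowSMulRight (innerSL ℝ) f v j) =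
      (2 * Real.pi * Complex.I) ^ j *
        (φ (-v) * polyFun (∏ k, MvPolynomial.X (I k)) (-v)) := by
    intro v
    rw [ContinuousMultilinearMap.apply_apply, VectorFourier.fourierPowSMulRight_apply]
    have h4 : ∀ i, innerSL ℝ v (EuclideanSpace.single i 1) = v i := fun i => by
      change inner ℝ v (EuclideanSpace.single i 1) = v i
      simp [EuclideanSpace.inner_single_right]
    simp only [he, OrthonormalBasis.coe_toBasis, EuclideanSpace.basisFun_apply, h4, polyFun,
      map_prod, MvPolynomial.eval_X, hf, PiLp.neg_apply, Complex.ofReal_neg, Finset.prod_neg,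
      Finset.card_univ, Fintype.card_fin, Complex.real_smul, smul_eq_mul, Complex.ofReal_prod]
    rw [neg_pow]
    ring
  simp_rw [h3]
  rw [integral_const_mul,
    integral_neg_eq_self fun v => φ v * polyFun (∏ k, MvPolynomial.X (I k)) v]
  have := h I
  rw [polyDist_apply] at this
  rw [this, mul_zero]

namespace DyadicPartition

variable {d : ℕ} (Φ : DyadicPartition d)

theorem ψ_half_smul (η : E d) : Φ.ψ ((2 : ℝ)⁻¹ • η) = Φ.ψ η + Φ.φ η := by
  have h1 := Φ.sum_nat η
  have h2 := Φ.sum_nat ((2 : ℝ)⁻¹ • η)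
  have h3 : (fun l : ℕ => Φ.φ ((2 : ℝ) ^ (-(l : ℤ)) • (2 : ℝ)⁻¹ • η)) =
      fun l : ℕ => Φ.φ ((2 : ℝ) ^ (-((l + 1 : ℕ) : ℤ)) • η) := by
    funext l
    rw [smul_smul]
    congr 2
    rw [← zpow_neg_one, ← zpow_add₀ two_ne_zero]
    congr 1
    push_cast
    ring
  rw [h3] at h2
  rw [hasSum_nat_add_iff (f := fun l : ℕ => Φ.φ ((2 : ℝ) ^ (-(l : ℤ)) • η)) 1] at h2
  have h4 := h1.unique h2
  simp only [Finset.range_one, Finset.sum_singleton, Nat.cast_zero, neg_zero, zpow_zero,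
    one_smul] at h4
  linarith

theorem ψ_eq_one {η : E d} (h : ‖η‖ < 3 / 4) : Φ.ψ η = 1 := by
  have h1 := Φ.sum_nat η
  have h2 : (fun l : ℕ => Φ.φ ((2 : ℝ) ^ (-(l : ℤ)) • η)) = fun _ => 0 := by
    funext l
    by_contra hne
    have h3 := (Φ.φ_supp (subset_tsupport _ hne)).1
    rw [norm_smul, zpow_neg, zpow_natCast, norm_inv, norm_pow, Real.norm_two] at h3
    have h4 : ((2 : ℝ) ^ l)⁻¹ * ‖η‖ ≤ 1 * ‖η‖ := by
      gcongr
      exact inv_le_one_of_one_le₀ (one_le_pow₀ one_le_two)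
    linarith
  rw [h2] at h1
  linarith [h1.unique hasSum_zero]

theorem ψ_hasCompactSupport : HasCompactSupport Φ.ψ :=
  HasCompactSupport.of_support_subset_isCompact (isCompact_closedBall (0 : E d) (4 / 3))
    ((subset_tsupport _).trans (Φ.ψ_supp.trans Metric.ball_subset_closedBall))

/-- The symbol `ψ(2^{-k} ·)` of the low frequency cut-off. -/
def lowSymbol (k : ℤ) (η : E d) : ℂ := (Φ.ψ ((2 : ℝ) ^ (-k) • η) : ℂ)

theorem lowSymbol_hasTemperateGrowth (k : ℤ) : (Φ.lowSymbol k).HasTemperateGrowth := by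
  have hc : HasCompactSupport (fun η => Φ.ψ ((2 : ℝ) ^ (-k) • η)) :=
    Φ.ψ_hasCompactSupport.comp_homeomorph
      (Homeomorph.smulOfNeZero ((2 : ℝ) ^ (-k)) (by positivity))
  have hd : ContDiff ℝ (⊤ : ℕ∞) (Φ.lowSymbol k) :=
    Complex.ofRealCLM.contDiff.comp (Φ.ψ_smooth.comp (contDiff_const_smul _))
  have hc' : HasCompactSupport (Φ.lowSymbol k) := hc.comp_left Complex.ofReal_zero
  exact hc'.hasTemperateGrowth hd

theorem lowSymbol_add_one (k : ℤ) : Φ.lowSymbol (k + 1) = Φ.lowSymbol k + Φ.symbol k := by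
  funext η
  have h : (2 : ℝ) ^ (-(k + 1)) • η = (2 : ℝ)⁻¹ • (2 : ℝ) ^ (-k) • η := by
    rw [smul_smul, ← zpow_neg_one, ← zpow_add₀ two_ne_zero, neg_add_rev]
  rw [Pi.add_apply, lowSymbol, lowSymbol, symbol, h, ψ_half_smul, Complex.ofReal_add]

variable {T : 𝓢'(E d, ℂ)}

theorem apply_lowSymbol_eq (hT : ∀ l, Φ.blockDist l T = 0) (h : 𝓢(E d, ℂ)) (k : ℤ) :
    T (𝓕 (SchwartzMap.smulLeftCLM ℂ (Φ.lowSymbol k) h)) =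
      T (𝓕 (SchwartzMap.smulLeftCLM ℂ (Φ.lowSymbol 0) h)) := by
  have hstep : ∀ k : ℤ, T (𝓕 (SchwartzMap.smulLeftCLM ℂ (Φ.lowSymbol (k + 1)) h)) =
      T (𝓕 (SchwartzMap.smulLeftCLM ℂ (Φ.lowSymbol k) h)) := by
    intro k
    have h1 : T (𝓕 (SchwartzMap.smulLeftCLM ℂ (Φ.symbol k) h)) = 0 := by
      have h2 : Φ.blockDist k T (𝓕 h) = 0 := by rw [hT]; rfl
      rwa [blockDist_apply, transposeMul_def, FourierTransform.fourierInv_fourier_eq] at h2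
    rw [lowSymbol_add_one, SchwartzMap.smulLeftCLM_add (Φ.lowSymbol_hasTemperateGrowth k)
      (Φ.symbol_hasTemperateGrowth k), add_apply, FourierTransform.fourier_add, map_add, h1,
      add_zero]
  induction k using Int.induction_on with
  | zero => rfl
  | succ n ih => rw [hstep, ih]
  | pred n ih => rw [← hstep, sub_add_cancel, ih]

/-- A distribution with vanishing blocks vanishes at the Schwartz functions with vanishing moments
of high order: with `h = 𝓕⁻ φ`, the value `T (𝓕 (ψ(2^{-k} ·) h))` does not depend on `k`, it
tends to `T φ` for `k → ∞`, and to `0` for `k → -∞`. -/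
theorem exists_apply_eq_zero_of_moments (hT : ∀ l, Φ.blockDist l T = 0) :
    ∃ N : ℕ, ∀ φ : 𝓢(E d, ℂ), (∀ j ≤ N, iteratedFDeriv ℝ j (𝓕⁻ φ : 𝓢(E d, ℂ)) 0 = 0) →
      T φ = 0 := by
  let Λ : 𝓢(E d, ℂ) →L[ℂ] ℂ := (T : 𝓢(E d, ℂ) →L[ℂ] ℂ) ∘L
    FourierTransform.fourierCLM ℂ 𝓢(E d, ℂ)
  have hΛ : ∀ h, Λ h = T (𝓕 h) := fun h => rfl
  obtain ⟨s, C, -, hC⟩ := Seminorm.bound_of_continuous (schwartz_withSeminorms ℂ (E d) ℂ)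
    ((normSeminorm ℂ ℂ).comp Λ.toLinearMap) (continuous_norm.comp Λ.continuous)
  refine ⟨s.sup Prod.snd, fun φ h0 => ?_⟩
  set h : 𝓢(E d, ℂ) := 𝓕⁻ φ with hh
  have hχd : ContDiff ℝ (⊤ : ℕ∞) fun η => (Φ.ψ η : ℂ) :=
    Complex.ofRealCLM.contDiff.comp Φ.ψ_smooth
  have hχc : HasCompactSupport fun η => (Φ.ψ η : ℂ) :=
    Φ.ψ_hasCompactSupport.comp_left Complex.ofReal_zero
  have hup : Tendsto (fun K : ℕ => Λ (SchwartzMap.smulLeftCLM ℂ (Φ.lowSymbol K) h)) atTop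
      (𝓝 (Λ h)) := by
    refine (Λ.continuous.tendsto h).comp ?_
    have h1 := tendsto_cutoff hχd hχc (δ := 3 / 4) (by norm_num)
      (fun x hx => by rw [Φ.ψ_eq_one hx, Complex.ofReal_one]) h
    refine h1.congr fun K => ?_
    congr 2
    funext η
    rw [lowSymbol, zpow_neg, zpow_natCast, one_div, inv_pow]
  have hdown : Tendsto (fun K : ℕ => Λ (SchwartzMap.smulLeftCLM ℂ (Φ.lowSymbol (-K)) h)) atTop
      (𝓝 0) := by
    have hA := HasCompactSupport.exists_norm_iteratedFDeriv_le hχd hχc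
    have hsupp : ∀ x ∈ tsupport fun η => (Φ.ψ η : ℂ), ‖x‖ ≤ 4 / 3 := fun x hx => by
      have := Φ.ψ_supp (tsupport_comp_subset Complex.ofReal_zero Φ.ψ hx)
      rw [mem_ball_zero_iff] at this
      exact this.le
    have h1 : ∀ i : s, ∃ B : ℝ, 0 ≤ B ∧ ∀ (K : ℕ),
        schwartzSeminormFamily ℂ (E d) ℂ i
          (SchwartzMap.smulLeftCLM ℂ (Φ.lowSymbol (-K)) h) ≤ B * (1 / 2) ^ K := by
      intro i
      obtain ⟨B, hB0, hB⟩ := exists_norm_iteratedFDeriv_contract_mul_le hχd hA (ρ := 4 / 3)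
        (by norm_num) hsupp h h0 i.1.1 (n := i.1.2) (Finset.le_sup (f := Prod.snd) i.2)
      refine ⟨B, hB0, fun K => SchwartzMap.seminorm_le_bound _ _ _ _ (by positivity) fun x => ?_⟩
      have h2 := hB K x
      convert h2 using 4
      funext y
      rw [SchwartzMap.smulLeftCLM_apply_apply (Φ.lowSymbol_hasTemperateGrowth _), lowSymbol,
        neg_neg, zpow_natCast, smul_eq_mul]
    choose B hB0 hB using h1
    have h2 : ∀ K : ℕ, ‖Λ (SchwartzMap.smulLeftCLM ℂ (Φ.lowSymbol (-K)) h)‖ ≤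
        C * ((∑ i, B i) * (1 / 2) ^ K) := by
      intro K
      refine (hC _).trans ?_
      rw [smul_apply, NNReal.smul_def, smul_eq_mul]
      gcongr
      have h3 : 0 ≤ ∑ i, B i := Finset.sum_nonneg fun i _ => hB0 i
      refine Seminorm.finset_sup_apply_le (by positivity) fun i hi => ?_
      refine (hB ⟨i, hi⟩ K).trans ?_
      gcongr
      exact Finset.single_le_sum (fun i _ => hB0 i) (Finset.mem_univ (⟨i, hi⟩ : s))
    refine squeeze_zero_norm h2 ?_
    have := ((tendsto_pow_atTop_nhds_zero_of_lt_one (by norm_num : (0 : ℝ) ≤ 1 / 2)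
      (by norm_num)).const_mul (∑ i, B i)).const_mul (C : ℝ)
    simpa using this
  have e1 : ∀ k : ℤ, Λ (SchwartzMap.smulLeftCLM ℂ (Φ.lowSymbol k) h) =
    Λ (SchwartzMap.smulLeftCLM ℂ (Φ.lowSymbol 0) h) := fun k => Φ.apply_lowSymbol_eq hT h k
  simp_rw [e1] at hup hdown
  have h3 := (tendsto_nhds_unique hup tendsto_const_nhds).trans
    (tendsto_nhds_unique tendsto_const_nhds hdown)
  rwa [hΛ, hh, FourierTransform.fourier_fourierInv_eq] at h3

/-- A distribution with vanishing blocks is a polynomial. -/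
theorem mem_polynomials_of_blockDist_eq_zero (hT : ∀ l, Φ.blockDist l T = 0) :
    T ∈ polynomials d := by
  obtain ⟨N, hN⟩ := Φ.exists_apply_eq_zero_of_moments hT
  let p : (Σ j : Fin (N + 1), Fin j → Fin d) → MvPolynomial (Fin d) ℂ :=
    fun i => ∏ k, MvPolynomial.X (i.2 k)
  let L : 𝓢'(E d, ℂ) → 𝓢(E d, ℂ) →ₗ[ℂ] ℂ := fun S => (S : 𝓢(E d, ℂ) →L[ℂ] ℂ).toLinearMap
  have h1 : L T ∈ Submodule.span ℂ (Set.range fun i => L (polyDist (p i))) := by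
    refine mem_span_of_iInf_ker_le_ker fun φ hφ => hN φ fun j hj => ?_
    refine iteratedFDeriv_fourierInv_zero fun I => ?_
    exact (Submodule.mem_iInf _).1 hφ ⟨⟨j, Nat.lt_succ_of_le hj⟩, I⟩
  obtain ⟨c, hc⟩ := (Submodule.mem_span_range_iff_exists_fun ℂ).1 h1
  have h2 : T = ∑ i, c i • polyDist (p i) := by
    ext φ
    have h3 := LinearMap.congr_fun hc φ
    rw [LinearMap.sum_apply] at h3
    refine h3.symm.trans (Eq.symm ?_)
    exact map_sum (PointwiseConvergenceCLM.evalCLM (RingHom.id ℂ) ℂ φ)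
      (fun i => c i • polyDist (p i)) Finset.univ
  rw [h2]
  exact Submodule.sum_mem _ fun i _ => Submodule.smul_mem _ _ ⟨p i, rfl⟩

end DyadicPartition

/-! ### Banach spaces of distributions modulo polynomials -/

/-- The properties of a norm, for functions with values in `[0, ∞]`. -/
structure IsENorm {V : Type*} [AddCommGroup V] [Module ℂ V] (N : V → ℝ≥0∞) : Prop where
  add_le : ∀ g h, N (g + h) ≤ N g + N h
  smul_le : ∀ (c : ℂ) g, N (c • g) ≤ ‖c‖ₑ * N g
  eq_zero : ∀ g, N g = 0 → g = 0

namespace IsENorm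

variable {V : Type*} [AddCommGroup V] [Module ℂ V] {N : V → ℝ≥0∞}

theorem map_zero (h : IsENorm N) : N 0 = 0 := by
  simpa using h.smul_le 0 0

theorem map_neg (h : IsENorm N) (g : V) : N (-g) = N g := by
  have h1 : ∀ g, N (-g) ≤ N g := fun g => by simpa using h.smul_le (-1) g
  exact le_antisymm (h1 g) (by simpa using h1 (-g))

/-- The subspace of the vectors of finite norm. -/
def finite (h : IsENorm N) : Submodule ℂ V where
  carrier := {g | N g < ∞}
  zero_mem' := by
    change N 0 < ∞
    rw [h.map_zero]
    exact ENNReal.zero_lt_top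
  add_mem' ha hb := (h.add_le _ _).trans_lt (ENNReal.add_lt_top.2 ⟨ha, hb⟩)
  smul_mem' c _ hg := (h.smul_le c _).trans_lt (ENNReal.mul_lt_top enorm_lt_top hg)

/-- The subspace of the vectors of finite norm, as a normed space (a type synonym, because the
subspace already carries the topology of `V`). -/
def Space (h : IsENorm N) : Type _ := h.finite

instance (h : IsENorm N) : AddCommGroup h.Space := inferInstanceAs (AddCommGroup h.finite)

instance (h : IsENorm N) : Module ℂ h.Space := inferInstanceAs (Module ℂ h.finite)

/-- The inclusion of the normed space of the vectors of finite norm. -/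
def val (h : IsENorm N) : h.Space →ₗ[ℂ] V := h.finite.subtype

theorem val_lt_top (h : IsENorm N) (b : h.Space) : N (h.val b) < ∞ := b.2

theorem val_injective (h : IsENorm N) : Function.Injective h.val := Subtype.val_injective

theorem range_val (h : IsENorm N) : Set.range h.val = {g | N g < ∞} := Subtype.range_val

/-- The norm `N`, as a real number. -/
def groupNorm (h : IsENorm N) : AddGroupNorm h.Space where
  toFun b := (N (h.val b)).toReal
  map_zero' := by rw [_root_.map_zero, h.map_zero, ENNReal.toReal_zero]
  add_le' a b := by
    rw [← ENNReal.toReal_add (h.val_lt_top a).ne (h.val_lt_top b).ne, map_add]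
    exact ENNReal.toReal_mono (ENNReal.add_lt_top.2 ⟨h.val_lt_top a, h.val_lt_top b⟩).ne
      (h.add_le _ _)
  neg' a := by rw [_root_.map_neg, h.map_neg]
  eq_zero_of_map_eq_zero' a ha := by
    rcases (ENNReal.toReal_eq_zero_iff _).1 ha with h0 | h0
    · exact h.val_injective ((h.eq_zero _ h0).trans (_root_.map_zero _).symm)
    · exact absurd h0 (h.val_lt_top a).ne

instance (h : IsENorm N) : NormedAddCommGroup h.Space := h.groupNorm.toNormedAddCommGroup

theorem norm_eq (h : IsENorm N) (b : h.Space) : ‖b‖ = (N (h.val b)).toReal := rfl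

theorem ofReal_norm_eq (h : IsENorm N) (b : h.Space) : ENNReal.ofReal ‖b‖ = N (h.val b) := by
  rw [h.norm_eq, ENNReal.ofReal_toReal (h.val_lt_top b).ne]

instance (h : IsENorm N) : NormedSpace ℂ h.Space where
  norm_smul_le c b := by
    rw [h.norm_eq, h.norm_eq, _root_.map_smul, ← toReal_enorm, ← ENNReal.toReal_mul]
    exact ENNReal.toReal_mono (ENNReal.mul_lt_top enorm_lt_top (h.val_lt_top b)).ne
      (h.smul_le _ _)

end IsENorm

theorem continuous_of_norm_le {V : Type*} [AddCommGroup V] [Module ℂ V] [TopologicalSpace V]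
    [IsTopologicalAddGroup V] (f : V →ₗ[ℂ] ℂ) {p : V → ℝ} (hp : Continuous p) (hp0 : p 0 = 0)
    (h : ∀ v, ‖f v‖ ≤ p v) : Continuous f := by
  refine continuous_of_continuousAt_zero f ?_
  rw [ContinuousAt, map_zero]
  have := hp.tendsto 0
  rw [hp0] at this
  exact squeeze_zero_norm h this

/-- Let `N` be lower semicontinuous for the convergence in `𝒮'` of representatives, and let the
elements of finite norm have representatives in `𝒮'` that depend linearly and continuously on
them. Then the elements of finite norm form a Banach space that is continuously included in
`𝒮'/𝒫`. -/
theorem IsENorm.isBanachIncludedInSModP {d : ℕ} {N : SModP d → ℝ≥0∞} (hN : IsENorm N)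
    (L : hN.Space →ₗ[ℂ] 𝓢'(E d, ℂ)) (hL : ∀ g, Submodule.Quotient.mk (L g) = hN.val g)
    {p : 𝓢(E d, ℂ) → ℝ} (hp : Continuous p) (hp0 : p 0 = 0) (hp1 : ∀ φ, 0 ≤ p φ)
    (hLp : ∀ g φ, ‖L g φ‖ ≤ p φ * ‖g‖)
    (hfatou : ∀ (T : ℕ → 𝓢'(E d, ℂ)) (S : 𝓢'(E d, ℂ)) (A : ℝ),
      (∀ φ, Tendsto (fun n => T n φ) atTop (𝓝 (S φ))) →
      (∀ n, N (Submodule.Quotient.mk (T n)) ≤ ENNReal.ofReal A) →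
      N (Submodule.Quotient.mk S) ≤ ENNReal.ofReal A) :
    IsBanachIncludedInSModP N := by
  let e : 𝓢(E d, ℂ) → hN.Space →L[ℂ] ℂ := fun φ =>
    LinearMap.mkContinuous
      ((PointwiseConvergenceCLM.evalCLM (RingHom.id ℂ) ℂ φ).toLinearMap ∘ₗ L) (p φ) (hLp · φ)
  have hLc : Continuous L := PointwiseConvergenceCLM.continuous_of_continuous_eval
    fun φ => (e φ).continuous
  have hι : Continuous hN.val := by
    have h1 : ⇑hN.val = (fun T => (Submodule.Quotient.mk T : SModP d)) ∘ L :=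
      funext fun g => (hL g).symm
    rw [h1]
    exact continuous_quot_mk.comp hLc
  have hcomplete : CompleteSpace hN.Space := by
    refine Metric.complete_of_cauchySeq_tendsto fun u hu => ?_
    have h1 : ∀ φ, ∃ t, Tendsto (fun n => L (u n) φ) atTop (𝓝 t) := fun φ =>
      cauchySeq_tendsto_of_complete (hu.map (e φ).uniformContinuous)
    choose t ht using h1
    obtain ⟨B, hB⟩ := hu.norm_bddAbove
    have hB' : ∀ n, ‖u n‖ ≤ B := fun n => hB ⟨n, rfl⟩
    let S₀ : 𝓢(E d, ℂ) →ₗ[ℂ] ℂ := linearMapOfTendsto t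
      (fun n => ((L (u n) : 𝓢(E d, ℂ) →L[ℂ] ℂ) : 𝓢(E d, ℂ) →ₗ[ℂ] ℂ)) (tendsto_pi_nhds.2 ht)
    have hS₀ : ∀ φ, ‖S₀ φ‖ ≤ p φ * B := fun φ => by
      refine le_of_tendsto (ht φ).norm (Eventually.of_forall fun n => (hLp _ _).trans ?_)
      have h2 := hp1 φ
      gcongr
      exact hB' n
    let S : 𝓢'(E d, ℂ) := (⟨S₀, continuous_of_norm_le S₀ (hp.mul continuous_const)
      (by simp [hp0]) hS₀⟩ : 𝓢(E d, ℂ) →L[ℂ] ℂ)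
    have hS : ∀ φ, Tendsto (fun n => L (u n) φ) atTop (𝓝 (S φ)) := ht
    have hfin : N (Submodule.Quotient.mk S) < ∞ := by
      refine (hfatou (fun n => L (u n)) S B hS fun n => ?_).trans_lt ENNReal.ofReal_lt_top
      rw [hL, ← hN.ofReal_norm_eq]
      exact ENNReal.ofReal_le_ofReal (hB' n)
    obtain ⟨v, hv⟩ : ∃ v, hN.val v = Submodule.Quotient.mk S := by
      have : Submodule.Quotient.mk S ∈ Set.range hN.val := by
        rw [hN.range_val]
        exact hfin
      exact this
    refine ⟨v, Metric.tendsto_atTop.2 fun ε hε => ?_⟩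
    obtain ⟨n₀, hn₀⟩ := Metric.cauchySeq_iff.1 hu (ε / 2) (half_pos hε)
    refine ⟨n₀, fun m hm => ?_⟩
    have h2 : N (Submodule.Quotient.mk (S - L (u m))) ≤ ENNReal.ofReal (ε / 2) := by
      refine hfatou (fun n => L (u (n + n₀) - u m)) _ _ (fun φ => ?_) fun n => ?_
      · have h3 := ((hS φ).comp (tendsto_add_atTop_nat n₀)).sub_const (L (u m) φ)
        refine h3.congr fun n => ?_
        rw [map_sub]
        rfl
      · rw [hL, ← hN.ofReal_norm_eq, ← dist_eq_norm]
        exact ENNReal.ofReal_le_ofReal (hn₀ _ (Nat.le_add_left _ _) _ hm).le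
    rw [Submodule.Quotient.mk_sub, hL, ← hv, ← map_sub, ← hN.ofReal_norm_eq, ← dist_eq_norm,
      ENNReal.ofReal_le_ofReal_iff (half_pos hε).le, dist_comm] at h2
    linarith
  refine ⟨hN.Space, inferInstance, inferInstance, hcomplete, ⟨hN.val, hι⟩, hN.val_injective,
    hN.range_val, fun b => ?_⟩
  rw [← ofReal_norm, hN.ofReal_norm_eq]
  rfl

/-! ### The norm of the Besov mixed-Morrey spaces -/

theorem Represents.add {d : ℕ} {f g : E d → ℂ} {S T : 𝓢'(E d, ℂ)} (hf : Represents f S)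
    (hg : Represents g T) : Represents (f + g) (S + T) := by
  refine ⟨hf.1.add hg.1, fun φ hφ => ?_⟩
  have hi : ∀ {w : E d → ℂ}, LocallyIntegrable w → Integrable fun x => w x * φ x := by
    intro w hw
    have := hw.integrable_smul_right_of_hasCompactSupport φ.continuous hφ
    simpa [smul_eq_mul] using this
  change S φ + T φ = _
  rw [hf.2 φ hφ, hg.2 φ hφ, ← integral_add (hi hf.1) (hi hg.1)]
  simp_rw [← add_mul]
  rfl

theorem Represents.const_smul {d : ℕ} {f : E d → ℂ} {T : 𝓢'(E d, ℂ)} (hf : Represents f T)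
    (c : ℂ) : Represents (c • f) (c • T) := by
  refine ⟨hf.1.smul c, fun φ hφ => ?_⟩
  change c * T φ = _
  rw [hf.2 φ hφ, ← integral_const_mul]
  simp_rw [← mul_assoc]
  rfl

theorem distNorm_add_le {d : ℕ} {q : Fin d → ℝ} (hq : ∀ i, 1 ≤ q i) (lam : Fin d → ℝ)
    (S T : 𝓢'(E d, ℂ)) : distNorm (morreyNorm q lam) (S + T) ≤
      distNorm (morreyNorm q lam) S + distNorm (morreyNorm q lam) T := by
  rw [distNorm, distNorm, distNorm]
  simp_rw [ENNReal.iInf_add, ENNReal.add_iInf]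
  refine le_iInf₂ fun f hf => le_iInf₂ fun g hg => (distNorm_le _ (hf.add hg)).trans ?_
  exact morreyNorm_add_le hq lam hf.1.aestronglyMeasurable hg.1.aestronglyMeasurable

theorem distNorm_smul_le {d : ℕ} {q : Fin d → ℝ} (hq : ∀ i, 1 ≤ q i) (lam : Fin d → ℝ)
    (c : ℂ) (T : 𝓢'(E d, ℂ)) :
    distNorm (morreyNorm q lam) (c • T) ≤ ‖c‖ₑ * distNorm (morreyNorm q lam) T := by
  have hq0 : ∀ i, 0 < q i := fun i => one_pos.trans_le (hq i)
  by_cases h : distNorm (morreyNorm q lam) T < ∞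
  · obtain ⟨f, hf, -⟩ := exists_represents_of_distNorm_lt_top h
    rw [distNorm_eq (fun _ _ h => morreyNorm_congr_ae (fun i => (hq0 i).le) lam h) hf,
      ← morreyNorm_const_smul hq0]
    exact distNorm_le _ (hf.const_smul c)
  · rw [not_lt_top_iff.1 h]
    by_cases hc : c = 0
    · have h0 : Represents (0 : E d → ℂ) (0 : 𝓢'(E d, ℂ)) :=
        ⟨locallyIntegrable_zero, fun φ _ => by simp⟩
      have h1 := distNorm_le (morreyNorm q lam) h0
      have h2 := morreyNorm_const_smul hq0 lam 0 (0 : E d → ℂ)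
      rw [zero_smul, enorm_zero, zero_mul] at h2
      rw [h2] at h1
      have h3 : (0 : ℂ) • T = 0 := zero_smul ℂ T
      rw [hc, h3]
      exact h1.trans zero_le
    · rw [ENNReal.mul_top (by simpa using hc)]
      exact le_top

theorem isENorm_bmmNorm {d : ℕ} (Φ : DyadicPartition d) {q : Fin d → ℝ} (hq : ∀ i, 1 ≤ q i)
    (lam : Fin d → ℝ) (s : ℝ) {r : ℝ≥0∞} (hr : 1 ≤ r) : IsENorm (bmmNorm Φ q lam s r) where
  add_le g h := by
    refine (seqNorm_mono r fun l => ?_).trans (seqNorm_add_le hr _ _)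
    rw [map_add, ← mul_add]
    gcongr
    exact distNorm_add_le hq lam _ _
  smul_le c g := by
    rw [bmmNorm, besovNorm, besovNorm, ← seqNorm_const_mul hr]
    refine seqNorm_mono r fun l => ?_
    rw [map_smul, mul_left_comm]
    gcongr
    exact distNorm_smul_le hq lam c _
  eq_zero g h := by
    obtain ⟨C, hC⟩ := Φ.exists_blockFun hq lam
    have h1 : ∀ l, distNorm (morreyNorm q lam) (Φ.block l g) = 0 := by
      intro l
      have h2 := le_seqNorm hr (fun l : ℤ => ENNReal.ofReal ((2 : ℝ) ^ ((l : ℝ) * s)) *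
        distNorm (morreyNorm q lam) (Φ.block l g)) l
      have h3 := (h2.trans_eq h).antisymm zero_le
      exact (mul_eq_zero.1 h3).resolve_left (ENNReal.ofReal_pos.2 (by positivity)).ne'
    obtain ⟨T, rfl⟩ := Submodule.Quotient.mk_surjective _ g
    refine (Submodule.Quotient.mk_eq_zero _).2 (Φ.mem_polynomials_of_blockDist_eq_zero fun l => ?_)
    obtain ⟨-, hb, -, happ⟩ := hC l (Submodule.Quotient.mk T)
      (by rw [h1]; exact ENNReal.zero_lt_top)
    ext φ
    rw [← Φ.block_mk, happ]
    simp only [h1, mul_zero] at hb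
    have h4 : ∀ y, Φ.blockFun l (Submodule.Quotient.mk T) y = 0 := fun y =>
      enorm_eq_zero.1 ((hb y).antisymm zero_le)
    simp [h4]

/-- The norm is lower semicontinuous for the convergence in `𝒮'`. -/
theorem bmmNorm_le_of_tendsto {d : ℕ} (Φ : DyadicPartition d) {q : Fin d → ℝ}
    (hq : ∀ i, 1 ≤ q i) (lam : Fin d → ℝ) (s : ℝ) {r : ℝ≥0∞} (hr : 1 ≤ r)
    {T : ℕ → 𝓢'(E d, ℂ)} {S : 𝓢'(E d, ℂ)} {A : ℝ}
    (hT : ∀ φ, Tendsto (fun n => T n φ) atTop (𝓝 (S φ)))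
    (hA : ∀ n, bmmNorm Φ q lam s r (Submodule.Quotient.mk (T n)) ≤ ENNReal.ofReal A) :
    bmmNorm Φ q lam s r (Submodule.Quotient.mk S) ≤ ENNReal.ofReal A := by
  obtain ⟨C, hC⟩ := Φ.exists_blockFun hq lam
  have hq0 : ∀ i, 0 < q i := fun i => one_pos.trans_le (hq i)
  set g : ℕ → SModP d := fun n => Submodule.Quotient.mk (T n) with hg
  set D : ℕ → ℤ → ℝ≥0∞ := fun n l => distNorm (morreyNorm q lam) (Φ.block l (g n)) with hD
  have hfin : ∀ n l, D n l < ∞ := fun n l =>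
    distNorm_lt_top_of_bmmNorm_lt_top Φ hr ((hA n).trans_lt ENNReal.ofReal_lt_top) l
  have hDle : ∀ n l, D n l ≤ (ENNReal.ofReal ((2 : ℝ) ^ ((l : ℝ) * s)))⁻¹ * ENNReal.ofReal A := by
    intro n l
    rw [mul_comm, ← div_eq_mul_inv, ENNReal.le_div_iff_mul_le
      (Or.inl (ENNReal.ofReal_pos.2 (by positivity)).ne') (Or.inl ENNReal.ofReal_ne_top), mul_comm]
    exact (le_seqNorm hr (fun l : ℤ => ENNReal.ofReal ((2 : ℝ) ^ ((l : ℝ) * s)) * D n l) l).trans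
      (hA n)
  have hblock : ∀ l, distNorm (morreyNorm q lam) (Φ.block l (Submodule.Quotient.mk S)) ≤
      liminf (fun n => D n l) atTop := by
    intro l
    have hlim : ∀ φ, Tendsto (fun n => Φ.block l (g n) φ) atTop
        (𝓝 (Φ.block l (Submodule.Quotient.mk S) φ)) := fun φ => hT _
    set F := Φ.blockFun l (Submodule.Quotient.mk S) with hF
    have hlimF : ∀ y, Tendsto (fun n => Φ.blockFun l (g n) y) atTop (𝓝 (F y)) := fun y => hlim _
    set B : ℝ≥0∞ := C * ENNReal.ofReal ((2 : ℝ) ^ ((l : ℝ) * ∑ i, (1 - lam i) / q i)) *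
      ((ENNReal.ofReal ((2 : ℝ) ^ ((l : ℝ) * s)))⁻¹ * ENNReal.ofReal A) with hB
    have hBtop : B ≠ ∞ := by
      refine ENNReal.mul_ne_top (ENNReal.mul_ne_top ENNReal.coe_ne_top ENNReal.ofReal_ne_top)
        (ENNReal.mul_ne_top (ENNReal.inv_ne_top.2 ?_) ENNReal.ofReal_ne_top)
      exact (ENNReal.ofReal_pos.2 (by positivity)).ne'
    have hb : ∀ n y, ‖Φ.blockFun l (g n) y‖ₑ ≤ B := fun n y => by
      refine ((hC l (g n) (hfin n l)).2.1 y).trans ?_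
      rw [hB]
      gcongr
      exact hDle n l
    have hbF : ∀ y, ‖F y‖ₑ ≤ B := fun y =>
      le_of_tendsto (hlimF y).enorm (Eventually.of_forall fun n => hb n y)
    have hmeas := fun n => (hC l (g n) (hfin n l)).1
    have hmF : Measurable F := measurable_of_tendsto_metrizable hmeas (tendsto_pi_nhds.2 hlimF)
    have hrep : Represents F (Φ.block l (Submodule.Quotient.mk S)) := by
      refine ⟨locallyIntegrable_of_bounded hmF hBtop hbF, fun φ _ => ?_⟩
      refine tendsto_nhds_unique (hlim φ) ?_
      have h1 : ∀ n, Φ.block l (g n) φ = ∫ y, Φ.blockFun l (g n) y * φ y := fun n =>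
        (hC l (g n) (hfin n l)).2.2.2 φ
      simp_rw [h1]
      refine tendsto_integral_of_dominated_convergence (fun y => B.toReal * ‖φ y‖) (fun n => ?_)
        (φ.integrable.norm.const_mul _) (fun n => Eventually.of_forall fun y => ?_)
        (Eventually.of_forall fun y => (hlimF y).mul_const _)
      · exact (hmeas n).aestronglyMeasurable.mul φ.continuous.aestronglyMeasurable
      · rw [norm_mul]
        gcongr
        rw [← toReal_enorm]
        exact ENNReal.toReal_mono hBtop (hb n y)
    refine (distNorm_le _ hrep).trans ((morreyNorm_le_of_tendsto hq0 lam hmeas hlimF).trans_eq ?_)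
    exact congrArg (fun w => liminf w atTop)
      (funext fun n => (Φ.distNorm_block_eq hq lam (hfin n l)).symm)
  calc bmmNorm Φ q lam s r (Submodule.Quotient.mk S)
      ≤ seqNorm r fun l : ℤ => liminf (fun n =>
          ENNReal.ofReal ((2 : ℝ) ^ ((l : ℝ) * s)) * D n l) atTop := by
        refine seqNorm_mono r fun l => ?_
        rw [ENNReal.liminf_const_mul_of_ne_top ENNReal.ofReal_ne_top]
        gcongr
        exact hblock l
    _ ≤ liminf (fun n => bmmNorm Φ q lam s r (g n)) atTop := seqNorm_liminf_le hr _
    _ ≤ liminf (fun _ : ℕ => ENNReal.ofReal A) atTop :=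
        liminf_le_liminf (Eventually.of_forall hA)
    _ = ENNReal.ofReal A := liminf_const _

/-! ### Representatives in `𝒮'` of the elements of the Besov mixed-Morrey spaces -/

/-- A continuous projection of finite corank on the common kernel of finitely many continuous
linear forms. -/
theorem exists_projection {V ι : Type*} [AddCommGroup V] [Module ℂ V] [TopologicalSpace V]
    [IsTopologicalAddGroup V] [ContinuousSMul ℂ V] [Finite ι] (ℓ : ι → V →L[ℂ] ℂ) :
    ∃ P : V →L[ℂ] V, (∀ i v, ℓ i (P v) = 0) ∧ ∀ v, (∀ i, ℓ i v = 0) → P v = v := by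
  classical
  have _ := Fintype.ofFinite ι
  have h : ∀ s : Finset ι, ∃ P : V →L[ℂ] V, (∀ i ∈ s, ∀ v, ℓ i (P v) = 0) ∧
      ∀ v, (∀ i ∈ s, ℓ i v = 0) → P v = v := by
    intro s
    induction s using Finset.induction_on with
    | empty => exact ⟨ContinuousLinearMap.id ℂ V, by simp, fun v _ => rfl⟩
    | insert k s hk ih =>
      obtain ⟨P, hP1, hP2⟩ := ih
      by_cases h0 : ∀ v, ℓ k (P v) = 0
      · refine ⟨P, fun i hi v => ?_, fun v hv => hP2 v fun i hi => hv i (by simp [hi])⟩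
        rcases Finset.mem_insert.1 hi with rfl | hi
        · exact h0 v
        · exact hP1 i hi v
      · push Not at h0
        obtain ⟨w, hw⟩ := h0
        -- The vector `e` is in the range of `P` and satisfies `ℓ k e = 1`.
        set e := (ℓ k (P w))⁻¹ • P w with he
        have hek : ℓ k e = 1 := by rw [he, map_smul, smul_eq_mul, inv_mul_cancel₀ hw]
        have hes : ∀ i ∈ s, ℓ i e = 0 := fun i hi => by rw [he, map_smul, hP1 i hi, smul_zero]
        refine ⟨P - (ℓ k ∘L P).smulRight e, fun i hi v => ?_, fun v hv => ?_⟩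
        · change ℓ i (P v - ℓ k (P v) • e) = 0
          rw [map_sub, map_smul, smul_eq_mul]
          rcases Finset.mem_insert.1 hi with rfl | hi
          · rw [hek, mul_one, sub_self]
          · rw [hes i hi, hP1 i hi, mul_zero, sub_zero]
        · have h1 := hP2 v fun i hi => hv i (by simp [hi])
          change P v - ℓ k (P v) • e = v
          rw [h1, hv k (by simp), zero_smul, sub_zero]
  obtain ⟨P, h1, h2⟩ := h Finset.univ
  exact ⟨P, fun i => h1 i (Finset.mem_univ i), fun v hv => h2 v fun i _ => hv i⟩

/-- The derivatives of a Schwartz function decay faster than any power, with a constant that is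
a continuous seminorm. -/
theorem exists_norm_iteratedFDeriv_le_zpow_neg (d M k : ℕ) :
    ∃ A : 𝓢(E d, ℂ) → ℝ, Continuous A ∧ A 0 = 0 ∧ (∀ h, 0 ≤ A h) ∧
      ∀ h : 𝓢(E d, ℂ), ∀ j ≤ k, ∀ η, η ≠ 0 →
        ‖iteratedFDeriv ℝ j h η‖ ≤ A h * ‖η‖ ^ (-(M : ℤ) - j) := by
  refine ⟨fun h => ∑ j ∈ Finset.range (k + 1), SchwartzMap.seminorm ℝ (M + j) j h,
    continuous_finsetSum _ fun j _ =>
      (schwartz_withSeminorms ℝ (E d) ℂ).continuous_seminorm (M + j, j), by simp,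
    fun h => Finset.sum_nonneg fun j _ => apply_nonneg _ _, fun h j hj η hη => ?_⟩
  have hη0 : 0 < ‖η‖ := norm_pos_iff.2 hη
  have h3 : SchwartzMap.seminorm ℝ (M + j) j h ≤
      ∑ j ∈ Finset.range (k + 1), SchwartzMap.seminorm ℝ (M + j) j h :=
    Finset.single_le_sum (f := fun j => SchwartzMap.seminorm ℝ (M + j) j h)
      (fun j _ => apply_nonneg _ _) (Finset.mem_range_succ_iff.2 hj)
  have h4 := (SchwartzMap.le_seminorm ℝ (M + j) j h η).trans h3
  have h5 : (-(M : ℤ) - j) = -((M + j : ℕ) : ℤ) := by push_cast; ring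
  rw [h5, zpow_neg, zpow_natCast, ← div_eq_mul_inv, le_div_iff₀ (by positivity), mul_comm]
  exact h4

/-- The derivatives of a Schwartz function that vanishes to the order `N` at the origin, with a
constant that is a continuous seminorm. -/
theorem exists_norm_iteratedFDeriv_le_zpow (d N : ℕ) :
    ∃ A : 𝓢(E d, ℂ) → ℝ, Continuous A ∧ A 0 = 0 ∧ (∀ h, 0 ≤ A h) ∧
      ∀ h : 𝓢(E d, ℂ), (∀ j ≤ N, iteratedFDeriv ℝ j h 0 = 0) → ∀ j ≤ N, ∀ η,
        ‖iteratedFDeriv ℝ j h η‖ ≤ A h * ‖η‖ ^ ((N + 1 : ℤ) - j) := by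
  refine ⟨fun h => SchwartzMap.seminorm ℝ 0 (N + 1) h,
    (schwartz_withSeminorms ℝ (E d) ℂ).continuous_seminorm (0, N + 1), by simp,
    fun h => apply_nonneg _ _, fun h h0 j hj η => ?_⟩
  refine (norm_iteratedFDeriv_le_of_vanishing h h0 (j := j) (k := N + 1 - j)
    (by omega) η).trans_eq ?_
  rw [← zpow_natCast, Nat.cast_sub (by omega)]
  push_cast
  rfl

/-- The kernels of the symbols `a(2^{-l} ·) h` decay faster than any given power of `2^l`, both
for `l → ∞` and for `l → -∞`, if `h` vanishes to a high order at the origin. -/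
theorem IsAnnular.exists_lintegral_fourier_le_of_vanishing {d : ℕ} {a : E d → ℂ}
    (ha : IsAnnular a) (t : ℝ) :
    ∃ (N : ℕ) (p : 𝓢(E d, ℂ) → ℝ), Continuous p ∧ p 0 = 0 ∧ (∀ h, 0 ≤ p h) ∧
      ∀ h : 𝓢(E d, ℂ), (∀ j ≤ N, iteratedFDeriv ℝ j h 0 = 0) → ∀ l : ℤ,
        ∫⁻ x, ‖𝓕 (fun η => BesovMixedMorrey.dilate a l η * h η) x‖ₑ ≤
          ENNReal.ofReal (p h * (2 ^ (-(l * t)) * (1 / 2) ^ l.natAbs)) := by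
  obtain ⟨M, hM⟩ := exists_nat_ge (t + 1)
  obtain ⟨n, hn⟩ := exists_nat_ge (-t)
  obtain ⟨C₁, hC₁⟩ := ha.exists_lintegral_fourier_le (-(M : ℤ))
  obtain ⟨C₂, hC₂⟩ := ha.exists_lintegral_fourier_le ((n + d + 1 : ℕ) + 1 : ℤ)
  obtain ⟨A₁, hA₁c, hA₁z, hA₁0, hA₁⟩ := exists_norm_iteratedFDeriv_le_zpow_neg d M (d + 1)
  obtain ⟨A₂, hA₂c, hA₂z, hA₂0, hA₂⟩ := exists_norm_iteratedFDeriv_le_zpow d (n + d + 1)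
  have hexp : ∀ l : ℤ, (2 : ℝ) ^ (-(l * t)) * (1 / 2) ^ l.natAbs = 2 ^ (-(l * t) - |(l : ℝ)|) := by
    intro l
    rw [sub_eq_add_neg, Real.rpow_add two_pos, Real.rpow_neg two_pos.le |(l : ℝ)|, one_div, inv_pow,
      ← Real.rpow_natCast, Nat.cast_natAbs, Int.cast_abs]
  refine ⟨n + d + 1, fun h => C₁ * A₁ h + C₂ * A₂ h, by fun_prop, by simp [hA₁z, hA₂z],
    fun h => ?_, fun h h0 l => ?_⟩
  · have := hA₁0 h
    have := hA₂0 h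
    positivity
  have h₁ := hA₁0 h
  have h₂ := hA₂0 h
  rw [hexp]
  rcases le_or_gt 0 l with hl | hl
  · refine (hC₁ h (A₁ h) (h.smooth ⊤) h₁ (hA₁ h) l).trans ?_
    rw [← ENNReal.ofReal_coe_nnreal, ← ENNReal.ofReal_mul (by positivity)]
    refine ENNReal.ofReal_le_ofReal ?_
    rw [← Real.rpow_intCast, ← mul_assoc]
    have hl' : (0 : ℝ) ≤ l := by exact_mod_cast hl
    gcongr
    · have : (0 : ℝ) ≤ C₂ * A₂ h := by positivity
      linarith
    · exact one_le_two
    · rw [abs_of_nonneg hl']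
      push_cast
      nlinarith
  · refine (hC₂ h (A₂ h) (h.smooth ⊤) h₂ (fun j hj η _ => hA₂ h h0 j (by omega) η) l).trans ?_
    rw [← ENNReal.ofReal_coe_nnreal, ← ENNReal.ofReal_mul (by positivity)]
    refine ENNReal.ofReal_le_ofReal ?_
    rw [← Real.rpow_intCast, ← mul_assoc]
    have hl' : (l : ℝ) ≤ 0 := by exact_mod_cast hl.le
    gcongr
    · have : (0 : ℝ) ≤ C₁ * A₁ h := by positivity
      linarith
    · exact one_le_two
    · rw [abs_of_nonpos hl']
      push_cast
      have : (0 : ℝ) ≤ d := Nat.cast_nonneg d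
      nlinarith

theorem summable_half_pow_natAbs : Summable fun l : ℤ => (1 / 2 : ℝ) ^ l.natAbs := by
  refine Summable.of_nat_of_neg ?_ ?_ <;>
  simpa using summable_geometric_two

namespace DyadicPartition

variable {d : ℕ} (Φ : DyadicPartition d)

/-- The values of the blocks are bounded in terms of the kernels of the multipliers applied to the
test function. -/
theorem exists_enorm_block_apply_le {q : Fin d → ℝ} (hq : ∀ i, 1 ≤ q i) (lam : Fin d → ℝ) :
    ∃ C : ℝ≥0, ∀ (l : ℤ) (g : SModP d), distNorm (morreyNorm q lam) (Φ.block l g) < ∞ →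
      ∀ φ : 𝓢(E d, ℂ), ‖Φ.block l g φ‖ₑ ≤
        C * ENNReal.ofReal ((2 : ℝ) ^ ((l : ℝ) * ∑ i, (1 - lam i) / q i)) *
          distNorm (morreyNorm q lam) (Φ.block l g) *
          ∫⁻ x, ‖𝓕 (fun η => dilate Φ.wide l η * (𝓕⁻ φ : 𝓢(E d, ℂ)) η) x‖ₑ := by
  obtain ⟨C, hC⟩ := Φ.exists_blockFun hq lam
  refine ⟨C, fun l g hg φ => ?_⟩
  obtain ⟨-, hb, -, happ⟩ := hC l g hg
  rw [← block_transposeMul_wide, happ]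
  refine (enorm_integral_le_lintegral_enorm _).trans ?_
  rw [← lintegral_const_mul']
  · refine lintegral_mono fun y => ?_
    dsimp only
    rw [enorm_mul, transposeMul_coe (Φ.isAnnular_wide.dilate l).hasTemperateGrowth]
    gcongr
    exact hb y
  · exact ENNReal.mul_ne_top (ENNReal.mul_ne_top ENNReal.coe_ne_top ENNReal.ofReal_ne_top) hg.ne

/-- After the projection on the test functions with vanishing moments up to a high order, which
does not change the test functions that enter in the blocks, the series of the blocks converges
absolutely. -/
theorem exists_norm_block_projection_le {q : Fin d → ℝ} (hq : ∀ i, 1 ≤ q i) (lam : Fin d → ℝ)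
    (s : ℝ) {r : ℝ≥0∞} (hr : 1 ≤ r) :
    ∃ (P : 𝓢(E d, ℂ) →L[ℂ] 𝓢(E d, ℂ)) (p : 𝓢(E d, ℂ) → ℝ), Continuous p ∧ p 0 = 0 ∧
      (∀ φ, 0 ≤ p φ) ∧
      (∀ k φ, P (transposeMul (Φ.symbol k) φ) = transposeMul (Φ.symbol k) φ) ∧
      ∀ g, bmmNorm Φ q lam s r g < ∞ → ∀ (l : ℤ) φ,
        ‖Φ.block l g (P φ)‖ ≤ p φ * (bmmNorm Φ q lam s r g).toReal * (1 / 2) ^ l.natAbs := by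
  set S := ∑ i, (1 - lam i) / q i with hS
  obtain ⟨C, hC⟩ := Φ.exists_enorm_block_apply_le hq lam
  obtain ⟨N, p, hp, hp0, hp1, hbound⟩ :=
    Φ.isAnnular_wide.exists_lintegral_fourier_le_of_vanishing (S - s)
  -- The linear forms are the moments of order at most `N`.
  obtain ⟨P, hP, hP'⟩ := exists_projection
    fun i : Σ j : Fin (N + 1), Fin j → Fin d =>
      (polyDist (∏ k, MvPolynomial.X (i.2 k)) : 𝓢(E d, ℂ) →L[ℂ] ℂ)
  refine ⟨P, fun φ => C * p (𝓕⁻ (P φ)), ?_, ?_, fun φ => ?_, fun k φ => ?_, fun g hg l φ => ?_⟩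
  · exact continuous_const.mul (hp.comp
      ((FourierTransform.fourierInvCLM ℂ 𝓢(E d, ℂ)).continuous.comp P.continuous))
  · have : (𝓕⁻ (0 : 𝓢(E d, ℂ)) : 𝓢(E d, ℂ)) = 0 :=
      map_zero (FourierTransform.fourierInvCLM ℂ 𝓢(E d, ℂ))
    simp only [map_zero, this, hp0, mul_zero]
  · have := hp1 (𝓕⁻ (P φ))
    positivity
  · refine hP' _ fun i => ?_
    have h1 := integral_fourier_mul_polyFun (∏ k, MvPolynomial.X (i.2 k))
      (SchwartzMap.smulLeftCLM ℂ (Φ.symbol k) (𝓕⁻ φ)) ?_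
    · exact h1
    · filter_upwards [Φ.symbol_eventually_zero k] with x hx
      rw [SchwartzMap.smulLeftCLM_apply_apply (Φ.symbol_hasTemperateGrowth k), hx]
      simp
  · have hvan : ∀ j ≤ N, iteratedFDeriv ℝ j (𝓕⁻ (P φ) : 𝓢(E d, ℂ)) 0 = 0 := fun j hj =>
      iteratedFDeriv_fourierInv_zero fun I => hP ⟨⟨j, Nat.lt_succ_of_le hj⟩, I⟩ φ
    have h1 := hC l g (distNorm_lt_top_of_bmmNorm_lt_top Φ hr hg l) (P φ)
    have h2 := hbound _ hvan l
    have h3 : distNorm (morreyNorm q lam) (Φ.block l g) ≤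
        ENNReal.ofReal ((2 : ℝ) ^ (-((l : ℝ) * s))) * bmmNorm Φ q lam s r g := by
      have h4 := le_seqNorm hr (fun l : ℤ => ENNReal.ofReal ((2 : ℝ) ^ ((l : ℝ) * s)) *
        distNorm (morreyNorm q lam) (Φ.block l g)) l
      calc _ = ENNReal.ofReal ((2 : ℝ) ^ (-((l : ℝ) * s)) * (2 : ℝ) ^ ((l : ℝ) * s)) *
            distNorm (morreyNorm q lam) (Φ.block l g) := by
            rw [← Real.rpow_add two_pos, neg_add_cancel, Real.rpow_zero, ENNReal.ofReal_one,
              one_mul]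
        _ ≤ _ := by
            rw [ENNReal.ofReal_mul (by positivity), mul_assoc]
            gcongr
            exact h4
    have hp1' := hp1 (𝓕⁻ (P φ))
    rw [← ENNReal.ofReal_le_ofReal_iff (by positivity), ofReal_norm]
    calc _ ≤ C * ENNReal.ofReal ((2 : ℝ) ^ ((l : ℝ) * S)) *
          (ENNReal.ofReal ((2 : ℝ) ^ (-((l : ℝ) * s))) * bmmNorm Φ q lam s r g) *
          ENNReal.ofReal (p (𝓕⁻ (P φ)) * (2 ^ (-(l * (S - s))) * (1 / 2) ^ l.natAbs)) := by
          refine h1.trans ?_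
          gcongr
      _ = C * ENNReal.ofReal ((2 : ℝ) ^ ((l : ℝ) * S)) *
          (ENNReal.ofReal ((2 : ℝ) ^ (-((l : ℝ) * s))) *
            ENNReal.ofReal (bmmNorm Φ q lam s r g).toReal) *
          ENNReal.ofReal (p (𝓕⁻ (P φ)) * (2 ^ (-(l * (S - s))) * (1 / 2) ^ l.natAbs)) := by
          rw [ENNReal.ofReal_toReal hg.ne]
      _ = ENNReal.ofReal (C * p (𝓕⁻ (P φ)) * (bmmNorm Φ q lam s r g).toReal *
            (1 / 2) ^ l.natAbs * ((2 : ℝ) ^ ((l : ℝ) * S) * (2 : ℝ) ^ (-((l : ℝ) * s)) *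
              2 ^ (-(l * (S - s))))) := by
          rw [← ENNReal.ofReal_coe_nnreal, ← ENNReal.ofReal_mul (by positivity),
            ← ENNReal.ofReal_mul (by positivity), ← ENNReal.ofReal_mul (by positivity),
            ← ENNReal.ofReal_mul (by positivity)]
          congr 1
          ring
      _ = _ := by
          rw [← Real.rpow_add two_pos, ← Real.rpow_add two_pos]
          have : (l : ℝ) * S + -((l : ℝ) * s) + -(l * (S - s)) = 0 := by ring
          rw [this, Real.rpow_zero, mul_one]

/-- The Besov mixed-Morrey spaces are Banach spaces, continuously included in `𝒮'/𝒫`. -/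
theorem isBanachIncludedInSModP_bmmNorm {q : Fin d → ℝ} (hq : ∀ i, 1 ≤ q i) (lam : Fin d → ℝ)
    (s : ℝ) {r : ℝ≥0∞} (hr : 1 ≤ r) : IsBanachIncludedInSModP (bmmNorm Φ q lam s r) := by
  obtain ⟨P, p, hp, hp0, hp1, hPs, hbound⟩ := Φ.exists_norm_block_projection_le hq lam s hr
  have hN := isENorm_bmmNorm Φ hq lam s hr
  set A : ℝ := ∑' l : ℤ, (1 / 2 : ℝ) ^ l.natAbs with hA
  have hb : ∀ (g : hN.Space) (l : ℤ) φ,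
      ‖Φ.block l (hN.val g) (P φ)‖ ≤ p φ * ‖g‖ * (1 / 2) ^ l.natAbs :=
    fun g l φ => hbound _ (hN.val_lt_top g) l φ
  have hsum : ∀ (g : hN.Space) φ, Summable fun l => Φ.block l (hN.val g) (P φ) := fun g φ =>
    Summable.of_norm_bounded (summable_half_pow_natAbs.mul_left _) fun l => hb g l φ
  have hnorm : ∀ (g : hN.Space) φ, ‖∑' l, Φ.block l (hN.val g) (P φ)‖ ≤ p φ * A * ‖g‖ := by
    intro g φ
    refine (tsum_of_norm_bounded (summable_half_pow_natAbs.hasSum.mul_left _)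
      fun l => hb g l φ).trans_eq ?_
    ring
  let L₀ : hN.Space → 𝓢(E d, ℂ) →ₗ[ℂ] ℂ := fun g =>
    { toFun := fun φ => ∑' l, Φ.block l (hN.val g) (P φ)
      map_add' := fun φ ψ => by
        rw [← (hsum g φ).tsum_add (hsum g ψ)]
        simp_rw [map_add]
      map_smul' := fun c φ => by
        rw [RingHom.id_apply, ← tsum_const_smul'' c]
        simp_rw [map_smul] }
  have hL₀ : ∀ g φ, L₀ g φ = ∑' l, Φ.block l (hN.val g) (P φ) := fun g φ => rfl
  have hLc : ∀ g, Continuous (L₀ g) := fun g =>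
    continuous_of_norm_le (L₀ g) (p := fun φ => p φ * A * ‖g‖) (by fun_prop) (by simp [hp0])
      (hnorm g)
  let L : hN.Space →ₗ[ℂ] 𝓢'(E d, ℂ) :=
    { toFun := fun g => (⟨L₀ g, hLc g⟩ : 𝓢(E d, ℂ) →L[ℂ] ℂ)
      map_add' := fun g h => by
        ext φ
        change L₀ (g + h) φ = L₀ g φ + L₀ h φ
        rw [hL₀, hL₀, hL₀, ← (hsum g φ).tsum_add (hsum h φ)]
        simp_rw [map_add]
        rfl
      map_smul' := fun c g => by
        ext φ
        change L₀ (c • g) φ = c • L₀ g φ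
        rw [hL₀, hL₀, ← tsum_const_smul'' c]
        simp_rw [map_smul]
        rfl }
  have hL : ∀ g φ, L g φ = ∑' l, Φ.block l (hN.val g) (P φ) := fun g φ => rfl
  refine hN.isBanachIncludedInSModP L (fun g => ?_) (p := fun φ => p φ * A) (by fun_prop)
    (by simp [hp0]) (fun φ => ?_) (fun g φ => hnorm g φ) fun T S B hT hB => ?_
  · obtain ⟨T, hT⟩ := Submodule.Quotient.mk_surjective _ (hN.val g)
    rw [← hT, Submodule.Quotient.eq]
    refine Φ.mem_polynomials_of_blockDist_eq_zero fun k => ?_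
    rw [map_sub, sub_eq_zero]
    ext φ
    -- Only the blocks with `|l - k| ≤ 1` contribute to the `k`-th block of `L g`.
    rw [blockDist_apply, hL, ← hT]
    simp_rw [hPs, block_mk, blockDist_apply]
    rw [tsum_eq_sum (s := {k - 1, k, k + 1}), ← apply_transposeMul_wide,
      transposeMul_transposeMul (Φ.isAnnular_wide.dilate k).hasTemperateGrowth
        (Φ.symbol_hasTemperateGrowth k), mul_comm, symbol_mul_dilate_wide]
    intro l hl
    rw [transposeMul_transposeMul (Φ.symbol_hasTemperateGrowth l) (Φ.symbol_hasTemperateGrowth k),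
      Φ.symbol_mul_symbol_eq_zero hl, transposeMul_zero, map_zero]
  · have := hp1 φ
    have : 0 ≤ A := tsum_nonneg fun l => by positivity
    positivity
  · exact bmmNorm_le_of_tendsto Φ hq lam s hr hT hB

end DyadicPartition

/-! ### Distributions that depend on the first variables only -/

theorem partialIntegral_eq {d m : ℕ} (g : 𝓢(E (d + m), ℂ)) :
    partialIntegral d m g = 𝓕 (SchwartzMap.compCLM ℂ (incl_hasTemperateGrowth d m)
      ⟨1, 1, fun x => by rw [norm_incl]; linarith⟩ (𝓕⁻ g) : 𝓢(E d, ℂ)) := by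
  change 𝓕⁻ (SchwartzMap.compCLM ℂ (incl_hasTemperateGrowth d m)
      ⟨1, 1, fun x => by rw [norm_incl]; linarith⟩ (𝓕 g) : 𝓢(E d, ℂ)) = _
  refine DFunLike.coe_injective ?_
  rw [SchwartzMap.fourierInv_coe, SchwartzMap.fourier_coe, Real.fourierInv_eq_fourier_comp_neg]
  congr 1
  funext x
  change 𝓕 g (incl d m (-x)) = (𝓕⁻ g : 𝓢(E (d + m), ℂ)) (incl d m x)
  rw [SchwartzMap.fourierInv_apply_eq, map_neg]
  rfl

/-- The Fourier transform of the partial integral is the restriction of the Fourier transform, so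
that the multipliers are restricted as well. -/
theorem partialIntegral_transposeMul {d m : ℕ} {μ : E (d + m) → ℂ} (hμ : μ.HasTemperateGrowth)
    (hμ' : (μ ∘ incl d m).HasTemperateGrowth) (g : 𝓢(E (d + m), ℂ)) :
    partialIntegral d m (transposeMul μ g) =
      transposeMul (μ ∘ incl d m) (partialIntegral d m g) := by
  rw [partialIntegral_eq, partialIntegral_eq, transposeMul_def, transposeMul_def,
    FourierTransform.fourierInv_fourier_eq, FourierTransform.fourierInv_fourier_eq]
  congr 1
  ext x
  rw [SchwartzMap.smulLeftCLM_apply_apply hμ']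
  change SchwartzMap.smulLeftCLM ℂ μ (𝓕⁻ g) (incl d m x) = μ (incl d m x) • (𝓕⁻ g) (incl d m x)
  rw [SchwartzMap.smulLeftCLM_apply_apply hμ]

theorem continuous_proj (d m : ℕ) : Continuous (proj d m) :=
  (LipschitzWith.of_dist_le' (K := 1) fun x y => by
    rw [one_mul]
    exact dist_proj_le x y).continuous

/-- A distribution given by a bounded function `F(x')` is given by the same function when it is
considered as a distribution of `(x', x'')`. -/
theorem represents_cylinder {d m : ℕ} {F : E d → ℂ} {v : 𝓢'(E d, ℂ)} (hF : Measurable F)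
    {B : ℝ≥0∞} (hB : B ≠ ∞) (hb : ∀ y, ‖F y‖ₑ ≤ B)
    (hv : ∀ φ : 𝓢(E d, ℂ), v φ = ∫ y, F y * φ y) :
    Represents (F ∘ proj d m) (cylinder d m v) := by
  have hm : Measurable (F ∘ proj d m) := hF.comp (continuous_proj d m).measurable
  refine ⟨locallyIntegrable_of_bounded hm hB fun y => hb _, fun g _ => ?_⟩
  have hint : Integrable fun x => (F ∘ proj d m) x * g x := by
    refine g.integrable.bdd_mul (c := B.toReal) hm.aestronglyMeasurable
      (Eventually.of_forall fun x => ?_)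
    rw [← toReal_enorm]
    exact ENNReal.toReal_mono hB (hb _)
  have hint' : Integrable (fun p : E d × E m =>
      (F ∘ proj d m) (glue p.1 p.2) * g (glue p.1 p.2)) (volume.prod volume) :=
    (glue_measurePreserving d m).integrable_comp_of_integrable hint
  rw [cylinder_apply, hv, ← (glue_measurePreserving d m).integral_comp
    (glue_measurableEmbedding d m), Measure.volume_eq_prod, integral_prod _ hint']
  refine integral_congr_ae (Eventually.of_forall fun y => ?_)
  dsimp only
  simp only [Function.comp_apply, proj_glue]
  rw [partialIntegral_apply, ← integral_const_mul]

/-- The Fourier multipliers `a(2^{-l} ·)` are uniformly bounded on the mixed-Morrey spaces, and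
their values are bounded functions. -/
theorem IsAnnular.exists_morreyNorm_mollify_le {d : ℕ} {a : E d → ℂ} (ha : IsAnnular a)
    {q : Fin d → ℝ} (hq : ∀ i, 1 ≤ q i) (lam : Fin d → ℝ) :
    ∃ C : ℝ≥0, ∀ (l : ℤ) (T : 𝓢'(E d, ℂ)), distNorm (morreyNorm q lam) T < ∞ →
      Measurable (mollify (ha.kernel l) T) ∧
      (∃ B : ℝ≥0∞, B ≠ ∞ ∧ ∀ y, ‖mollify (ha.kernel l) T y‖ₑ ≤ B) ∧
      (∀ φ, T (transposeMul (BesovMixedMorrey.dilate a l) φ) =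
        ∫ y, mollify (ha.kernel l) T y * φ y) ∧
      morreyNorm q lam (mollify (ha.kernel l) T) ≤ C * distNorm (morreyNorm q lam) T := by
  obtain ⟨C, hC⟩ := ha.exists_lintegral_fourier_dilate_le
  obtain ⟨C', hC'⟩ := ha.exists_bound_mollify (d - ∑ i, (1 - lam i) / q i)
  refine ⟨C, fun l T hT => ?_⟩
  obtain ⟨f, hf, hfin⟩ := exists_represents_of_distNorm_lt_top hT
  have hd : distNorm (morreyNorm q lam) T = morreyNorm q lam f :=
    distNorm_eq (fun _ _ h => morreyNorm_congr_ae (fun i => zero_le_one.trans (hq i)) lam h) hf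
  have hgr := morreyNorm_hasGrowth hq lam hf.1.aestronglyMeasurable
  have hA := ENNReal.mul_ne_top
    (ENNReal.ofReal_ne_top (r := (2 ^ ∑ i, (1 - 1 / q i) : ℝ))) hfin.ne
  refine ⟨hf.measurable_mollify hgr hA _, ⟨_, ?_, hC' l T f _ hf hgr hA⟩,
    hf.apply_transposeMul hgr hA (ha.dilate l).contDiff (ha.dilate l).hasCompactSupport, ?_⟩
  · exact ENNReal.mul_ne_top (ENNReal.mul_ne_top ENNReal.coe_ne_top ENNReal.ofReal_ne_top) hA
  · refine (morreyNorm_convolution_le hq lam (K := ha.kernel l) hf.1.aestronglyMeasurable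
      (ha.kernel l).continuous.measurable fun y => ?_).trans ?_
    · refine (hf.enorm_mollify_le hgr hA _ y).trans_eq ?_
      rw [← lintegral_add_left_eq_self _ y]
      refine lintegral_congr fun z => ?_
      rw [add_sub_cancel_left, mul_comm]
    · rw [hd]
      gcongr
      rw [IsAnnular.kernel, kernel_coe]
      exact hC l

namespace DyadicPartition

variable {d m : ℕ} (Φ : DyadicPartition d) (Φ' : DyadicPartition (d + m))

/-- The restriction of `φ` to `ℝ^d`. -/
def restrict (m : ℕ) {d : ℕ} (Φ' : DyadicPartition (d + m)) (η : E d) : ℂ :=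
  (Φ'.φ (incl d m η) : ℂ)

theorem isAnnular_restrict : IsAnnular (restrict m Φ') := by
  have hc : Continuous (incl d m) := LinearMap.continuous_of_finiteDimensional _
  refine ⟨Complex.ofRealCLM.contDiff.comp (Φ'.φ_smooth.comp
    (LinearMap.toContinuousLinearMap (incl d m)).contDiff), 3 / 4, 8 / 3, by norm_num, ?_⟩
  have hs : IsClosed {η : E d | 3 / 4 ≤ ‖η‖ ∧ ‖η‖ ≤ 8 / 3} :=
    (isClosed_le continuous_const continuous_norm).inter
      (isClosed_le continuous_norm continuous_const)
  refine closure_minimal (fun η hη => ?_) hs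
  have h := Φ'.φ_supp (subset_tsupport _ fun h0 : Φ'.φ (incl d m η) = 0 => hη (by
    rw [restrict, h0, Complex.ofReal_zero]))
  rwa [Set.mem_ofPred_eq, norm_incl] at h

theorem dilate_restrict (l : ℤ) : dilate (restrict m Φ') l = Φ'.symbol l ∘ incl d m := by
  funext η
  rw [dilate, restrict, Function.comp_apply, symbol, map_smul]

theorem dilate_wide_mul_dilate_restrict (l : ℤ) :
    dilate Φ.wide l * dilate (restrict m Φ') l = dilate (restrict m Φ') l := by
  funext η
  rw [Pi.mul_apply]
  by_cases h : dilate (restrict m Φ') l η = 0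
  · rw [h, mul_zero]
  · rw [Φ.dilate_wide_eq_one, one_mul]
    rw [dilate_restrict, Function.comp_apply] at h
    have h1 := Φ'.mem_annulus_of_symbol_ne_zero h
    rwa [← map_smul, norm_incl] at h1

/-- The blocks of a distribution of the first variables are bounded by the neighbouring blocks
of this distribution on the lower dimensional space. -/
theorem exists_distNorm_block_cylinder_le {q β : Fin (d + m) → ℝ} (hq : ∀ i, 1 ≤ q i)
    {lam : Fin d → ℝ}
    (h : ∑ i, (1 - β i) / q i = ∑ i, (1 - lam i) / q (Fin.castAdd m i)) :
    ∃ C : ℝ≥0, ∀ (u : 𝓢'(E d, ℂ)) (D : ℤ → ℝ≥0∞),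
      (∀ l, D l = distNorm (morreyNorm (fun i => q (Fin.castAdd m i)) lam)
        (Φ.block l (Submodule.Quotient.mk u))) → (∀ l, D l < ∞) → ∀ l,
      distNorm (morreyNorm q β) (Φ'.block l (Submodule.Quotient.mk (cylinder d m u))) ≤
        C * (D (l - 1) + (D l + D (l + 1))) := by
  have hq' : ∀ i, 1 ≤ q (Fin.castAdd m i) := fun i => hq _
  have ha := isAnnular_restrict Φ'
  obtain ⟨C, hC⟩ := ha.exists_morreyNorm_mollify_le hq' lam
  refine ⟨(2 ^ ∑ i, 1 / q (Fin.natAdd d i) : ℝ).toNNReal * C, fun u D hD hfin l => ?_⟩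
  set g : SModP d := Submodule.Quotient.mk u with hg
  set w : 𝓢'(E d, ℂ) := Φ.block (l - 1) g + (Φ.block l g + Φ.block (l + 1) g) with hw
  have hwD : distNorm (morreyNorm (fun i => q (Fin.castAdd m i)) lam) w ≤
      D (l - 1) + (D l + D (l + 1)) := by
    rw [hD, hD, hD]
    refine (distNorm_add_le hq' lam _ _).trans ?_
    gcongr
    exact distNorm_add_le hq' lam _ _
  have hwfin := hwD.trans_lt
    (ENNReal.add_lt_top.2 ⟨hfin _, ENNReal.add_lt_top.2 ⟨hfin _, hfin _⟩⟩)
  obtain ⟨hm, ⟨B, hB, hb⟩, happ, hnorm⟩ := hC l w hwfin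
  have hwu : ∀ φ, w φ = u (transposeMul (dilate Φ.wide l) φ) := by
    intro φ
    rw [Φ.apply_transposeMul_wide, Finset.sum_insert (by simp; omega),
      Finset.sum_insert (by simp), Finset.sum_singleton]
    rfl
  have hblock : Φ'.block l (Submodule.Quotient.mk (cylinder d m u)) =
      cylinder d m (TemperedDistribution.fourierMultiplierCLM ℂ (dilate (restrict m Φ') l) u) := by
    ext φ
    rw [block_mk, blockDist_apply, cylinder_apply, cylinder_apply, fourierMultiplierCLM_apply_eq,
      partialIntegral_transposeMul (Φ'.symbol_hasTemperateGrowth l), dilate_restrict]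
    rw [← dilate_restrict]
    exact (ha.dilate l).hasTemperateGrowth
  have hrep : Represents (mollify (ha.kernel l) w ∘ proj d m)
      (Φ'.block l (Submodule.Quotient.mk (cylinder d m u))) := by
    rw [hblock]
    refine represents_cylinder hm hB hb fun φ => ?_
    rw [← happ, hwu, transposeMul_transposeMul (Φ.isAnnular_wide.dilate l).hasTemperateGrowth
      (ha.dilate l).hasTemperateGrowth, dilate_wide_mul_dilate_restrict]
    rfl
  refine (distNorm_le _ hrep).trans ?_
  refine (morreyNorm_comp_proj_le (fun i => one_pos.trans_le (hq i)) h _).trans ?_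
  rw [ENNReal.coe_mul, mul_assoc]
  change ENNReal.ofReal _ * _ ≤ ENNReal.ofReal _ * _
  gcongr
  exact hnorm.trans (by gcongr)

theorem bmmNorm_cylinder_lt_top {q β : Fin (d + m) → ℝ} (hq : ∀ i, 1 ≤ q i)
    {lam : Fin d → ℝ} {r : ℝ≥0∞} (hr : 1 ≤ r) (s : ℝ)
    (h : ∑ i, (1 - β i) / q i = ∑ i, (1 - lam i) / q (Fin.castAdd m i)) {u : 𝓢'(E d, ℂ)}
    (hu : bmmNorm Φ (fun i => q (Fin.castAdd m i)) lam s r (Submodule.Quotient.mk u) < ∞) :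
    bmmNorm Φ' q β s r (Submodule.Quotient.mk (cylinder d m u)) < ∞ := by
  obtain ⟨C, hC⟩ := exists_distNorm_block_cylinder_le Φ Φ' hq h
  set D : ℤ → ℝ≥0∞ := fun l => distNorm (morreyNorm (fun i => q (Fin.castAdd m i)) lam)
    (Φ.block l (Submodule.Quotient.mk u)) with hD
  have hle := hC u D (fun _ => rfl) (distNorm_lt_top_of_bmmNorm_lt_top Φ hr hu)
  set b : ℤ → ℝ≥0∞ := fun l => ENNReal.ofReal ((2 : ℝ) ^ ((l : ℝ) * s)) * D l with hb
  have hbN : seqNorm r b < ∞ := hu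
  -- The weights `2^{ls}` and `2^{(l+k)s}` differ by a factor that does not depend on `l`.
  have hshift : ∀ l k : ℤ, ENNReal.ofReal ((2 : ℝ) ^ ((l : ℝ) * s)) * D (l + k) =
      ENNReal.ofReal ((2 : ℝ) ^ (-(k : ℝ) * s)) * b (l + k) := by
    intro l k
    simp only [hb]
    rw [← mul_assoc, ← ENNReal.ofReal_mul (by positivity), ← Real.rpow_add two_pos]
    congr 4
    push_cast
    ring
  have hfin : ∀ k : ℤ, seqNorm r (fun l => ENNReal.ofReal ((2 : ℝ) ^ (-(k : ℝ) * s)) * b (l + k))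
      < ∞ := by
    intro k
    rw [seqNorm_const_mul hr, seqNorm_comp_add]
    exact ENNReal.mul_lt_top ENNReal.ofReal_lt_top hbN
  have h1 : bmmNorm Φ' q β s r (Submodule.Quotient.mk (cylinder d m u)) ≤
      seqNorm r fun l => C * (ENNReal.ofReal ((2 : ℝ) ^ (-((-1 : ℤ) : ℝ) * s)) * b (l + -1) +
        (ENNReal.ofReal ((2 : ℝ) ^ (-((0 : ℤ) : ℝ) * s)) * b (l + 0) +
          ENNReal.ofReal ((2 : ℝ) ^ (-((1 : ℤ) : ℝ) * s)) * b (l + 1))) := by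
    refine seqNorm_mono r fun l => ?_
    rw [← hshift, ← hshift, ← hshift, ← mul_add, ← mul_add, mul_left_comm, add_zero]
    gcongr
    exact hle l
  refine h1.trans_lt ?_
  rw [seqNorm_const_mul hr]
  refine ENNReal.mul_lt_top ENNReal.coe_lt_top ((seqNorm_add_le hr _ _).trans_lt ?_)
  refine ENNReal.add_lt_top.2 ⟨hfin _, (seqNorm_add_le hr _ _).trans_lt ?_⟩
  exact ENNReal.add_lt_top.2 ⟨hfin _, hfin _⟩

end DyadicPartition

end BesovMixedMorrey

end

open BesovMixedMorrey in
theorem theorem1p1 :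
    (∀ (d : ℕ) (_ : 0 < d) (Φ : DyadicPartition d),
      -- (i)
      (∀ (q lam : Fin d → ℝ), (∀ i, 1 ≤ q i) → (∀ i, 0 ≤ lam i ∧ lam i < 1) →
        ∃ C : ℝ≥0, ∀ (l : ℤ) (f : SModP d), distNorm (morreyNorm q lam) (Φ.block l f) < ∞ →
          distNorm supNorm (Φ.block l f) ≤
            C * ENNReal.ofReal ((2 : ℝ) ^ ((l : ℝ) * ∑ i, (1 - lam i) / q i)) *
              distNorm (morreyNorm q lam) (Φ.block l f)) ∧
      -- (ii.1)
      (∀ (q r lam mu : Fin d → ℝ) (a : ℝ≥0∞) (σ : ℝ), 1 ≤ a →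
        (∀ i, 1 ≤ q i) → (∀ i, q i ≤ r i) →
        (∀ i, 0 ≤ lam i ∧ lam i < 1) → (∀ i, 0 ≤ mu i ∧ mu i < 1) →
        (∀ i, mu i / r i ≤ lam i / q i) →
        (∀ i, (1 - lam i) / q i = (1 - mu i) / r i) →
        ContinuouslyIncluded (bmmNorm Φ r mu σ a) (bmmNorm Φ q lam σ a)) ∧
      -- (ii.2)
      (∀ (q lam : Fin d → ℝ) (a b : ℝ≥0∞) (σ : ℝ), 1 ≤ a → a ≤ b →
        (∀ i, 1 ≤ q i) → (∀ i, 0 ≤ lam i ∧ lam i < 1) →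
        ContinuouslyIncluded (bmmNorm Φ q lam σ a) (bmmNorm Φ q lam σ b)) ∧
      -- (iii)
      (∀ (q lam : Fin d → ℝ) (r : ℝ≥0∞) (s : ℝ), 1 ≤ r →
        (∀ i, 1 ≤ q i) → (∀ i, 0 ≤ lam i ∧ lam i < 1) →
        ContinuouslyIncluded (bmmNorm Φ q lam s r)
          (besovSupNorm Φ (s - ∑ i, (1 - lam i) / q i) r)) ∧
      -- (iv)
      (∀ (q lam : Fin d → ℝ) (r : ℝ≥0∞) (s θ : ℝ), 1 ≤ r → 0 < θ → θ < 1 →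
        (∀ i, 1 ≤ q i) → (∀ i, 0 ≤ lam i ∧ lam i < 1) →
        ContinuouslyIncluded (bmmNorm Φ q lam s r)
          (bmmNorm Φ (fun i => q i / θ) lam (s - (∑ i, (1 - lam i) / q i) * (1 - θ)) r)) ∧
      -- (v)
      (∀ (q lam : Fin d → ℝ) (r : ℝ≥0∞) (s : ℝ), 1 ≤ r →
        (∀ i, 1 ≤ q i) → (∀ i, 0 ≤ lam i ∧ lam i < 1) →
        IsBanachIncludedInSModP (bmmNorm Φ q lam s r))) ∧
    -- (vi)
    (∀ (d m : ℕ) (_ : 0 < d) (_ : 0 < m) (Φ : DyadicPartition d) (Φ' : DyadicPartition (d + m))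
      (q β : Fin (d + m) → ℝ) (lam : Fin d → ℝ) (r : ℝ≥0∞) (s : ℝ), 1 ≤ r →
      (∀ i, 1 ≤ q i) → (∀ i, 0 ≤ lam i ∧ lam i < 1) → (∀ i, 0 ≤ β i ∧ β i < 1) →
      ∑ i, (1 - β i) / q i = ∑ i, (1 - lam i) / q (Fin.castAdd m i) →
      ∀ u : 𝓢'(E d, ℂ),
        bmmNorm Φ (fun i => q (Fin.castAdd m i)) lam s r (Submodule.Quotient.mk u) < ∞ →
        bmmNorm Φ' q β s r (Submodule.Quotient.mk (cylinder d m u)) < ∞) := by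
  refine ⟨fun d _ Φ => ⟨fun q lam hq _ => Φ.exists_distNorm_supNorm_le hq lam, ?_, ?_, ?_, ?_, ?_⟩,
    ?_⟩
  · exact fun q r lam mu a σ ha hq hqr _ _ _ h =>
      bmmNorm_continuouslyIncluded_of_le Φ ha σ hq hqr h
  · exact fun q lam a b σ ha hab _ _ => bmmNorm_continuouslyIncluded_seq Φ ha hab σ
  · exact fun q lam r s hr hq _ => bmmNorm_continuouslyIncluded_besovSupNorm Φ lam hr s hq
  · exact fun q lam r s θ hr h0 h1 hq _ =>
      bmmNorm_continuouslyIncluded_div Φ lam hr s h0 h1 hq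
  · exact fun q lam r s hr hq _ => Φ.isBanachIncludedInSModP_bmmNorm hq lam s hr
  · exact fun d m _ _ Φ Φ' q β lam r s hr hq _ _ h u hu =>
      Φ.bmmNorm_cylinder_lt_top Φ' hq hr s h hu
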